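/- Let $\mathbb{M}_2^{\mathbb R}=\mathbb F_2[\tau,\rho]$ be bigraded with $|\tau|=(0,1)$ and $|\rho|=(1,1)$. Let $\mathcal A(1)^{\mathbb R}$ be the subalgebra of the mod $2$ $\mathbb R$-motivic Steenrod algebra generated over $\mathbb{M}_2^{\mathbb R}$ by $\mathrm{Sq}^1$ and $\mathrm{Sq}^2$, of bidegrees $(1,0)$ and $(2,1)$. Explicitly, it is the $\mathbb F_2$-algebra generated by $\tau,\rho,\mathrm{Sq}^1,\mathrm{Sq}^2$ subject to $$\rho\tau=\tau\rho,\quad \mathrm{Sq}^1\tau=\tau\,\mathrm{Sq}^1+\rho,\quad \mathrm{Sq}^1\rho=\rho\,\mathrm{Sq}^1,\quad \mathrm{Sq}^2\tau=\tau\,\mathrm{Sq}^2+\tau\rho\,\mathrm{Sq}^1,\quad \mathrm{Sq}^2\rho=\rho\,\mathrm{Sq}^2,$$ $$\mathrm{Sq}^1\mathrm{Sq}^1=0,\quad \mathrm{Sq}^2\mathrm{Sq}^2=\tau\,\mathrm{Sq}^1\mathrm{Sq}^2\mathrm{Sq}^1,\quad \mathrm{Sq}^1\mathrm{Sq}^2\mathrm{Sq}^1\mathrm{Sq}^2=\mathrm{Sq}^2\mathrm{Sq}^1\mathrm{Sq}^2\mathrm{Sq}^1.$$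 Modules are bigraded left $\mathcal A(1)^{\mathbb R}$-modules and isomorphisms preserve the bigrading. The module $\mathbb{M}_2^{\mathbb R}$ has $\mathrm{Sq}^1,\mathrm{Sq}^2$ acting $\mathbb F_2[\rho]$-linearly by $\mathrm{Sq}^1(\tau^i)=i\,\rho\,\tau^{i-1}$ and $\mathrm{Sq}^2(\tau^i)=\binom i2\rho^2\tau^{i-1}$. The tensor product $M\otimes_{\mathbb{M}_2^{\mathbb R}}N$ of two modules is a module by the Cartan formulas $$\mathrm{Sq}^1(x\otimes y)=\mathrm{Sq}^1x\otimes y+x\otimes \mathrm{Sq}^1y,\qquad \mathrm{Sq}^2(x\otimes y)=\mathrm{Sq}^2x\otimes y+x\otimes \mathrm{Sq}^2y+\tau\,\mathrm{Sq}^1x\otimes \mathrm{Sq}^1y.$$ Two modules $X,Y$ are stably equivalent if $X\oplus P\cong Y\oplus Q$ for some finitely generated projective modules $P,Q$. A module $M$ that is finitely generated and free over $\mathbb{M}_2^{\mathbb R}$ is stably invertible if there is a module $N$, finitely generated and free over $\mathbb{M}_2^{\mathbb R}$, such that $M\otimes_{\mathbb{M}_2^{\mathbb R}}N$ is stably equivalent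 to $\mathbb{M}_2^{\mathbb R}$. Let $Q_0=\mathrm{Sq}^1$ and $Q_1=\mathrm{Sq}^1\mathrm{Sq}^2+\mathrm{Sq}^2\mathrm{Sq}^1$. For $\alpha\in\{Q_0,Q_1,\mathrm{Sq}^2\}$, which squares to zero on $M/(\rho,\tau)=M/(\rho M+\tau M)$, the Margolis homology $H(M/(\rho,\tau);\alpha)$ is the $\mathbb F_2$-vector space $\ker(\alpha)/\operatorname{im}(\alpha)$ of $\alpha$ acting on $M/(\rho,\tau)$. **Theorem.** Let $M$ be a bigraded $\mathcal A(1)^{\mathbb R}$-module that is finitely generated and free over $\mathbb{M}_2^{\mathbb R}$. Then $M$ is stably invertible if and only if $$\dim_{\mathbb F_2}H(M/(\rho,\tau);\alpha)=1\quad\text{for each }\alpha\in\{Q_0,\,Q_1,\,\mathrm{Sq}^2\}.$$ -/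

import Mathlib

open scoped Polynomial TensorProduct

universe u v

namespace RMotivic

/-! ### The coefficient ring and the algebra `A(1)` over it -/

/-- The generators of `A(1)^ℝ` as an algebra over `𝔽₂`. -/
inductive Gen : Type
  | tau | rho | sq1 | sq2

/-- A generator, as an element of the free `𝔽₂`-algebra. -/
abbrev gen (g : Gen) : FreeAlgebra (ZMod 2) Gen := FreeAlgebra.ι (ZMod 2) g

/-- The defining relations: `τ`, `ρ` commute; the Cartan formula for `Sq¹`, `Sq²` against the
scalars `τ`, `ρ` (with `Sq¹ τ = ρ` and `Sq¹ ρ = Sq² τ = Sq² ρ = 0`); the Adem relations. -/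
inductive Rel : FreeAlgebra (ZMod 2) Gen → FreeAlgebra (ZMod 2) Gen → Prop
  | rho_tau : Rel (gen .rho * gen .tau) (gen .tau * gen .rho)
  | sq1_tau : Rel (gen .sq1 * gen .tau) (gen .tau * gen .sq1 + gen .rho)
  | sq1_rho : Rel (gen .sq1 * gen .rho) (gen .rho * gen .sq1)
  | sq2_tau : Rel (gen .sq2 * gen .tau) (gen .tau * gen .sq2 + gen .tau * gen .rho * gen .sq1)
  | sq2_rho : Rel (gen .sq2 * gen .rho) (gen .rho * gen .sq2)
  | sq1_sq1 : Rel (gen .sq1 * gen .sq1) 0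
  | sq2_sq2 : Rel (gen .sq2 * gen .sq2) (gen .tau * gen .sq1 * gen .sq2 * gen .sq1)
  | sq1212 : Rel (gen .sq1 * gen .sq2 * gen .sq1 * gen .sq2)
      (gen .sq2 * gen .sq1 * gen .sq2 * gen .sq1)

/-- The algebra `A(1)^ℝ`: generated over `𝔽₂[τ, ρ]` by `Sq¹` and `Sq²`. The scalars `𝔽₂[τ, ρ]` are
not central in it. -/
abbrev A1R : Type := RingQuot Rel

namespace A1R

/-- A generator, as an element of `A(1)^ℝ`. -/
def of (g : Gen) : A1R := RingQuot.mkAlgHom (ZMod 2) Rel (gen g)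

/-- The scalar `τ`, as an element of `A(1)^ℝ`. -/
def tau : A1R := of .tau
/-- The scalar `ρ`, as an element of `A(1)^ℝ`. -/
def rho : A1R := of .rho
/-- The Steenrod square `Sq¹`. -/
def sq1 : A1R := of .sq1
/-- The Steenrod square `Sq²`. -/
def sq2 : A1R := of .sq2

/-- The Milnor primitive `Q₀ = Sq¹`. -/
def Q0 : A1R := sq1

/-- The Milnor primitive `Q₁ = Sq¹ Sq² + Sq² Sq¹`. -/
def Q1 : A1R := sq1 * sq2 + sq2 * sq1

theorem rho_tau : rho * tau = tau * rho := by
  simpa [tau, rho, of] using RingQuot.mkAlgHom_rel (ZMod 2) Rel.rho_tau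
theorem sq1_tau : sq1 * tau = tau * sq1 + rho := by
  simpa [tau, rho, sq1, of] using RingQuot.mkAlgHom_rel (ZMod 2) Rel.sq1_tau
theorem sq1_rho : sq1 * rho = rho * sq1 := by
  simpa [rho, sq1, of] using RingQuot.mkAlgHom_rel (ZMod 2) Rel.sq1_rho
theorem sq2_tau : sq2 * tau = tau * sq2 + tau * rho * sq1 := by
  simpa [tau, rho, sq1, sq2, of] using RingQuot.mkAlgHom_rel (ZMod 2) Rel.sq2_tau
theorem sq2_rho : sq2 * rho = rho * sq2 := by
  simpa [rho, sq2, of] using RingQuot.mkAlgHom_rel (ZMod 2) Rel.sq2_rho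
theorem sq1_sq1 : sq1 * sq1 = 0 := by
  simpa [sq1, of] using RingQuot.mkAlgHom_rel (ZMod 2) Rel.sq1_sq1
theorem sq2_sq2 : sq2 * sq2 = tau * sq1 * sq2 * sq1 := by
  simpa [tau, sq1, sq2, of] using RingQuot.mkAlgHom_rel (ZMod 2) Rel.sq2_sq2
theorem sq1212 : sq1 * sq2 * sq1 * sq2 = sq2 * sq1 * sq2 * sq1 := by
  simpa [sq1, sq2, of] using RingQuot.mkAlgHom_rel (ZMod 2) Rel.sq1212

end A1R

/-- The coefficient ring `𝕄₂^ℝ = 𝔽₂[ρ][τ]`; the inner variable is `ρ`, the outer one is `τ`. -/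
abbrev M2 : Type := (ZMod 2)[X][X]

namespace M2

/-- The variable `τ`, of bidegree `(0,1)`. -/
noncomputable def tau : M2 := Polynomial.X
/-- The variable `ρ`, of bidegree `(1,1)`. -/
noncomputable def rho : M2 := Polynomial.C Polynomial.X

/-- The structure map `𝔽₂[τ, ρ] → A(1)^ℝ`. -/
noncomputable def toA1R : M2 →+* A1R :=
  Polynomial.eval₂RingHom' (Polynomial.aeval (R := ZMod 2) A1R.rho).toRingHom A1R.tau (by
    intro p
    induction p using Polynomial.induction_on' with
    | add p q hp hq => simpa using hp.add_left hq
    | monomial n a =>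
      have h : Commute A1R.rho A1R.tau := A1R.rho_tau
      simpa [Polynomial.aeval_monomial] using
        (Algebra.commute_algebraMap_left a A1R.tau).mul_left (h.pow_left n))

theorem toA1R_tau : toA1R tau = A1R.tau := by
  simp [toA1R, tau, Polynomial.eval₂RingHom']

theorem toA1R_rho : toA1R rho = A1R.rho := by
  simp [toA1R, rho, Polynomial.eval₂RingHom']

/-- `𝔽₂[τ, ρ]` is generated by `τ` and `ρ`. -/
theorem induction {p : M2 → Prop} (one : p 1) (htau : p tau) (hrho : p rho)
    (add : ∀ a b, p a → p b → p (a + b)) (mul : ∀ a b, p a → p b → p (a * b)) (r : M2) : p r := by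
  have h0 : p 0 := by
    have : (1 : M2) + 1 = 0 := CharTwo.add_self_eq_zero 1
    rw [← this]; exact add _ _ one one
  have hpow : ∀ (x : M2), p x → ∀ n : ℕ, p (x ^ n) := by
    intro x hx n
    induction n with
    | zero => simpa using one
    | succ n ih => rw [pow_succ]; exact mul _ _ ih hx
  have hC : ∀ q : (ZMod 2)[X], p (Polynomial.C q) := by
    intro q
    induction q using Polynomial.induction_on' with
    | add q q' h h' => rw [map_add]; exact add _ _ h h'
    | monomial n a =>
      have ha : a = 0 ∨ a = 1 := by revert a; decide
      rcases ha with rfl | rfl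
      · simpa using h0
      · rw [Polynomial.monomial_one_right_eq_X_pow, map_pow]; exact hpow _ hrho n
  induction r using Polynomial.induction_on' with
  | add q q' h h' => exact add _ _ h h'
  | monomial n a =>
    rw [← Polynomial.C_mul_X_pow_eq_monomial]; exact mul _ _ (hC a) (hpow _ htau n)

end M2

section Ops

variable {T : Type*} [AddCommGroup T] [Module (ZMod 2) T] (t r a b : Module.End (ZMod 2) T)
    (rt : r * t = t * r) (atau : a * t = t * a + r) (ar : a * r = r * a)
    (bt : b * t = t * b + t * r * a) (br : b * r = r * b) (aa : a * a = 0)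
    (bb : b * b = t * a * b * a) (abab : a * b * a * b = b * a * b * a)

/-- Four operators satisfying the defining relations give a representation of `A(1)^ℝ`. -/
noncomputable def opsHom : A1R →ₐ[ZMod 2] Module.End (ZMod 2) T :=
  RingQuot.liftAlgHom (ZMod 2) (s := Rel)
    ⟨FreeAlgebra.lift (ZMod 2) (fun g : Gen => match g with
      | .tau => t | .rho => r | .sq1 => a | .sq2 => b), by
      intro x y h
      cases h <;> simpa using by assumption⟩

theorem opsHom_tau : opsHom t r a b rt atau ar bt br aa bb abab A1R.tau = t := by
  simp [opsHom, A1R.tau, A1R.of]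
theorem opsHom_rho : opsHom t r a b rt atau ar bt br aa bb abab A1R.rho = r := by
  simp [opsHom, A1R.rho, A1R.of]
theorem opsHom_sq1 : opsHom t r a b rt atau ar bt br aa bb abab A1R.sq1 = a := by
  simp [opsHom, A1R.sq1, A1R.of]
theorem opsHom_sq2 : opsHom t r a b rt atau ar bt br aa bb abab A1R.sq2 = b := by
  simp [opsHom, A1R.sq2, A1R.of]

/-- The `A(1)^ℝ`-module structure given by four operators satisfying the defining relations. -/
noncomputable abbrev moduleOfOps : Module A1R T :=
  Module.compHom T (opsHom t r a b rt atau ar bt br aa bb abab).toRingHom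

end Ops

/-! ### Bigraded modules -/

/-- A bigraded (left) `A(1)^ℝ`-module: `M = ⨁_{s,w} M^{s,w}` with `τ`, `ρ`, `Sq¹`, `Sq²` acting in
bidegrees `(0,1)`, `(1,1)`, `(1,0)`, `(2,1)`. -/
structure BigradedModule where
  carrier : Type u
  [addCommGroup : AddCommGroup carrier]
  [module : Module A1R carrier]
  gr : ℤ × ℤ → AddSubgroup carrier
  isInternal : DirectSum.IsInternal gr
  tau_mem : ∀ d x, x ∈ gr d → A1R.tau • x ∈ gr (d + (0, 1))
  rho_mem : ∀ d x, x ∈ gr d → A1R.rho • x ∈ gr (d + (1, 1))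
  sq1_mem : ∀ d x, x ∈ gr d → A1R.sq1 • x ∈ gr (d + (1, 0))
  sq2_mem : ∀ d x, x ∈ gr d → A1R.sq2 • x ∈ gr (d + (2, 1))

namespace BigradedModule

instance : CoeSort BigradedModule.{u} (Type u) := ⟨carrier⟩

attribute [instance] addCommGroup module

/-- The underlying `𝔽₂[τ, ρ]`-module. -/
noncomputable instance (M : BigradedModule.{u}) : Module M2 M := Module.compHom M M2.toA1R

/-- The underlying `𝔽₂`-vector space. -/
noncomputable instance (M : BigradedModule.{u}) : Module (ZMod 2) M :=
  Module.compHom M (algebraMap (ZMod 2) A1R)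

instance (M : BigradedModule.{u}) : IsScalarTower (ZMod 2) A1R M :=
  ⟨fun c a m => by
    rw [Algebra.smul_def, mul_smul]; rfl⟩

theorem tau_smul (M : BigradedModule.{u}) (m : M) : M2.tau • m = A1R.tau • m := by
  change M2.toA1R M2.tau • m = _; rw [M2.toA1R_tau]

theorem rho_smul (M : BigradedModule.{u}) (m : M) : M2.rho • m = A1R.rho • m := by
  change M2.toA1R M2.rho • m = _; rw [M2.toA1R_rho]


theorem two_nsmul_eq_zero (M : BigradedModule.{u}) (m : M) : 2 • m = 0 := by
  have h : ((2 : ZMod 2)) • m = 2 • m := ofNat_smul_eq_nsmul (ZMod 2) 2 m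
  rw [← h, show (2 : ZMod 2) = 0 from rfl, zero_smul]

theorem add_self_eq_zero (M : BigradedModule.{u}) (m : M) : m + m = 0 := by
  rw [← two_nsmul, two_nsmul_eq_zero]

/-- A criterion for a family of subgroups to be a grading. -/
theorem isInternal_of_proj {T : Type*} [AddCommGroup T] (g : ℤ × ℤ → AddSubgroup T)
    (p : ℤ × ℤ → T →+ T) (same : ∀ d, ∀ x ∈ g d, p d x = x)
    (other : ∀ d e, d ≠ e → ∀ x ∈ g e, p d x = 0) (span : ∀ x, x ∈ ⨆ d, g d) :
    DirectSum.IsInternal g := by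
  constructor
  · rw [injective_iff_map_eq_zero]
    intro x hx
    have key : ∀ d (y : DirectSum (ℤ × ℤ) fun i => g i),
        p d (DirectSum.coeAddMonoidHom g y) = y d := by
      intro d y
      induction y using DirectSum.induction_on with
      | zero => simp
      | add y z hy hz => simp [hy, hz]
      | of e y =>
        rw [DirectSum.coeAddMonoidHom_of]
        by_cases h : e = d
        · subst h
          rw [same _ _ y.2, DirectSum.of_eq_same]
        · rw [other d e (Ne.symm h) _ y.2, DirectSum.of_eq_of_ne _ _ _ (Ne.symm h)]; rfl
    ext d
    rw [← key, hx]; simp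
  · intro x
    induction span x using AddSubgroup.iSup_induction' with
    | hp d y hy => exact ⟨DirectSum.of (fun i => g i) d ⟨y, hy⟩, by simp⟩
    | h1 => exact ⟨0, map_zero _⟩
    | hadd y z _ _ hy hz =>
      obtain ⟨y', rfl⟩ := hy
      obtain ⟨z', rfl⟩ := hz
      exact ⟨y' + z', map_add _ _ _⟩

/-- The decomposition of a bigraded module into its homogeneous parts. -/
noncomputable def dec (M : BigradedModule.{u}) : M ≃+ DirectSum (ℤ × ℤ) fun d => M.gr d :=
  (AddEquiv.ofBijective (DirectSum.coeAddMonoidHom M.gr) M.isInternal).symm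

theorem dec_mem (M : BigradedModule.{u}) {d : ℤ × ℤ} {x : M} (hx : x ∈ M.gr d) :
    M.dec x = DirectSum.of (fun d => M.gr d) d ⟨x, hx⟩ := by
  exact (AddEquiv.symm_apply_eq _).2 (DirectSum.coeAddMonoidHom_of M.gr d ⟨x, hx⟩).symm

/-- The projection of a bigraded module to its part of bidegree `d`. -/
noncomputable def proj (M : BigradedModule.{u}) (d : ℤ × ℤ) : M →+ M :=
  (M.gr d).subtype.comp ((DFinsupp.evalAddMonoidHom d).comp M.dec.toAddMonoidHom)

theorem proj_same (M : BigradedModule.{u}) (d : ℤ × ℤ) (x : M) (hx : x ∈ M.gr d) :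
    M.proj d x = x := by
  change ((M.dec x) d : M) = x
  rw [dec_mem M hx, DirectSum.of_eq_same]

theorem proj_other (M : BigradedModule.{u}) (d e : ℤ × ℤ) (h : d ≠ e) (x : M) (hx : x ∈ M.gr e) :
    M.proj d x = 0 := by
  change ((M.dec x) d : M) = 0
  rw [dec_mem M hx, DirectSum.of_eq_of_ne _ _ _ h]; rfl

theorem hom_induction (M : BigradedModule.{u}) {p : M → Prop}
    (mem : ∀ d, ∀ x ∈ M.gr d, p x) (add : ∀ x y, p x → p y → p (x + y)) (x : M) : p x := by
  obtain ⟨y, rfl⟩ := M.isInternal.2 x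
  induction y using DirectSum.induction_on with
  | zero => rw [map_zero]; exact mem 0 0 (zero_mem _)
  | add y z hy hz => rw [map_add]; exact add _ _ hy hz
  | of e y => rw [DirectSum.coeAddMonoidHom_of]; exact mem e _ y.2

theorem proj_shift (M : BigradedModule.{u}) (f : M →+ M) (c : ℤ × ℤ)
    (hf : ∀ d x, x ∈ M.gr d → f x ∈ M.gr (d + c)) (d : ℤ × ℤ) (x : M) :
    M.proj (d + c) (f x) = f (M.proj d x) := by
  induction x using M.hom_induction with
  | mem e x hx =>
    by_cases h : d = e
    · subst h; rw [proj_same _ _ _ hx, proj_same _ _ _ (hf _ _ hx)]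
    · rw [proj_other _ _ _ h _ hx, proj_other _ _ (e + c) (by simpa using h) _ (hf _ _ hx),
        map_zero]
  | add x y hx hy => simp only [map_add, hx, hy]

/-! ### Isomorphisms and direct sums -/

/-- `M` and `N` are isomorphic as bigraded modules. -/
def Isomorphic (M : BigradedModule.{u}) (N : BigradedModule.{v}) : Prop :=
  ∃ e : M ≃ₗ[A1R] N, ∀ d x, e x ∈ N.gr d ↔ x ∈ M.gr d

/-- The direct sum of two bigraded modules. -/
noncomputable def prod (M : BigradedModule.{u}) (N : BigradedModule.{v}) :
    BigradedModule.{max u v} where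
  carrier := M × N
  gr d := (M.gr d).prod (N.gr d)
  isInternal := by
    refine isInternal_of_proj _ (fun d => (M.proj d).prodMap (N.proj d)) ?_ ?_ ?_
    · rintro d ⟨x, y⟩ ⟨hx, hy⟩
      exact Prod.ext (M.proj_same d x hx) (N.proj_same d y hy)
    · rintro d e h ⟨x, y⟩ ⟨hx, hy⟩
      exact Prod.ext (M.proj_other d e h x hx) (N.proj_other d e h y hy)
    · rintro ⟨x, y⟩
      have h1 : ∀ x : M, ((x, 0) : M × N) ∈ ⨆ d, (M.gr d).prod (N.gr d) := by
        intro x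
        induction x using M.hom_induction with
        | mem d x hx => exact AddSubgroup.mem_iSup_of_mem d ⟨hx, zero_mem _⟩
        | add x y hx hy => simpa using add_mem hx hy
      have h2 : ∀ y : N, ((0, y) : M × N) ∈ ⨆ d, (M.gr d).prod (N.gr d) := by
        intro x
        induction x using N.hom_induction with
        | mem d x hx => exact AddSubgroup.mem_iSup_of_mem d ⟨zero_mem _, hx⟩
        | add x y hx hy => simpa using add_mem hx hy
      simpa using add_mem (h1 x) (h2 y)
  tau_mem d x hx := ⟨M.tau_mem d _ hx.1, N.tau_mem d _ hx.2⟩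
  rho_mem d x hx := ⟨M.rho_mem d _ hx.1, N.rho_mem d _ hx.2⟩
  sq1_mem d x hx := ⟨M.sq1_mem d _ hx.1, N.sq1_mem d _ hx.2⟩
  sq2_mem d x hx := ⟨M.sq2_mem d _ hx.1, N.sq2_mem d _ hx.2⟩

/-! ### The tensor product over `𝔽₂[τ, ρ]` -/

section Tensor

variable (M : BigradedModule.{u}) (N : BigradedModule.{v})

theorem tmul_tau (x : M) (y : N) : x ⊗ₜ[M2] (A1R.tau • y) = (A1R.tau • x) ⊗ₜ[M2] y := by
  rw [← tau_smul, ← tau_smul, TensorProduct.smul_tmul]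

theorem tmul_rho (x : M) (y : N) : x ⊗ₜ[M2] (A1R.rho • y) = (A1R.rho • x) ⊗ₜ[M2] y := by
  rw [← rho_smul, ← rho_smul, TensorProduct.smul_tmul]

/-- A biadditive map balanced for `τ` and `ρ` is defined on the tensor product. -/
noncomputable def tensorLift {T : Type*} [AddCommGroup T] (B : M → N → T)
    (addl : ∀ x x' y, B (x + x') y = B x y + B x' y)
    (addr : ∀ x y y', B x (y + y') = B x y + B x y')
    (ht : ∀ x y, B (A1R.tau • x) y = B x (A1R.tau • y))
    (hr : ∀ x y, B (A1R.rho • x) y = B x (A1R.rho • y)) : (M ⊗[M2] N) →+ T :=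
  TensorProduct.liftAddHom
    (AddMonoidHom.mk' (fun x => AddMonoidHom.mk' (B x) (addr x))
      (fun x x' => AddMonoidHom.ext fun y => addl x x' y))
    (fun r => M2.induction (p := fun r => ∀ (x : M) (y : N), B (r • x) y = B x (r • y))
      (by simp) (by simpa [tau_smul] using ht) (by simpa [rho_smul] using hr)
      (fun a b ha hb x y => by rw [add_smul, add_smul, addl, addr, ha, hb])
      (fun a b ha hb x y => by rw [mul_smul, ha, hb, ← mul_smul, mul_comm]) r)

@[simp] theorem tensorLift_tmul {T : Type*} [AddCommGroup T] (B : M → N → T) (addl addr ht hr)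
    (x : M) (y : N) : tensorLift M N B addl addr ht hr (x ⊗ₜ y) = B x y := rfl

theorem tensor_two_nsmul (z : M ⊗[M2] N) : 2 • z = 0 := by
  induction z using TensorProduct.induction_on with
  | zero => simp
  | tmul x y => rw [two_nsmul, ← TensorProduct.add_tmul, add_self_eq_zero, TensorProduct.zero_tmul]
  | add x y hx hy => rw [nsmul_add, hx, hy, add_zero]

theorem tensor_two_zsmul (z : M ⊗[M2] N) : (2 : ℤ) • z = 0 := by
  rw [two_zsmul, ← two_nsmul, tensor_two_nsmul]

theorem rho_tau_smul (x : M) : A1R.rho • A1R.tau • x = A1R.tau • A1R.rho • x := by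
  rw [← mul_smul, A1R.rho_tau, mul_smul]
theorem sq1_tau_smul (x : M) : A1R.sq1 • A1R.tau • x = A1R.tau • A1R.sq1 • x + A1R.rho • x := by
  rw [← mul_smul, A1R.sq1_tau, add_smul, mul_smul]
theorem sq1_rho_smul (x : M) : A1R.sq1 • A1R.rho • x = A1R.rho • A1R.sq1 • x := by
  rw [← mul_smul, A1R.sq1_rho, mul_smul]
theorem sq2_tau_smul (x : M) : A1R.sq2 • A1R.tau • x =
    A1R.tau • A1R.sq2 • x + A1R.tau • A1R.rho • A1R.sq1 • x := by
  rw [← mul_smul, A1R.sq2_tau, add_smul, mul_smul, mul_smul, mul_smul]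
theorem sq2_rho_smul (x : M) : A1R.sq2 • A1R.rho • x = A1R.rho • A1R.sq2 • x := by
  rw [← mul_smul, A1R.sq2_rho, mul_smul]
theorem sq1_sq1_smul (x : M) : A1R.sq1 • A1R.sq1 • x = 0 := by
  rw [← mul_smul, A1R.sq1_sq1, zero_smul]
theorem sq2_sq2_smul (x : M) : A1R.sq2 • A1R.sq2 • x =
    A1R.tau • A1R.sq1 • A1R.sq2 • A1R.sq1 • x := by
  rw [← mul_smul, A1R.sq2_sq2, mul_smul, mul_smul, mul_smul]
theorem sq2121_smul (x : M) : A1R.sq2 • A1R.sq1 • A1R.sq2 • A1R.sq1 • x =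
    A1R.sq1 • A1R.sq2 • A1R.sq1 • A1R.sq2 • x := by
  rw [← mul_smul, ← mul_smul, ← mul_smul, ← A1R.sq1212, mul_smul, mul_smul, mul_smul]

/-- `τ (x ⊗ y) = τ x ⊗ y`. -/
noncomputable def tensorTau : (M ⊗[M2] N) →+ (M ⊗[M2] N) :=
  tensorLift M N (fun x y => (A1R.tau • x) ⊗ₜ y)
    (fun x x' y => by simp [TensorProduct.add_tmul])
    (fun x y y' => by simp [TensorProduct.tmul_add])
    (fun x y => by simp [tmul_tau])
    (fun x y => by simp [tmul_rho, rho_tau_smul])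

/-- `ρ (x ⊗ y) = ρ x ⊗ y`. -/
noncomputable def tensorRho : (M ⊗[M2] N) →+ (M ⊗[M2] N) :=
  tensorLift M N (fun x y => (A1R.rho • x) ⊗ₜ y)
    (fun x x' y => by simp [TensorProduct.add_tmul])
    (fun x y y' => by simp [TensorProduct.tmul_add])
    (fun x y => by simp [tmul_tau, rho_tau_smul])
    (fun x y => by simp [tmul_rho])

/-- The Cartan formula `Sq¹ (x ⊗ y) = Sq¹ x ⊗ y + x ⊗ Sq¹ y`. -/
noncomputable def tensorSq1 : (M ⊗[M2] N) →+ (M ⊗[M2] N) :=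
  tensorLift M N (fun x y => (A1R.sq1 • x) ⊗ₜ y + x ⊗ₜ (A1R.sq1 • y))
    (fun x x' y => by simp [TensorProduct.add_tmul]; abel)
    (fun x y y' => by simp [TensorProduct.tmul_add]; abel)
    (fun x y => by
      simp only [tmul_tau, tmul_rho, sq1_tau_smul, TensorProduct.add_tmul, TensorProduct.tmul_add]
      abel)
    (fun x y => by
      simp only [tmul_rho, sq1_rho_smul])

/-- The Cartan formula `Sq² (x ⊗ y) = Sq² x ⊗ y + x ⊗ Sq² y + τ Sq¹ x ⊗ Sq¹ y`. -/
noncomputable def tensorSq2 : (M ⊗[M2] N) →+ (M ⊗[M2] N) :=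
  tensorLift M N (fun x y => (A1R.sq2 • x) ⊗ₜ y + x ⊗ₜ (A1R.sq2 • y)
      + (A1R.tau • A1R.sq1 • x) ⊗ₜ (A1R.sq1 • y))
    (fun x x' y => by simp [TensorProduct.add_tmul]; abel)
    (fun x y y' => by simp [TensorProduct.tmul_add]; abel)
    (fun x y => by
      simp only [tmul_tau, tmul_rho, sq1_tau_smul, sq2_tau_smul, rho_tau_smul, smul_add,
        TensorProduct.add_tmul, TensorProduct.tmul_add]
      abel)
    (fun x y => by
      simp only [tmul_rho, sq1_rho_smul, sq2_rho_smul, rho_tau_smul])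

/-- The diagonal `A(1)^ℝ`-module structure on `M ⊗ N`, given by the Cartan formulas. -/
noncomputable instance tensorModule : Module A1R (M ⊗[M2] N) :=
  letI : Module (ZMod 2) (M ⊗[M2] N) := AddCommGroup.zmodModule (tensor_two_nsmul M N)
  have ext : ∀ f g : Module.End (ZMod 2) (M ⊗[M2] N), (∀ x y, f (x ⊗ₜ y) = g (x ⊗ₜ y)) → f = g :=
    fun f g h => LinearMap.ext fun z => by
      induction z using TensorProduct.induction_on with
      | zero => simp
      | tmul x y => exact h x y
      | add x y hx hy => rw [map_add, map_add, hx, hy]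
  have char2 : ∀ z w : M ⊗[M2] N, z + w = 0 → z = w := fun z w h => by
    have h2 := tensor_two_nsmul M N w
    rw [two_nsmul] at h2
    exact add_right_cancel (h.trans h2.symm)
  moduleOfOps
    ((tensorTau M N).toZModLinearMap 2) ((tensorRho M N).toZModLinearMap 2)
    ((tensorSq1 M N).toZModLinearMap 2) ((tensorSq2 M N).toZModLinearMap 2)
    (ext _ _ fun x y => by
      simp [tensorTau, tensorRho, rho_tau_smul])
    (ext _ _ fun x y => by
      simp [tensorTau, tensorRho, tensorSq1, sq1_tau_smul, TensorProduct.add_tmul]; abel)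
    (ext _ _ fun x y => by
      simp [tensorRho, tensorSq1, sq1_rho_smul])
    (ext _ _ fun x y => by
      simp [tensorTau, tensorRho, tensorSq1, tensorSq2, sq1_tau_smul, sq2_tau_smul,
        TensorProduct.add_tmul]; abel)
    (ext _ _ fun x y => by
      simp [tensorRho, tensorSq2, sq1_rho_smul, sq2_rho_smul, rho_tau_smul])
    (ext _ _ fun x y => by
      apply char2
      simp [tensorSq1, sq1_sq1_smul]; abel_nf; simp only [tensor_two_zsmul])
    (ext _ _ fun x y => by
      apply char2
      simp [tensorTau, tensorSq1, tensorSq2, sq1_sq1_smul, sq2_sq2_smul, sq2_tau_smul, tmul_tau]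
      abel_nf; simp only [tensor_two_zsmul, add_zero])
    (ext _ _ fun x y => by
      apply char2
      simp [tensorSq1, tensorSq2, sq1_sq1_smul, sq2_sq2_smul, sq1_tau_smul, sq2121_smul,
        sq1_rho_smul, sq2_rho_smul, tmul_tau]
      abel_nf; simp only [tensor_two_zsmul, add_zero])

theorem tau_smul_tmul (x : M) (y : N) :
    A1R.tau • (x ⊗ₜ[M2] y) = (A1R.tau • x) ⊗ₜ[M2] y := by
  let _ : Module (ZMod 2) (M ⊗[M2] N) := AddCommGroup.zmodModule (tensor_two_nsmul M N)
  exact LinearMap.congr_fun (opsHom_tau _ _ _ _ _ _ _ _ _ _ _ _) (x ⊗ₜ[M2] y)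

theorem rho_smul_tmul (x : M) (y : N) :
    A1R.rho • (x ⊗ₜ[M2] y) = (A1R.rho • x) ⊗ₜ[M2] y := by
  let _ : Module (ZMod 2) (M ⊗[M2] N) := AddCommGroup.zmodModule (tensor_two_nsmul M N)
  exact LinearMap.congr_fun (opsHom_rho _ _ _ _ _ _ _ _ _ _ _ _) (x ⊗ₜ[M2] y)

theorem sq1_smul_tmul (x : M) (y : N) :
    A1R.sq1 • (x ⊗ₜ[M2] y) = (A1R.sq1 • x) ⊗ₜ[M2] y + x ⊗ₜ[M2] (A1R.sq1 • y) := by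
  let _ : Module (ZMod 2) (M ⊗[M2] N) := AddCommGroup.zmodModule (tensor_two_nsmul M N)
  exact LinearMap.congr_fun (opsHom_sq1 _ _ _ _ _ _ _ _ _ _ _ _) (x ⊗ₜ[M2] y)

theorem sq2_smul_tmul (x : M) (y : N) :
    A1R.sq2 • (x ⊗ₜ[M2] y) = (A1R.sq2 • x) ⊗ₜ[M2] y + x ⊗ₜ[M2] (A1R.sq2 • y)
      + (A1R.tau • A1R.sq1 • x) ⊗ₜ[M2] (A1R.sq1 • y) := by
  let _ : Module (ZMod 2) (M ⊗[M2] N) := AddCommGroup.zmodModule (tensor_two_nsmul M N)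
  exact LinearMap.congr_fun (opsHom_sq2 _ _ _ _ _ _ _ _ _ _ _ _) (x ⊗ₜ[M2] y)

/-- The part of `M ⊗ N` of bidegree `d`: sums of `x ⊗ y` with `|x| + |y| = d`. -/
noncomputable def tensorGr (d : ℤ × ℤ) : AddSubgroup (M ⊗[M2] N) :=
  AddSubgroup.closure {z | ∃ d₁ d₂ x y, d₁ + d₂ = d ∧ x ∈ M.gr d₁ ∧ y ∈ N.gr d₂ ∧ z = x ⊗ₜ y}

theorem tmul_mem_tensorGr {d d₁ d₂ : ℤ × ℤ} (h : d₁ + d₂ = d) {x : M} {y : N}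
    (hx : x ∈ M.gr d₁) (hy : y ∈ N.gr d₂) : x ⊗ₜ[M2] y ∈ tensorGr M N d :=
  AddSubgroup.subset_closure ⟨d₁, d₂, x, y, h, hx, hy, rfl⟩

/-- The biadditive map `(x, y) ↦ ∑ x_{d₁} ⊗ y_{d - d₁}`. -/
noncomputable def tensorProjAux (d : ℤ × ℤ) : M →+ N →+ (M ⊗[M2] N) :=
  (DirectSum.toAddMonoid fun d₁ =>
    AddMonoidHom.mk' (fun x : M.gr d₁ =>
      AddMonoidHom.mk' (fun y : N => (x : M) ⊗ₜ[M2] N.proj (d - d₁) y)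
        (fun y y' => by rw [map_add, TensorProduct.tmul_add]))
      (fun x x' => AddMonoidHom.ext fun y => by simp [TensorProduct.add_tmul])).comp
    M.dec.toAddMonoidHom

theorem tensorProjAux_apply (d d₁ : ℤ × ℤ) (x : M) (hx : x ∈ M.gr d₁) (y : N) :
    tensorProjAux M N d x y = x ⊗ₜ[M2] N.proj (d - d₁) y := by
  simp only [tensorProjAux, AddMonoidHom.comp_apply, AddEquiv.coe_toAddMonoidHom, dec_mem M hx,
    DirectSum.toAddMonoid_of, AddMonoidHom.mk'_apply]

/-- The projection of `M ⊗ N` to its part of bidegree `d`. -/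
noncomputable def tensorProj (d : ℤ × ℤ) : (M ⊗[M2] N) →+ (M ⊗[M2] N) :=
  tensorLift M N (fun x y => tensorProjAux M N d x y) (by simp) (by simp)
    (fun x y => by
      induction x using M.hom_induction with
      | mem e x hx =>
        have h := N.proj_shift (DistribSMul.toAddMonoidHom N A1R.tau) (0, 1) N.tau_mem
          (d - (e + (0, 1))) y
        rw [sub_add_eq_sub_sub, sub_add_cancel] at h
        rw [tensorProjAux_apply M N d _ _ (M.tau_mem e x hx), tensorProjAux_apply M N d e x hx,
          sub_add_eq_sub_sub, ← tmul_tau]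
        exact congrArg _ h.symm
      | add x x' h h' => simp only [smul_add, map_add, AddMonoidHom.add_apply, h, h'])
    (fun x y => by
      induction x using M.hom_induction with
      | mem e x hx =>
        have h := N.proj_shift (DistribSMul.toAddMonoidHom N A1R.rho) (1, 1) N.rho_mem
          (d - (e + (1, 1))) y
        rw [sub_add_eq_sub_sub, sub_add_cancel] at h
        rw [tensorProjAux_apply M N d _ _ (M.rho_mem e x hx), tensorProjAux_apply M N d e x hx,
          sub_add_eq_sub_sub, ← tmul_rho]
        exact congrArg _ h.symm
      | add x x' h h' => simp only [smul_add, map_add, AddMonoidHom.add_apply, h, h'])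

theorem tensorGr_isInternal : DirectSum.IsInternal (tensorGr M N) := by
  have key : ∀ d d₁ d₂ (x : M) (y : N), x ∈ M.gr d₁ → y ∈ N.gr d₂ →
      tensorProj M N d (x ⊗ₜ y) = if d = d₁ + d₂ then x ⊗ₜ y else 0 := by
    intro d d₁ d₂ x y hx hy
    rw [tensorProj, tensorLift_tmul, tensorProjAux_apply M N d d₁ x hx]
    split_ifs with h
    · subst h; rw [add_sub_cancel_left, N.proj_same _ _ hy]
    · rw [N.proj_other _ d₂ _ _ hy, TensorProduct.tmul_zero]
      intro h'; exact h (by rw [← h']; abel)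
  refine isInternal_of_proj _ (tensorProj M N) ?_ ?_ ?_
  · intro d z hz
    induction hz using AddSubgroup.closure_induction with
    | mem z hz =>
      obtain ⟨d₁, d₂, x, y, rfl, hx, hy, rfl⟩ := hz
      rw [key _ _ _ _ _ hx hy, if_pos rfl]
    | zero => exact map_zero _
    | add z w _ _ hz hw => rw [map_add, hz, hw]
    | neg z _ hz => rw [map_neg, hz]
  · intro d e h z hz
    induction hz using AddSubgroup.closure_induction with
    | mem z hz =>
      obtain ⟨d₁, d₂, x, y, rfl, hx, hy, rfl⟩ := hz
      rw [key _ _ _ _ _ hx hy, if_neg h]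
    | zero => exact map_zero _
    | add z w _ _ hz hw => rw [map_add, hz, hw, add_zero]
    | neg z _ hz => rw [map_neg, hz, neg_zero]
  · intro z
    induction z using TensorProduct.induction_on with
    | zero => exact zero_mem _
    | add z w hz hw => exact add_mem hz hw
    | tmul x y =>
      induction x using M.hom_induction with
      | add x x' h h' => rw [TensorProduct.add_tmul]; exact add_mem h h'
      | mem d₁ x hx =>
        induction y using N.hom_induction with
        | add y y' h h' => rw [TensorProduct.tmul_add]; exact add_mem h h'
        | mem d₂ y hy => exact AddSubgroup.mem_iSup_of_mem _ (tmul_mem_tensorGr M N rfl hx hy)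

theorem smul_mem_tensorGr (a : A1R) (c : ℤ × ℤ)
    (h : ∀ d₁ d₂ x y, x ∈ M.gr d₁ → y ∈ N.gr d₂ →
      a • (x ⊗ₜ[M2] y) ∈ tensorGr M N (d₁ + d₂ + c)) (d : ℤ × ℤ) (z : M ⊗[M2] N)
    (hz : z ∈ tensorGr M N d) : a • z ∈ tensorGr M N (d + c) := by
  induction hz using AddSubgroup.closure_induction with
  | mem z hz => obtain ⟨d₁, d₂, x, y, rfl, hx, hy, rfl⟩ := hz; exact h _ _ _ _ hx hy
  | zero => rw [smul_zero]; exact zero_mem _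
  | add z w _ _ hz hw => rw [smul_add]; exact add_mem hz hw
  | neg z _ hz => rw [smul_neg]; exact neg_mem hz

/-- The tensor product of bigraded modules, over `𝔽₂[τ, ρ]`, with the diagonal action. -/
noncomputable def tensor : BigradedModule.{max u v} where
  carrier := M ⊗[M2] N
  gr := tensorGr M N
  isInternal := tensorGr_isInternal M N
  tau_mem := smul_mem_tensorGr M N _ _ fun d₁ d₂ x y hx hy => by
    rw [tau_smul_tmul]; exact tmul_mem_tensorGr M N (by abel) (M.tau_mem _ _ hx) hy
  rho_mem := smul_mem_tensorGr M N _ _ fun d₁ d₂ x y hx hy => by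
    rw [rho_smul_tmul]; exact tmul_mem_tensorGr M N (by abel) (M.rho_mem _ _ hx) hy
  sq1_mem := smul_mem_tensorGr M N _ _ fun d₁ d₂ x y hx hy => by
    rw [sq1_smul_tmul]
    exact add_mem (tmul_mem_tensorGr M N (by abel) (M.sq1_mem _ _ hx) hy)
      (tmul_mem_tensorGr M N (by abel) hx (N.sq1_mem _ _ hy))
  sq2_mem := smul_mem_tensorGr M N _ _ fun d₁ d₂ x y hx hy => by
    rw [sq2_smul_tmul]
    refine add_mem (add_mem (tmul_mem_tensorGr M N (by abel) (M.sq2_mem _ _ hx) hy)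
      (tmul_mem_tensorGr M N (by abel) hx (N.sq2_mem _ _ hy)))
      (tmul_mem_tensorGr M N ?_ (M.tau_mem _ _ (M.sq1_mem _ _ hx)) (N.sq1_mem _ _ hy))
    ext <;> simp <;> ring

end Tensor

/-! ### The unit object -/

section Unit

/-- The action of `Sq¹` on the coefficient ring: the `𝔽₂[ρ]`-linear map `τⁱ ↦ i ρ τⁱ⁻¹`. -/
noncomputable def unitSq1 : M2 →ₗ[ZMod 2] M2 :=
  (LinearMap.mulLeft (ZMod 2) M2.rho).comp
    ((Polynomial.derivative (R := (ZMod 2)[X])).restrictScalars (ZMod 2))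

/-- The action of `Sq²` on the coefficient ring: the `𝔽₂[ρ]`-linear map
`τⁱ ↦ (i choose 2) ρ² τⁱ⁻¹`. -/
noncomputable def unitSq2 : M2 →ₗ[ZMod 2] M2 :=
  (LinearMap.mulLeft (ZMod 2) (M2.rho ^ 2 * M2.tau)).comp
    ((Polynomial.hasseDeriv (R := (ZMod 2)[X]) 2).restrictScalars (ZMod 2))

theorem unitSq1_tau (f : M2) : unitSq1 (M2.tau * f) = M2.tau * unitSq1 f + M2.rho * f := by
  simp [unitSq1, M2.tau, Polynomial.derivative_mul]; ring

theorem unitSq1_rho (f : M2) : unitSq1 (M2.rho * f) = M2.rho * unitSq1 f := by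
  simp [unitSq1, M2.rho, Polynomial.derivative_mul]

theorem unitSq2_tau (f : M2) : unitSq2 (M2.tau * f) =
    M2.tau * unitSq2 f + M2.tau * (M2.rho * unitSq1 f) := by
  have h : Polynomial.hasseDeriv 2 (M2.tau * f) =
      M2.tau * Polynomial.hasseDeriv 2 f + Polynomial.derivative f := by
    rw [Polynomial.hasseDeriv_mul, show Finset.HasAntidiagonal.antidiagonal 2 = {(0, 2), (1, 1), (2, 0)} from rfl]
    simp [M2.tau, Polynomial.hasseDeriv_X]
  simp [unitSq1, unitSq2, h]; ring

theorem unitSq2_rho (f : M2) : unitSq2 (M2.rho * f) = M2.rho * unitSq2 f := by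
  have h : Polynomial.hasseDeriv 2 (M2.rho * f) = M2.rho * Polynomial.hasseDeriv 2 f := by
    rw [M2.rho, ← Polynomial.smul_eq_C_mul, ← Polynomial.smul_eq_C_mul, map_smul]
  simp [unitSq2, h]; ring

theorem M2_add_self (f : M2) : f + f = 0 := CharTwo.add_self_eq_zero f

/-- An additive operator that commutes with `τ` and `ρ` and kills `1` is zero. -/
theorem unit_eq_zero (D : M2 →+ M2) (one : D 1 = 0) (ht : ∀ f, D (M2.tau * f) = M2.tau * D f)
    (hr : ∀ f, D (M2.rho * f) = M2.rho * D f) (f : M2) : D f = 0 := by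
  have : ∀ g, D (f * g) = f * D g := by
    induction f using M2.induction with
    | one => simp
    | htau => exact ht
    | hrho => exact hr
    | add a b ha hb => intro g; rw [add_mul, map_add, ha, hb, add_mul]
    | mul a b ha hb => intro g; rw [mul_assoc, ha, hb, mul_assoc]
  simpa [one] using this 1

theorem unitSq1_one : unitSq1 1 = 0 := by simp [unitSq1]

theorem unitSq2_one : unitSq2 1 = 0 := by
  simp [unitSq2, Polynomial.hasseDeriv_apply_one 2 (by norm_num)]

theorem unitSq1_sq1 (f : M2) : unitSq1 (unitSq1 f) = 0 := by
  refine unit_eq_zero (unitSq1 * unitSq1 : Module.End (ZMod 2) M2).toAddMonoidHom ?_ ?_ ?_ f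
  · simp [unitSq1_one]
  · intro f
    simp only [LinearMap.toAddMonoidHom_coe, Module.End.mul_apply, unitSq1_tau, unitSq1_rho,
      map_add]
    linear_combination M2_add_self (M2.rho * unitSq1 f)
  · intro f
    simp [unitSq1_rho]

theorem unitSq2_sq2 (f : M2) :
    unitSq2 (unitSq2 f) = M2.tau * unitSq1 (unitSq2 (unitSq1 f)) := by
  rw [← sub_eq_zero]
  refine unit_eq_zero (unitSq2 * unitSq2 - LinearMap.mulLeft (ZMod 2) M2.tau * unitSq1 * unitSq2
    * unitSq1 : Module.End (ZMod 2) M2).toAddMonoidHom ?_ ?_ ?_ f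
  · simp [unitSq1_one, unitSq2_one]
  · intro f
    simp only [LinearMap.toAddMonoidHom_coe, Module.End.mul_apply, unitSq1_tau, unitSq1_rho,
      map_add, unitSq2_tau, unitSq2_rho, unitSq1_sq1, LinearMap.sub_apply,
      LinearMap.mulLeft_apply, mul_zero, add_zero]
    ring
  · intro f
    simp only [LinearMap.toAddMonoidHom_coe, Module.End.mul_apply, unitSq1_rho, unitSq2_rho,
      LinearMap.sub_apply, LinearMap.mulLeft_apply]
    ring

theorem unitSq1212 (f : M2) :
    unitSq1 (unitSq2 (unitSq1 (unitSq2 f))) = unitSq2 (unitSq1 (unitSq2 (unitSq1 f))) := by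
  rw [← sub_eq_zero]
  refine unit_eq_zero (unitSq1 * unitSq2 * unitSq1 * unitSq2 - unitSq2 * unitSq1 * unitSq2
    * unitSq1 : Module.End (ZMod 2) M2).toAddMonoidHom ?_ ?_ ?_ f
  · simp [unitSq1_one, unitSq2_one]
  · intro f
    simp only [LinearMap.toAddMonoidHom_coe, Module.End.mul_apply, unitSq1_tau, unitSq1_rho,
      map_add, unitSq2_tau, unitSq2_rho, unitSq1_sq1, unitSq2_sq2, LinearMap.sub_apply, map_zero,
      mul_zero, add_zero]
    linear_combination M2_add_self (M2.rho * (M2.rho * unitSq1 (unitSq2 (unitSq1 f))))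
  · intro f
    simp only [LinearMap.toAddMonoidHom_coe, Module.End.mul_apply, unitSq1_rho, unitSq2_rho,
      LinearMap.sub_apply]
    ring

/-- The `A(1)^ℝ`-module structure on the coefficient ring. -/
noncomputable abbrev unitModule : Module A1R M2 :=
  moduleOfOps (LinearMap.mulLeft (ZMod 2) M2.tau) (LinearMap.mulLeft (ZMod 2) M2.rho)
    unitSq1 unitSq2
    (LinearMap.ext fun f => by simp; ring)
    (LinearMap.ext fun f => unitSq1_tau f)
    (LinearMap.ext fun f => unitSq1_rho f)
    (LinearMap.ext fun f => unitSq2_tau f)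
    (LinearMap.ext fun f => unitSq2_rho f)
    (LinearMap.ext fun f => unitSq1_sq1 f)
    (LinearMap.ext fun f => unitSq2_sq2 f)
    (LinearMap.ext fun f => unitSq1212 f)

/-- The part of `𝔽₂[τ, ρ]` of bidegree `d`, where `τ`, `ρ` have bidegrees `(0,1)`, `(1,1)`. -/
noncomputable def unitGr (d : ℤ × ℤ) : AddSubgroup M2 :=
  AddSubgroup.closure
    {f | ∃ i j : ℕ, i • ((0, 1) : ℤ × ℤ) + j • ((1, 1) : ℤ × ℤ) = d ∧ f = M2.tau ^ i * M2.rho ^ j}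

theorem mem_unitGr (i j : ℕ) (d : ℤ × ℤ)
    (h : i • ((0, 1) : ℤ × ℤ) + j • ((1, 1) : ℤ × ℤ) = d) : M2.tau ^ i * M2.rho ^ j ∈ unitGr d :=
  AddSubgroup.subset_closure ⟨i, j, h, rfl⟩

theorem unitGr_map (D : M2 →+ M2) (c : ℤ × ℤ)
    (h : ∀ i j : ℕ, D (M2.tau ^ i * M2.rho ^ j) ∈
      unitGr (i • ((0, 1) : ℤ × ℤ) + j • ((1, 1) : ℤ × ℤ) + c)) (d : ℤ × ℤ) (f : M2)
    (hf : f ∈ unitGr d) : D f ∈ unitGr (d + c) := by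
  induction hf using AddSubgroup.closure_induction with
  | mem z hz => obtain ⟨i, j, rfl, rfl⟩ := hz; exact h i j
  | zero => rw [map_zero]; exact zero_mem _
  | add z w _ _ hz hw => rw [map_add]; exact add_mem hz hw
  | neg z _ hz => rw [map_neg]; exact neg_mem hz

theorem rho_pow_eq (j : ℕ) : M2.rho ^ j = Polynomial.C (Polynomial.X ^ j) := by
  rw [M2.rho, map_pow]

theorem unitSq1_monomial (i j : ℕ) : unitSq1 (M2.tau ^ i * M2.rho ^ j) =
    i • (M2.tau ^ (i - 1) * M2.rho ^ (j + 1)) := by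
  have : unitSq1 (M2.tau ^ i * M2.rho ^ j) =
      M2.rho * Polynomial.derivative (M2.tau ^ i * M2.rho ^ j) := rfl
  rw [this, rho_pow_eq, mul_comm (M2.tau ^ i), Polynomial.derivative_C_mul, M2.tau,
    Polynomial.derivative_X_pow, ← rho_pow_eq, nsmul_eq_mul, map_natCast]
  ring

theorem unitSq2_monomial (i j : ℕ) : unitSq2 (M2.tau ^ i * M2.rho ^ j) =
    (i.choose 2) • (M2.tau ^ (i - 2 + 1) * M2.rho ^ (j + 2)) := by
  have : unitSq2 (M2.tau ^ i * M2.rho ^ j) =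
      M2.rho ^ 2 * M2.tau * Polynomial.hasseDeriv 2 (M2.tau ^ i * M2.rho ^ j) := rfl
  have h : Polynomial.hasseDeriv 2 (M2.tau ^ i * M2.rho ^ j) =
      M2.rho ^ j * ((i.choose 2) • M2.tau ^ (i - 2)) := by
    rw [rho_pow_eq, mul_comm (M2.tau ^ i), ← Polynomial.smul_eq_C_mul, map_smul,
      Polynomial.smul_eq_C_mul, M2.tau, Polynomial.X_pow_eq_monomial i,
      Polynomial.hasseDeriv_monomial, mul_one, Polynomial.X_pow_eq_monomial (i - 2), ← map_nsmul,
      nsmul_one]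
  rw [this, h]
  simp only [nsmul_eq_mul]
  ring

/-- The projection of `𝔽₂[τ, ρ]` to the span of `τⁱ ρʲ`. -/
noncomputable def unitCoeff (i j : ℕ) : M2 →+ M2 :=
  AddMonoidHom.mk' (fun f => Polynomial.monomial i (Polynomial.monomial j ((f.coeff i).coeff j)))
    (fun f g => by simp)

theorem unitCoeff_monomial (i j k l : ℕ) : unitCoeff i j (M2.tau ^ k * M2.rho ^ l) =
    if i = k ∧ j = l then M2.tau ^ k * M2.rho ^ l else 0 := by
  have h : M2.tau ^ k * M2.rho ^ l = Polynomial.monomial k (Polynomial.monomial l 1) := by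
    rw [rho_pow_eq, M2.tau, mul_comm, Polynomial.C_mul_X_pow_eq_monomial,
      Polynomial.X_pow_eq_monomial]
  rw [h, unitCoeff, AddMonoidHom.mk'_apply, Polynomial.coeff_monomial]
  by_cases h1 : k = i
  · subst h1
    rw [if_pos rfl, Polynomial.coeff_monomial]
    by_cases h2 : l = j
    · subst h2; simp
    · simp [h2, Ne.symm h2]
  · simp [h1, Ne.symm h1]

theorem unitGr_isInternal : DirectSum.IsInternal unitGr := by
  have key : ∀ (d : ℤ × ℤ) (i j : ℕ),
      (if d = (d.2 - d.1).toNat • ((0, 1) : ℤ × ℤ) + d.1.toNat • ((1, 1) : ℤ × ℤ) then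
        unitCoeff (d.2 - d.1).toNat d.1.toNat else 0) (M2.tau ^ i * M2.rho ^ j) =
      if d = i • ((0, 1) : ℤ × ℤ) + j • ((1, 1) : ℤ × ℤ) then M2.tau ^ i * M2.rho ^ j else 0 := by
    rintro ⟨s, w⟩ i j
    by_cases h : ((s, w) : ℤ × ℤ) = i • ((0, 1) : ℤ × ℤ) + j • ((1, 1) : ℤ × ℤ)
    · simp only [Prod.smul_mk, Prod.mk_add_mk, Prod.mk.injEq, nsmul_eq_mul] at h
      obtain ⟨h1, h2⟩ := h
      have e1 : (w - s).toNat = i := by omega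
      have e2 : s.toNat = j := by omega
      rw [if_pos, if_pos]
      · simp only [e1, e2, unitCoeff_monomial]; simp
      · ext <;> simp <;> omega
      · simp only [e1, e2]; ext <;> simp <;> omega
    · rw [if_neg h]
      split_ifs with h'
      · rw [unitCoeff_monomial, if_neg]
        rintro ⟨rfl, rfl⟩
        exact h h'
      · rfl
  refine isInternal_of_proj _ (fun d =>
    if d = (d.2 - d.1).toNat • ((0, 1) : ℤ × ℤ) + d.1.toNat • ((1, 1) : ℤ × ℤ) then
        unitCoeff (d.2 - d.1).toNat d.1.toNat else 0) ?_ ?_ ?_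
  · intro d z hz
    induction hz using AddSubgroup.closure_induction with
    | mem z hz => obtain ⟨i, j, h, rfl⟩ := hz; rw [key, if_pos h.symm]
    | zero => exact map_zero _
    | add z w _ _ hz hw => rw [map_add, hz, hw]
    | neg z _ hz => rw [map_neg, hz]
  · intro d e hne z hz
    induction hz using AddSubgroup.closure_induction with
    | mem z hz =>
      obtain ⟨i, j, h, rfl⟩ := hz
      rw [key, if_neg (fun h' => hne (h'.trans h))]
    | zero => exact map_zero _
    | add z w _ _ hz hw => rw [map_add, hz, hw, add_zero]
    | neg z _ hz => rw [map_neg, hz, neg_zero]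
  · intro f
    induction f using Polynomial.induction_on' with
    | add f g hf hg => exact add_mem hf hg
    | monomial i q =>
      induction q using Polynomial.induction_on' with
      | add f g hf hg => rw [map_add]; exact add_mem hf hg
      | monomial j a =>
        have ha : a = 0 ∨ a = 1 := by revert a; decide
        rcases ha with rfl | rfl
        · simp
        · have h : Polynomial.monomial i (Polynomial.monomial j (1 : ZMod 2)) =
              M2.tau ^ i * M2.rho ^ j := by
            rw [rho_pow_eq, M2.tau, mul_comm, Polynomial.C_mul_X_pow_eq_monomial,
              Polynomial.X_pow_eq_monomial]
          rw [h]
          exact AddSubgroup.mem_iSup_of_mem _ (mem_unitGr i j _ rfl)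

/-- The unit object: the coefficient ring `𝕄₂^ℝ = 𝔽₂[τ, ρ]`. -/
noncomputable def unit : BigradedModule.{0} where
  carrier := M2
  module := unitModule
  gr := unitGr
  isInternal := unitGr_isInternal
  tau_mem d f hf := by
    have h : unitModule.smul A1R.tau f = M2.tau * f :=
      LinearMap.congr_fun (opsHom_tau _ _ _ _ _ _ _ _ _ _ _ _) f
    refine Eq.mpr (congrArg (· ∈ _) h) (unitGr_map (AddMonoidHom.mulLeft M2.tau) (0, 1) ?_ d f hf)
    intro i j
    rw [AddMonoidHom.coe_mulLeft, ← mul_assoc, ← pow_succ']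
    exact mem_unitGr _ _ _ (by rw [succ_nsmul]; abel)
  rho_mem d f hf := by
    have h : unitModule.smul A1R.rho f = M2.rho * f :=
      LinearMap.congr_fun (opsHom_rho _ _ _ _ _ _ _ _ _ _ _ _) f
    refine Eq.mpr (congrArg (· ∈ _) h) (unitGr_map (AddMonoidHom.mulLeft M2.rho) (1, 1) ?_ d f hf)
    intro i j
    rw [AddMonoidHom.coe_mulLeft, mul_left_comm, ← pow_succ']
    exact mem_unitGr _ _ _ (by rw [succ_nsmul]; abel)
  sq1_mem d f hf := by
    have h : unitModule.smul A1R.sq1 f = unitSq1 f :=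
      LinearMap.congr_fun (opsHom_sq1 _ _ _ _ _ _ _ _ _ _ _ _) f
    refine Eq.mpr (congrArg (· ∈ _) h) (unitGr_map unitSq1.toAddMonoidHom (1, 0) ?_ d f hf)
    intro i j
    rw [LinearMap.toAddMonoidHom_coe, unitSq1_monomial]
    rcases i with _ | i
    · rw [zero_smul ℕ (_ : M2)]; exact zero_mem _
    · exact nsmul_mem (mem_unitGr _ _ _ (by ext <;> simp; ring)) _
  sq2_mem d f hf := by
    have h : unitModule.smul A1R.sq2 f = unitSq2 f :=
      LinearMap.congr_fun (opsHom_sq2 _ _ _ _ _ _ _ _ _ _ _ _) f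
    refine Eq.mpr (congrArg (· ∈ _) h) (unitGr_map unitSq2.toAddMonoidHom (2, 1) ?_ d f hf)
    intro i j
    rw [LinearMap.toAddMonoidHom_coe, unitSq2_monomial]
    rcases i with _ | _ | i
    · rw [Nat.choose_zero_succ, zero_smul ℕ (_ : M2)]; exact zero_mem _
    · rw [Nat.choose_eq_zero_of_lt (by norm_num), zero_smul ℕ (_ : M2)]; exact zero_mem _
    · exact nsmul_mem (mem_unitGr _ _ _ (by ext <;> simp; ring)) _

end Unit

/-! ### Stable invertibility -/

/-- `M` is finitely generated and free over `𝔽₂[τ, ρ]`. -/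
def IsFiniteFree (M : BigradedModule.{u}) : Prop :=
  Module.Finite M2 M ∧ Module.Free M2 M

/-- `P` is a finitely generated projective `A(1)^ℝ`-module. -/
def IsFiniteProjective (P : BigradedModule.{u}) : Prop :=
  Module.Finite A1R P ∧ Module.Projective A1R P

/-- `M` and `N` are stably equivalent: `M ⊕ P ≅ N ⊕ Q` for some finitely generated projective
bigraded modules `P` and `Q`. -/
def StablyEquivalent (M : BigradedModule.{u}) (N : BigradedModule.{v}) : Prop :=
  ∃ (P : BigradedModule.{u}) (Q : BigradedModule.{v}),
    P.IsFiniteProjective ∧ Q.IsFiniteProjective ∧ (M.prod P).Isomorphic (N.prod Q)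

/-- `M` is stably invertible: `M ⊗ N` is stably equivalent to the unit for some bigraded
module `N` that is finitely generated and free over `𝔽₂[τ, ρ]`. -/
def StablyInvertible (M : BigradedModule.{u}) : Prop :=
  ∃ N : BigradedModule.{u}, N.IsFiniteFree ∧ (M.tensor N).StablyEquivalent unit

/-! ### Reduction and Margolis homology -/

/-- Induction on elements of `A(1)^ℝ`. -/
theorem A1R_induction {p : A1R → Prop} (algebraMap : ∀ c : ZMod 2, p (algebraMap (ZMod 2) A1R c))
    (of : ∀ g, p (A1R.of g)) (mul : ∀ a b, p a → p b → p (a * b))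
    (add : ∀ a b, p a → p b → p (a + b)) (a : A1R) : p a := by
  obtain ⟨x, rfl⟩ := RingQuot.mkAlgHom_surjective (ZMod 2) Rel a
  induction x using FreeAlgebra.induction with
  | grade0 c => rw [AlgHom.commutes]; exact algebraMap c
  | grade1 g => exact of g
  | mul a b ha hb => rw [map_mul]; exact mul _ _ ha hb
  | add a b ha hb => rw [map_add]; exact add _ _ ha hb

/-- The submodule `(ρ, τ) M = ρ M + τ M` of `M`. -/
def rhoTau (M : BigradedModule.{u}) : Submodule A1R M where
  carrier := {z | ∃ x y : M, z = A1R.rho • x + A1R.tau • y}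
  zero_mem' := ⟨0, 0, by simp⟩
  add_mem' := by
    rintro _ _ ⟨x, y, rfl⟩ ⟨x', y', rfl⟩
    exact ⟨x + x', y + y', by rw [smul_add, smul_add]; abel⟩
  smul_mem' := by
    intro a
    induction a using A1R_induction with
    | algebraMap c =>
      rintro _ ⟨x, y, rfl⟩
      refine ⟨algebraMap (ZMod 2) A1R c • x, algebraMap (ZMod 2) A1R c • y, ?_⟩
      simp only [smul_add, ← mul_smul, Algebra.commutes]
    | of g =>
      rintro _ ⟨x, y, rfl⟩
      cases g with
      | tau => exact ⟨A1R.tau • x, A1R.tau • y, by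
          change A1R.tau • _ = _
          rw [smul_add, rho_tau_smul]⟩
      | rho => exact ⟨A1R.rho • x, A1R.rho • y, by
          change A1R.rho • _ = _
          rw [smul_add, rho_tau_smul]⟩
      | sq1 => exact ⟨A1R.sq1 • x + y, A1R.sq1 • y, by
          change A1R.sq1 • _ = _
          rw [smul_add, smul_add, sq1_rho_smul, sq1_tau_smul]; abel⟩
      | sq2 => exact ⟨A1R.sq2 • x, A1R.sq2 • y + A1R.rho • A1R.sq1 • y, by
          change A1R.sq2 • _ = _
          rw [smul_add, smul_add, sq2_rho_smul, sq2_tau_smul]⟩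
    | mul a b ha hb => intro z hz; rw [mul_smul]; exact ha (hb hz)
    | add a b ha hb =>
      intro z hz
      obtain ⟨x, y, h⟩ := ha hz
      obtain ⟨x', y', h'⟩ := hb hz
      exact ⟨x + x', y + y', by rw [add_smul, h, h', smul_add, smul_add]; abel⟩

/-- The reduction `M/(ρ, τ)`. -/
abbrev Reduction (M : BigradedModule.{u}) : Type u := M ⧸ M.rhoTau

/-- The action of `a` on `M/(ρ, τ)`, as an `𝔽₂`-linear map. -/
noncomputable def reductionAct (M : BigradedModule.{u}) (a : A1R) : M.Reduction →ₗ[ZMod 2] M.Reduction :=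
  Module.toModuleEnd (ZMod 2) (S := A1R) M.Reduction a

/-- The Margolis homology `H(M/(ρ, τ); a)`: the annihilator of `a` modulo the image of `a`. (It is
used for elements `a` whose square acts as zero on `M/(ρ, τ)`.) -/
abbrev MargolisHomology (M : BigradedModule.{u}) (a : A1R) : Type u :=
  LinearMap.ker (M.reductionAct a) ⧸
    (LinearMap.range (M.reductionAct a)).submoduleOf (LinearMap.ker (M.reductionAct a))

end BigradedModule

end RMotivic

/-!
Write `V_X = X/(ρ, τ)` for the reduction of a bigraded module `X`, and call `Q₀`, `Q₁`, `Sq²` the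
Margolis operators; they square to zero on `V_X`.

*Invertible modules have one-dimensional Margolis homology.* On `V_M ⊗ V_N = V_{M ⊗ N}` the
operators act by the Leibniz rule, as the correction term of the Cartan formula for `Sq²` is
divisible by `τ`. So the Künneth theorem holds (`finrank_margolisHomology_tensor`). A projective
module has exact reduction (`redExact_of_projective`), so Margolis homology is a stable invariant,
and that of the unit is one-dimensional. The dimensions for `M` and for its inverse multiply to `1`.

*Modules with one-dimensional Margolis homology are invertible.* The inverse is the dual
`M^∨ = Hom(M, 𝔽₂[τ, ρ])`. The evaluation `M ⊗ M^∨ → 𝔽₂[τ, ρ]` is linear over `A(1)`, and the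
canonical element `∑ bᵢ ⊗ bᵢ^∨` is killed by `Sq¹` and `Sq²`, since it corresponds to the identity
endomorphism of `M`. Evaluation takes it to the rank of `M`, which is the dimension of `V_M`; this
is odd as `V_M` has one-dimensional homology. So the unit splits off, `M ⊗ M^∨ ≅ 𝔽₂[τ, ρ] ⊕ K`,
and the reduction of `K` is acyclic for all three operators (`kernel_redAcyclic`).

Such a `K` is free over `A(1)` (`exists_linearEquiv_pi`). The operators `Sq¹` and `Sq²` remain exact
on the image of `Q₁`, and `Sq¹` on the image of `Sq² Q₁`, by induction on the degree, which is
bounded below (`exact_on_image`). So the kernel of the top operator `Sq¹ Sq² Q₁` of `V_K` is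
`Sq¹ V_K + Sq² V_K`, and the dimension of `V_K` is eight times that of its image. Homogeneous
elements whose images under the top operator form a basis of its image generate `V_K`, so their
lifts generate `K` by the graded Nakayama lemma. The eight words of `A(1)` applied to these lifts
span `K` over `𝔽₂[τ, ρ]`, and by the count of ranks they are a basis.
-/

namespace RMotivic

/-! ### Homology of a square-zero operator on an `𝔽₂`-vector space -/

section Homology

variable {V W : Type*} [AddCommGroup V] [Module (ZMod 2) V] [AddCommGroup W] [Module (ZMod 2) W]

/-- The homology `ker d / im d` of an operator `d`; the junk case `d² ≠ 0` uses `ker d ∩ im d`. -/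
abbrev Homology (d : V →ₗ[ZMod 2] V) : Type _ :=
  LinearMap.ker d ⧸ (LinearMap.range d).submoduleOf (LinearMap.ker d)

/-- A deformation retraction of the complex `(V, d)` onto a space `H` with zero
differential: maps `H → V → H` and a homotopy from the identity of `V` to their composite. -/
structure HomologyRetract (d : V →ₗ[ZMod 2] V) (H : Type*) [AddCommGroup H]
    [Module (ZMod 2) H] where
  incl : H →ₗ[ZMod 2] V
  retr : V →ₗ[ZMod 2] H
  htpy : V →ₗ[ZMod 2] V
  retr_incl : ∀ c, retr (incl c) = c
  d_incl : ∀ c, d (incl c) = 0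
  retr_d : ∀ v, retr (d v) = 0
  incl_retr : ∀ v, incl (retr v) = v + d (htpy v) + htpy (d v)

theorem HomologyRetract.finrank_homology {d : V →ₗ[ZMod 2] V} {H : Type*} [AddCommGroup H]
    [Module (ZMod 2) H] (D : HomologyRetract d H) :
    Module.finrank (ZMod 2) (Homology d) = Module.finrank (ZMod 2) H := by
  let f : LinearMap.ker d →ₗ[ZMod 2] H := D.retr ∘ₗ (LinearMap.ker d).subtype
  have hf : Function.Surjective f := fun c => ⟨⟨D.incl c, D.d_incl c⟩, D.retr_incl c⟩
  have hk : (LinearMap.range d).submoduleOf (LinearMap.ker d) = LinearMap.ker f := by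
    ext ⟨v, hv⟩
    rw [LinearMap.mem_ker]
    constructor
    · rintro ⟨w, hw⟩
      change D.retr v = 0
      rw [← show d w = v from hw, D.retr_d]
    · intro h
      have h1 := D.incl_retr v
      rw [show D.retr v = 0 from h, map_zero, show d v = 0 from hv, map_zero, add_zero] at h1
      exact ⟨D.htpy v, by
        rw [← ZModModule.neg_eq_self (d (D.htpy v))]
        exact (eq_neg_of_add_eq_zero_left h1.symm).symm⟩
  exact ((Submodule.quotEquivOfEq _ _ hk).trans (f.quotKerEquivOfSurjective hf)).finrank_eq

/-- Every complex over a field retracts onto its homology. -/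
theorem exists_homologyRetract (d : V →ₗ[ZMod 2] V) (hd : ∀ v, d (d v) = 0) :
    Nonempty (HomologyRetract d (Homology d)) := by
  obtain ⟨p, hp⟩ := (LinearMap.ker d).subtype.exists_leftInverse_of_injective
    (by simp)
  replace hp : ∀ z : LinearMap.ker d, p z = z := fun z => LinearMap.congr_fun hp z
  obtain ⟨s₀, hs₀⟩ := d.rangeRestrict.exists_rightInverse_of_surjective
    (LinearMap.range_eq_top.2 d.surjective_rangeRestrict)
  replace hs₀ : ∀ z, d (s₀ z) = z := fun z => congrArg Subtype.val (LinearMap.congr_fun hs₀ z)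
  let Q := (LinearMap.range d).submoduleOf (LinearMap.ker d)
  obtain ⟨i₀, hi₀⟩ := Q.mkQ.exists_rightInverse_of_surjective
    (LinearMap.range_eq_top.2 (Submodule.mkQ_surjective _))
  replace hi₀ : ∀ z, Q.mkQ (i₀ z) = z := fun z => LinearMap.congr_fun hi₀ z
  -- correct the section of `d` so that it takes values in the complement `ker p` of `ker d`
  let s : LinearMap.range d →ₗ[ZMod 2] V := s₀ - (LinearMap.ker d).subtype ∘ₗ p ∘ₗ s₀
  have hs : ∀ z, d (s z) = z := fun z => by simp [s, hs₀]
  have hps : ∀ z, p (s z) = 0 := fun z => by simp [s, hp]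
  let i : Homology d →ₗ[ZMod 2] V := (LinearMap.ker d).subtype ∘ₗ i₀
  let r : V →ₗ[ZMod 2] Homology d := Q.mkQ ∘ₗ p
  have hmem : ∀ v, (p v : V) - i (r v) ∈ LinearMap.range d := fun v => by
    have : p v - i₀ (r v) ∈ Q := by
      have h : Q.mkQ (p v - i₀ (r v)) = 0 := by
        rw [map_sub, hi₀]
        exact sub_self _
      rwa [← LinearMap.mem_ker, Submodule.ker_mkQ] at h
    exact this
  let e : V →ₗ[ZMod 2] LinearMap.range d :=
    LinearMap.codRestrict _ ((LinearMap.ker d).subtype ∘ₗ p - i ∘ₗ r) hmem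
  have hri : ∀ c, r (i c) = c := fun c => by
    change Q.mkQ (p (i₀ c)) = c
    rw [hp, hi₀]
  have hdi : ∀ c, d (i c) = 0 := fun c => (i₀ c).2
  have hrd : ∀ v, r (d v) = 0 := fun v => by
    change Q.mkQ (p (d v)) = 0
    have : p (d v) = ⟨d v, hd v⟩ := hp ⟨d v, hd v⟩
    rw [this, ← LinearMap.mem_ker, Submodule.ker_mkQ]
    exact ⟨v, rfl⟩
  refine ⟨⟨i, r, s ∘ₗ e, hri, hdi, hrd, fun v => ?_⟩⟩
  have h1 : d (s (e v)) = p v - i (r v) := by rw [hs]; rfl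
  have h2 : e (d v) = ⟨d v, v, rfl⟩ := by
    apply Subtype.ext
    change (p (d v) : V) - i (r (d v)) = d v
    have : p (d v) = ⟨d v, hd v⟩ := hp ⟨d v, hd v⟩
    rw [hrd, map_zero, sub_zero, this]
  have h3 : s (e (d v)) = v - p v := by
    have h : s (e (d v)) - v ∈ LinearMap.ker d := by
      rw [LinearMap.mem_ker, map_sub, h2, hs, sub_self]
    have h' := congrArg Subtype.val (hp ⟨_, h⟩)
    change (p (s (e (d v)) - v) : V) = s (e (d v)) - v at h'
    rw [map_sub, hps, zero_sub] at h'
    rw [eq_comm, sub_eq_iff_eq_add, ← sub_eq_iff_eq_add', ← neg_sub, ← h']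
    simp
  have h1' : d ((s ∘ₗ e) v) = p v + i (r v) := by
    rw [← ZModModule.sub_eq_add]; exact h1
  have h3' : (s ∘ₗ e) (d v) = v + p v := by
    rw [← ZModModule.sub_eq_add]; exact h3
  rw [h1', h3']
  have e1 := ZModModule.add_self v
  have e2 := ZModModule.add_self (p v : V)
  calc i (r v) = (v + v) + (p v + p v) + i (r v) := by rw [e1, e2]; simp
    _ = _ := by abel

/-- The tensor product of two retractions, for the differential `d ⊗ 1 + 1 ⊗ d'`. -/
noncomputable def HomologyRetract.tensor {d : V →ₗ[ZMod 2] V} {d' : W →ₗ[ZMod 2] W}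
    {H H' : Type*} [AddCommGroup H] [Module (ZMod 2) H] [AddCommGroup H'] [Module (ZMod 2) H']
    (D : HomologyRetract d H) (D' : HomologyRetract d' H')
    (δ : (V ⊗[ZMod 2] W) →ₗ[ZMod 2] (V ⊗[ZMod 2] W))
    (hδ : ∀ v w, δ (v ⊗ₜ w) = d v ⊗ₜ w + v ⊗ₜ d' w) :
    HomologyRetract δ (H ⊗[ZMod 2] H') where
  incl := TensorProduct.map D.incl D'.incl
  retr := TensorProduct.map D.retr D'.retr
  htpy := TensorProduct.map D.htpy LinearMap.id +
    TensorProduct.map (D.incl ∘ₗ D.retr) D'.htpy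
  retr_incl c := by
    induction c using TensorProduct.induction_on with
    | zero => simp
    | tmul x y => simp [D.retr_incl, D'.retr_incl]
    | add x y hx hy => rw [map_add, map_add, hx, hy]
  d_incl c := by
    induction c using TensorProduct.induction_on with
    | zero => simp
    | tmul x y => simp [hδ, D.d_incl, D'.d_incl]
    | add x y hx hy => rw [map_add, map_add, hx, hy, add_zero]
  retr_d c := by
    induction c using TensorProduct.induction_on with
    | zero => simp
    | tmul x y => simp [hδ, D.retr_d, D'.retr_d]
    | add x y hx hy => rw [map_add, map_add, hx, hy, add_zero]
  incl_retr c := by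
    induction c using TensorProduct.induction_on with
    | zero => simp
    | add x y hx hy =>
      simp only [map_add, hx, hy]; abel
    | tmul x y =>
      simp only [TensorProduct.map_tmul, LinearMap.add_apply, map_add, hδ, LinearMap.id_apply,
        LinearMap.comp_apply, D.d_incl, D.retr_d, map_zero, TensorProduct.zero_tmul, zero_add]
      simp only [D'.incl_retr, D.incl_retr, TensorProduct.tmul_add, TensorProduct.add_tmul]
      abel_nf
      simp [two_zsmul, ZModModule.add_self]

/-- The transposed retraction, on dual spaces. -/
noncomputable def HomologyRetract.dual {d : V →ₗ[ZMod 2] V} {H : Type*} [AddCommGroup H]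
    [Module (ZMod 2) H] (D : HomologyRetract d H) :
    HomologyRetract (Module.Dual.transpose (R := ZMod 2) d) (Module.Dual (ZMod 2) H) where
  incl := Module.Dual.transpose (R := ZMod 2) D.retr
  retr := Module.Dual.transpose (R := ZMod 2) D.incl
  htpy := Module.Dual.transpose (R := ZMod 2) D.htpy
  retr_incl c := LinearMap.ext fun x => congrArg c (D.retr_incl x)
  d_incl c := LinearMap.ext fun x => (congrArg c (D.retr_d x)).trans (map_zero c)
  retr_d c := LinearMap.ext fun x => (congrArg c (D.d_incl x)).trans (map_zero c)
  incl_retr c := LinearMap.ext fun x => by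
    refine (congrArg c (D.incl_retr x)).trans ?_
    simp only [map_add, LinearMap.add_apply, Module.Dual.transpose_apply, LinearMap.comp_apply]
    abel

/-- The transport of a retraction along an isomorphism of complexes. -/
noncomputable def HomologyRetract.congr {d : V →ₗ[ZMod 2] V} {d' : W →ₗ[ZMod 2] W} {H : Type*}
    [AddCommGroup H] [Module (ZMod 2) H] (D : HomologyRetract d H) (e : W ≃ₗ[ZMod 2] V)
    (he : ∀ w, e (d' w) = d (e w)) : HomologyRetract d' H where
  incl := e.symm.toLinearMap ∘ₗ D.incl
  retr := D.retr ∘ₗ e.toLinearMap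
  htpy := e.symm.toLinearMap ∘ₗ D.htpy ∘ₗ e.toLinearMap
  retr_incl c := by simp [D.retr_incl]
  d_incl c := e.injective (by simp [he, D.d_incl])
  retr_d c := by simp [he, D.retr_d]
  incl_retr c := e.injective (by simp [he, D.incl_retr])

/-- A chain map that is injective and surjective on homology preserves its dimension. -/
theorem finrank_homology_eq {d : V →ₗ[ZMod 2] V} {d' : W →ₗ[ZMod 2] W} (f : V →ₗ[ZMod 2] W)
    (hf : ∀ v, f (d v) = d' (f v)) (inj : ∀ v w, d v = 0 → f v = d' w → ∃ v', v = d v')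
    (surj : ∀ w, d' w = 0 → ∃ v w', d v = 0 ∧ w = f v + d' w') :
    Module.finrank (ZMod 2) (Homology d) = Module.finrank (ZMod 2) (Homology d') := by
  let Q := (LinearMap.range d').submoduleOf (LinearMap.ker d')
  let g : LinearMap.ker d →ₗ[ZMod 2] LinearMap.ker d' :=
    f.restrict (fun v (hv : d v = 0) => show d' (f v) = 0 by rw [← hf, hv, map_zero])
  let G : LinearMap.ker d →ₗ[ZMod 2] Homology d' := Q.mkQ ∘ₗ g
  have hG : Function.Surjective G := by
    intro c
    obtain ⟨⟨w, hw⟩, rfl⟩ := Q.mkQ_surjective c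
    obtain ⟨v, w', hv, rfl⟩ := surj w hw
    refine ⟨⟨v, hv⟩, ?_⟩
    rw [← sub_eq_zero, LinearMap.comp_apply, ← map_sub, ← LinearMap.mem_ker, Submodule.ker_mkQ]
    exact ⟨-w', by change d' (-w') = f v - (f v + d' w'); rw [map_neg]; abel⟩
  have hk : (LinearMap.range d).submoduleOf (LinearMap.ker d) = LinearMap.ker G := by
    ext ⟨v, hv⟩
    rw [LinearMap.mem_ker, LinearMap.comp_apply, ← LinearMap.mem_ker (f := Q.mkQ),
      Submodule.ker_mkQ]
    constructor
    · rintro ⟨w, hw⟩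
      exact ⟨f w, by rw [← hf]; exact congrArg f hw⟩
    · rintro ⟨w, hw⟩
      obtain ⟨v', h⟩ := inj v w hv hw.symm
      exact ⟨v', h.symm⟩
  exact ((Submodule.quotEquivOfEq _ _ hk).trans (G.quotKerEquivOfSurjective hG)).finrank_eq

/-- Over `𝔽₂`, a space with one-dimensional homology has odd dimension. -/
theorem odd_finrank_of_homology [Module.Finite (ZMod 2) V] (d : V →ₗ[ZMod 2] V)
    (hd : ∀ v, d (d v) = 0) (h : Module.finrank (ZMod 2) (Homology d) = 1) :
    Odd (Module.finrank (ZMod 2) V) := by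
  have h1 := d.finrank_range_add_finrank_ker
  have h2 := Submodule.finrank_quotient_add_finrank
    ((LinearMap.range d).submoduleOf (LinearMap.ker d))
  have hle : LinearMap.range d ≤ LinearMap.ker d := by
    rintro _ ⟨v, rfl⟩
    exact hd v
  have h3 := (Submodule.submoduleOfEquivOfLe hle).finrank_eq
  rw [h3, h] at h2
  exact ⟨Module.finrank (ZMod 2) (LinearMap.range d), by omega⟩

/-- When the homology is one-dimensional, every cycle is a multiple of a given cycle that is not
a boundary, up to a boundary. -/
theorem exists_smul_add_of_homology {d : V →ₗ[ZMod 2] V}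
    (h : Module.finrank (ZMod 2) (Homology d) = 1) (c : V) (hc : d c = 0) (hc' : ∀ v, d v ≠ c)
    (w : V) (hw : d w = 0) : ∃ (s : ZMod 2) (v : V), w = s • c + d v := by
  let Q := (LinearMap.range d).submoduleOf (LinearMap.ker d)
  have hne : Q.mkQ ⟨c, hc⟩ ≠ 0 := by
    intro h0
    rw [← LinearMap.mem_ker, Submodule.ker_mkQ] at h0
    obtain ⟨v, hv⟩ := h0
    exact hc' v hv
  obtain ⟨s, hs⟩ := (finrank_eq_one_iff_of_nonzero' _ hne).1 h (Q.mkQ ⟨w, hw⟩)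
  rw [← map_smul, ← sub_eq_zero, ← map_sub, ← LinearMap.mem_ker, Submodule.ker_mkQ] at hs
  obtain ⟨v, hv⟩ := hs
  refine ⟨s, -v, ?_⟩
  rw [map_neg, show d v = s • c - w from hv]
  abel

end Homology

/-! ### The coefficient ring and linearity criteria -/

namespace M2

/-- `𝔽₂[τ, ρ]` is spanned by the monomials, built from `1` by multiplication by `τ` and `ρ`. -/
theorem induction_mul {p : M2 → Prop} (one : p 1) (htau : ∀ f, p f → p (tau * f))
    (hrho : ∀ f, p f → p (rho * f)) (add : ∀ a b, p a → p b → p (a + b)) (f : M2) : p f := by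
  have key : ∀ r : M2, ∀ c, p c → p (r * c) := fun r =>
    M2.induction (p := fun r => ∀ c, p c → p (r * c)) (fun c hc => by rwa [one_mul])
      htau hrho (fun a b ha hb c hc => by rw [add_mul]; exact add _ _ (ha c hc) (hb c hc))
      (fun a b ha hb c hc => by rw [mul_assoc]; exact ha _ (hb c hc)) r
  simpa using key f 1 one

/-- The augmentation `𝔽₂[τ, ρ] → 𝔽₂` killing `τ` and `ρ`. -/
noncomputable def aug : M2 →+* ZMod 2 :=
  (Polynomial.constantCoeff (R := ZMod 2)).comp Polynomial.constantCoeff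

@[simp] theorem aug_tau : aug tau = 0 := by simp [aug, tau]
@[simp] theorem aug_rho : aug rho = 0 := by simp [aug, rho]

/-- A polynomial is its constant term up to the ideal `(ρ, τ)`. -/
theorem exists_eq_aug (f : M2) :
    ∃ g h : M2, f = algebraMap (ZMod 2) M2 (aug f) + (rho * g + tau * h) := by
  induction f using M2.induction_mul with
  | one => exact ⟨0, 0, by simp⟩
  | htau f _ => exact ⟨0, f, by simp⟩
  | hrho f _ => exact ⟨f, 0, by simp⟩
  | add a b ha hb =>
    obtain ⟨g, h, ha⟩ := ha
    obtain ⟨g', h', hb⟩ := hb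
    refine ⟨g + g', h + h', ?_⟩
    rw [map_add, map_add]
    linear_combination ha + hb

end M2

theorem zmod_two_cases (c : ZMod 2) : c = 0 ∨ c = 1 := by revert c; decide

/-- An additive map commuting with the four generators is `A(1)^ℝ`-linear. -/
def linearOfGens {X Y : Type*} [AddCommGroup X] [Module A1R X] [AddCommGroup Y] [Module A1R Y]
    (f : X →+ Y) (ht : ∀ x, f (A1R.tau • x) = A1R.tau • f x)
    (hr : ∀ x, f (A1R.rho • x) = A1R.rho • f x) (h1 : ∀ x, f (A1R.sq1 • x) = A1R.sq1 • f x)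
    (h2 : ∀ x, f (A1R.sq2 • x) = A1R.sq2 • f x) : X →ₗ[A1R] Y where
  toFun := f
  map_add' := f.map_add
  map_smul' a := by
    induction a using BigradedModule.A1R_induction with
    | algebraMap c =>
      intro x
      rcases zmod_two_cases c with rfl | rfl
      · simp
      · simp
    | of g => cases g with
      | tau => exact ht
      | rho => exact hr
      | sq1 => exact h1
      | sq2 => exact h2
    | mul a b ha hb =>
      intro x
      rw [mul_smul, ha, hb, RingHom.id_apply, RingHom.id_apply, RingHom.id_apply, mul_smul]
    | add a b ha hb =>
      intro x
      rw [add_smul, map_add, ha, hb, RingHom.id_apply, RingHom.id_apply, RingHom.id_apply,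
        add_smul]

/-- An additive map commuting with `τ` and `ρ` is `𝔽₂[τ, ρ]`-linear. -/
def m2LinearOfGens {X Y : Type*} [AddCommGroup X] [Module M2 X] [AddCommGroup Y] [Module M2 Y]
    (f : X →+ Y) (ht : ∀ x, f (M2.tau • x) = M2.tau • f x)
    (hr : ∀ x, f (M2.rho • x) = M2.rho • f x) : X →ₗ[M2] Y where
  toFun := f
  map_add' := f.map_add
  map_smul' c := by
    induction c using M2.induction with
    | one => simp
    | htau => exact ht
    | hrho => exact hr
    | add a b ha hb => intro x; rw [add_smul, map_add, ha, hb]; simp [add_smul]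
    | mul a b ha hb => intro x; rw [mul_smul, ha, hb]; simp [mul_smul]

namespace BigradedModule

/-- An `A(1)^ℝ`-linear map is `𝔽₂[τ, ρ]`-linear. -/
def toM2Linear {X : BigradedModule.{u}} {Y : BigradedModule.{v}} (f : X →ₗ[A1R] Y) :
    X →ₗ[M2] Y where
  toFun := f
  map_add' := f.map_add
  map_smul' c x := f.map_smul (M2.toA1R c) x

@[simp] theorem toM2Linear_apply {X : BigradedModule.{u}} {Y : BigradedModule.{v}}
    (f : X →ₗ[A1R] Y) (x : X) : toM2Linear f x = f x := rfl

theorem smul_smul_comm_tau (X : BigradedModule.{u}) (c : M2) (x : X) :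
    c • A1R.tau • x = A1R.tau • c • x := by
  rw [← tau_smul, ← tau_smul, smul_comm]

theorem algebraMap_smul (X : BigradedModule.{u}) (c : ZMod 2) (x : X) :
    algebraMap (ZMod 2) M2 c • x = c • x := by
  rcases zmod_two_cases c with rfl | rfl
  · simp
  · simp

/-! ### The unit object and the Cartan formula for scalars -/

section Unit

/-- The unit object is free of rank one over the coefficient ring. -/
noncomputable def unitEquiv : unit ≃ₗ[M2] M2 :=
  LinearEquiv.ofBijective
    (m2LinearOfGens (X := unit) (Y := M2) (AddMonoidHom.id M2)
      (fun x => by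
        rw [tau_smul]
        exact LinearMap.congr_fun (opsHom_tau (T := M2) _ _ _ _ _ _ _ _ _ _ _ _) x)
      (fun x => by
        rw [rho_smul]
        exact LinearMap.congr_fun (opsHom_rho (T := M2) _ _ _ _ _ _ _ _ _ _ _ _) x))
    Function.bijective_id

theorem unitEquiv_tau_smul (f : unit) : unitEquiv (A1R.tau • f) = M2.tau * unitEquiv f := by
  rw [← tau_smul, map_smul, smul_eq_mul]

theorem unitEquiv_rho_smul (f : unit) : unitEquiv (A1R.rho • f) = M2.rho * unitEquiv f := by
  rw [← rho_smul, map_smul, smul_eq_mul]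

theorem unitEquiv_sq1_smul (f : unit) : unitEquiv (A1R.sq1 • f) = unitSq1 (unitEquiv f) :=
  LinearMap.congr_fun (opsHom_sq1 (T := M2) _ _ _ _ _ _ _ _ _ _ _ _) f

theorem unitEquiv_sq2_smul (f : unit) : unitEquiv (A1R.sq2 • f) = unitSq2 (unitEquiv f) :=
  LinearMap.congr_fun (opsHom_sq2 (T := M2) _ _ _ _ _ _ _ _ _ _ _ _) f

theorem unitEquiv_mem {d : ℤ × ℤ} {f : unit} : unitEquiv f ∈ unitGr d ↔ f ∈ unit.gr d := Iff.rfl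

end Unit

variable (X : BigradedModule.{u})

theorem sq1_smul_smul (c : M2) (x : X) :
    A1R.sq1 • c • x = unitSq1 c • x + c • A1R.sq1 • x := by
  induction c using M2.induction_mul with
  | one => simp [unitSq1_one]
  | htau f hf =>
    rw [mul_smul, tau_smul, sq1_tau_smul, hf, unitSq1_tau, add_smul, mul_smul, mul_smul, mul_smul,
      tau_smul, tau_smul, rho_smul, smul_add]
    abel
  | hrho f hf =>
    rw [mul_smul, rho_smul, sq1_rho_smul, hf, unitSq1_rho, mul_smul, mul_smul,
      rho_smul, rho_smul, smul_add]
  | add a b ha hb => rw [add_smul, smul_add, ha, hb, map_add, add_smul, add_smul]; abel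

theorem sq2_smul_smul (c : M2) (x : X) :
    A1R.sq2 • c • x = unitSq2 c • x + c • A1R.sq2 • x + A1R.tau • unitSq1 c • A1R.sq1 • x := by
  induction c using M2.induction_mul with
  | one => simp [unitSq1_one, unitSq2_one]
  | htau f hf =>
    rw [mul_smul, tau_smul, sq2_tau_smul, hf, unitSq1_tau, unitSq2_tau, sq1_smul_smul]
    simp only [add_smul, mul_smul, tau_smul, rho_smul, smul_add]
    abel
  | hrho f hf =>
    rw [mul_smul, rho_smul, sq2_rho_smul, hf, unitSq1_rho, unitSq2_rho]
    simp only [mul_smul, rho_smul, smul_add, rho_tau_smul]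
  | add a b ha hb =>
    rw [add_smul, smul_add, ha, hb, map_add, map_add]
    simp only [add_smul, smul_add]
    abel

/-! ### The reduction modulo `(ρ, τ)` -/

variable {X}

/-- The class of an element in the reduction. -/
def red (x : X) : X.Reduction := Submodule.Quotient.mk x

theorem red_surjective : Function.Surjective (red (X := X)) := Submodule.Quotient.mk_surjective _

@[simp] theorem red_add (x y : X) : red (x + y) = red x + red y := rfl
@[simp] theorem red_zero : red (0 : X) = 0 := rfl
@[simp] theorem red_sub (x y : X) : red (x - y) = red x - red y := rfl
theorem smul_red (a : A1R) (x : X) : a • red x = red (a • x) := rfl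

theorem red_sum {ι : Type*} (s : Finset ι) (f : ι → X) :
    red (∑ i ∈ s, f i) = ∑ i ∈ s, red (f i) :=
  map_sum X.rhoTau.mkQ f s

theorem red_eq_zero_iff (x : X) : red x = 0 ↔ ∃ y z : X, x = A1R.rho • y + A1R.tau • z :=
  Submodule.Quotient.mk_eq_zero _

theorem tau_smul_red (v : X.Reduction) : A1R.tau • v = 0 := by
  obtain ⟨x, rfl⟩ := red_surjective v
  rw [smul_red, red_eq_zero_iff]
  exact ⟨0, x, by simp⟩

theorem rho_smul_red (v : X.Reduction) : A1R.rho • v = 0 := by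
  obtain ⟨x, rfl⟩ := red_surjective v
  rw [smul_red, red_eq_zero_iff]
  exact ⟨x, 0, by simp⟩

theorem red_zmod_smul (c : ZMod 2) (x : X) : red (c • x) = c • red x := rfl

theorem red_m2_smul (c : M2) (x : X) : red (c • x) = M2.aug c • red x := by
  obtain ⟨g, h, hc⟩ := M2.exists_eq_aug c
  have : c • x = M2.aug c • x + (A1R.rho • g • x + A1R.tau • h • x) := by
    rw [← tau_smul, ← rho_smul, ← mul_smul, ← mul_smul, ← algebraMap_smul, ← add_smul, ← add_smul,
      ← hc]
  rw [this, red_add, (red_eq_zero_iff _).2 ⟨_, _, rfl⟩, add_zero, red_zmod_smul]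

theorem reductionAct_apply (a : A1R) (v : X.Reduction) : X.reductionAct a v = a • v := rfl

theorem sq2_sq2_red (v : X.Reduction) : A1R.sq2 • A1R.sq2 • v = 0 := by
  rw [← mul_smul, A1R.sq2_sq2, mul_smul, mul_smul, mul_smul, tau_smul_red]

theorem sq1_sq1_red (v : X.Reduction) : A1R.sq1 • A1R.sq1 • v = 0 := by
  rw [← mul_smul, A1R.sq1_sq1, zero_smul]

theorem Q1_smul {Y : Type*} [AddCommGroup Y] [Module A1R Y] (v : Y) :
    A1R.Q1 • v = A1R.sq1 • A1R.sq2 • v + A1R.sq2 • A1R.sq1 • v := by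
  rw [A1R.Q1, add_smul, mul_smul, mul_smul]

theorem Q0_smul {Y : Type*} [AddCommGroup Y] [Module A1R Y] (v : Y) :
    A1R.Q0 • v = A1R.sq1 • v := rfl

theorem sq1212_smul {Y : Type*} [AddCommGroup Y] [Module A1R Y] (v : Y) :
    A1R.sq1 • A1R.sq2 • A1R.sq1 • A1R.sq2 • v = A1R.sq2 • A1R.sq1 • A1R.sq2 • A1R.sq1 • v := by
  simp only [← mul_smul, ← mul_assoc, A1R.sq1212]

theorem Q1_Q1_red (v : X.Reduction) : A1R.Q1 • A1R.Q1 • v = 0 := by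
  simp only [Q1_smul, smul_add, sq1_sq1_red, sq2_sq2_red, sq1212_smul, smul_zero, zero_add,
    add_zero, ZModModule.add_self]

/-- The three operators whose homology is considered. -/
def IsMargolis (a : A1R) : Prop := a = A1R.Q0 ∨ a = A1R.Q1 ∨ a = A1R.sq2

theorem IsMargolis.sq_red {a : A1R} (ha : IsMargolis a) (v : X.Reduction) : a • a • v = 0 := by
  rcases ha with rfl | rfl | rfl
  · exact sq1_sq1_red v
  · exact Q1_Q1_red v
  · exact sq2_sq2_red v

/-- The map induced on reductions by a linear map. -/
noncomputable def redMap {Y : BigradedModule.{v}} (f : X →ₗ[A1R] Y) :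
    X.Reduction →ₗ[A1R] Y.Reduction :=
  Submodule.mapQ _ _ f (by
    rintro _ ⟨x, y, rfl⟩
    exact ⟨f x, f y, by simp⟩)

@[simp] theorem redMap_red {Y : BigradedModule.{v}} (f : X →ₗ[A1R] Y) (x : X) :
    redMap f (red x) = red (f x) := rfl

/-- A basis over `𝔽₂[τ, ρ]` gives coordinates on the reduction. -/
noncomputable def redCoords {ι : Type*} [Fintype ι] (b : Module.Basis ι M2 X) :
    X.Reduction ≃ₗ[ZMod 2] (ι → ZMod 2) := by
  let f : X →+ (ι → ZMod 2) :=
    { toFun := fun x i => M2.aug (b.repr x i)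
      map_zero' := by ext; simp
      map_add' := fun x y => by ext; simp }
  have hf : ∀ x : X, f x = 0 ↔ red x = 0 := by
    intro x
    constructor
    · intro h
      rw [← b.sum_repr x, red_sum]
      refine Finset.sum_eq_zero fun i _ => ?_
      rw [red_m2_smul, show M2.aug (b.repr x i) = 0 from congrFun h i, zero_smul]
    · intro h
      obtain ⟨y, z, rfl⟩ := (red_eq_zero_iff x).1 h
      ext i
      change M2.aug (b.repr _ i) = 0
      rw [← tau_smul, ← rho_smul]
      simp
  let g : X.Reduction →+ (ι → ZMod 2) :=
    QuotientAddGroup.lift X.rhoTau.toAddSubgroup f fun x hx =>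
      (hf x).2 ((Submodule.Quotient.mk_eq_zero _).2 hx)
  have hg : ∀ x, g (red x) = f x := fun _ => rfl
  refine LinearEquiv.ofBijective (g.toZModLinearMap 2) ⟨?_, ?_⟩
  · rw [injective_iff_map_eq_zero]
    intro v hv
    obtain ⟨x, rfl⟩ := red_surjective v
    exact (hf x).1 hv
  · intro c
    refine ⟨red (∑ i, c i • b i), ?_⟩
    change f (∑ i, c i • b i) = c
    ext i
    change M2.aug (b.repr _ i) = _
    simp only [← algebraMap_smul]
    rw [Module.Basis.repr_sum_self]
    rcases zmod_two_cases (c i) with h | h <;> simp [h]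

theorem finite_reduction (hX : Module.Finite M2 X) : Module.Finite (ZMod 2) X.Reduction := by
  obtain ⟨s, hs⟩ := hX
  classical
  refine ⟨s.image red, ?_⟩
  rw [eq_top_iff]
  rintro v -
  obtain ⟨x, rfl⟩ := red_surjective v
  have hx : x ∈ Submodule.span M2 (s : Set X) := by rw [hs]; trivial
  induction hx using Submodule.span_induction with
  | mem x hx => exact Submodule.subset_span (by simpa using ⟨x, hx, rfl⟩)
  | zero => exact zero_mem _
  | add x y _ _ hx hy => exact add_mem hx hy
  | smul c x _ hx => rw [red_m2_smul]; exact Submodule.smul_mem _ _ hx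

theorem finrank_reduction (hX : X.IsFiniteFree) :
    Module.finrank (ZMod 2) X.Reduction = Module.finrank M2 X := by
  obtain ⟨h1, h2⟩ := hX
  rw [(redCoords (Module.finBasis M2 X)).finrank_eq]
  simp

end BigradedModule

/-! ### The eight words spanning `A(1)^ℝ` over the scalars -/

namespace A1R

/-- The words `1, Sq¹, Sq², Sq¹Sq², Sq²Sq¹, Sq¹Sq²Sq¹, Sq²Sq¹Sq², Sq¹Sq²Sq¹Sq²`. -/
def word : Fin 8 → A1R :=
  ![1, sq1, sq2, sq1 * sq2, sq2 * sq1, sq1 * sq2 * sq1, sq2 * sq1 * sq2, sq1 * sq2 * sq1 * sq2]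

/-- `A(1)^ℝ` as a left module over the scalars `𝔽₂[τ, ρ]`. -/
@[reducible]
noncomputable def m2Module : Module M2 A1R := Module.compHom A1R M2.toA1R

section Words

attribute [local instance] m2Module

theorem m2_smul_def (c : M2) (x : A1R) : c • x = M2.toA1R c * x := rfl

theorem m2_tau_smul (x : A1R) : M2.tau • x = tau * x := by rw [m2_smul_def, M2.toA1R_tau]
theorem m2_rho_smul (x : A1R) : M2.rho • x = rho * x := by rw [m2_smul_def, M2.toA1R_rho]

theorem sq1_mul_mem_span {x : A1R} (hx : x ∈ Submodule.span M2 (Set.range word)) :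
    sq1 * x ∈ Submodule.span M2 (Set.range word) := by
  have hw : ∀ i, word i ∈ Submodule.span M2 (Set.range word) := fun i =>
    Submodule.subset_span ⟨i, rfl⟩
  induction hx using Submodule.span_induction with
  | mem x hx =>
    obtain ⟨i, rfl⟩ := hx
    have key : sq1 * word i = ![word 1, 0, word 3, 0, word 5, 0, word 7, 0] i := by
      fin_cases i <;> simp [word, ← mul_assoc, sq1_sq1, sq1212]
      rw [mul_assoc (sq2 * sq1 * sq2), sq1_sq1, mul_zero]
    rw [key]
    fin_cases i <;> simp [hw]
  | zero => rw [mul_zero]; exact zero_mem _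
  | add x y _ _ hx hy => rw [mul_add]; exact add_mem hx hy
  | smul c x hx' hx =>
    induction c using M2.induction_mul with
    | one => rwa [one_smul]
    | htau c hc =>
      rw [mul_smul, m2_tau_smul, ← mul_assoc, sq1_tau, add_mul, mul_assoc, ← m2_tau_smul,
        ← m2_rho_smul]
      exact add_mem (Submodule.smul_mem _ _ hc)
        (Submodule.smul_mem _ _ (Submodule.smul_mem _ _ hx'))
    | hrho c hc =>
      rw [mul_smul, m2_rho_smul, ← mul_assoc, sq1_rho, mul_assoc, ← m2_rho_smul]
      exact Submodule.smul_mem _ _ hc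
    | add a b ha hb => rw [add_smul, mul_add]; exact add_mem ha hb

theorem sq2_mul_mem_span {x : A1R} (hx : x ∈ Submodule.span M2 (Set.range word)) :
    sq2 * x ∈ Submodule.span M2 (Set.range word) := by
  have hw : ∀ i, word i ∈ Submodule.span M2 (Set.range word) := fun i =>
    Submodule.subset_span ⟨i, rfl⟩
  induction hx using Submodule.span_induction with
  | mem x hx =>
    obtain ⟨i, rfl⟩ := hx
    have h0 : ∀ z, sq1 * (sq1 * z) = 0 := fun z => by rw [← mul_assoc, sq1_sq1, zero_mul]
    have h2 : ∀ z, sq2 * (sq2 * z) = tau * (sq1 * (sq2 * (sq1 * z))) := fun z => by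
      rw [← mul_assoc, sq2_sq2]; simp only [mul_assoc]
    have key : sq2 * word i =
        ![word 2, word 4, M2.tau • word 5, word 6, 0, word 7, 0, 0] i := by
      fin_cases i
      · simp [word]
      · simp [word]
      · simp [word, sq2_sq2, m2_tau_smul, mul_assoc]
      · simp [word, mul_assoc]
      · simp [word, h2, sq1_sq1]
      · simp [word, sq1212, ← mul_assoc]
      · simp [word, mul_assoc, h2, h0]
      · have : word 7 = sq2 * sq1 * sq2 * sq1 := sq1212
        change sq2 * word 7 = 0
        rw [this]
        simp [mul_assoc, h2, h0]
    rw [key]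
    fin_cases i <;> simp [hw, Submodule.smul_mem]
  | zero => rw [mul_zero]; exact zero_mem _
  | add x y _ _ hx hy => rw [mul_add]; exact add_mem hx hy
  | smul c x hx' hx =>
    induction c using M2.induction_mul with
    | one => rwa [one_smul]
    | htau c hc =>
      rw [mul_smul, m2_tau_smul, ← mul_assoc, sq2_tau, add_mul, mul_assoc, mul_assoc, mul_assoc,
        ← m2_tau_smul, ← m2_tau_smul, ← m2_rho_smul]
      exact add_mem (Submodule.smul_mem _ _ hc) (Submodule.smul_mem _ _ (Submodule.smul_mem _ _
        (sq1_mul_mem_span (Submodule.smul_mem _ _ hx'))))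
    | hrho c hc =>
      rw [mul_smul, m2_rho_smul, ← mul_assoc, sq2_rho, mul_assoc, ← m2_rho_smul]
      exact Submodule.smul_mem _ _ hc
    | add a b ha hb => rw [add_smul, mul_add]; exact add_mem ha hb

/-- The span of the words is a left ideal, as it is stable under the four generators, and it
contains `1`. -/
theorem span_word : Submodule.span M2 (Set.range word) = ⊤ := by
  rw [eq_top_iff]
  rintro x -
  have key : ∀ a : A1R, ∀ x ∈ Submodule.span M2 (Set.range word),
      a * x ∈ Submodule.span M2 (Set.range word) := by
    intro a
    induction a using BigradedModule.A1R_induction with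
    | algebraMap c =>
      intro x hx
      rcases zmod_two_cases c with rfl | rfl
      · rw [map_zero, zero_mul]; exact zero_mem _
      · rwa [map_one, one_mul]
    | of g =>
      intro x hx
      cases g with
      | tau => rw [show of .tau * x = M2.tau • x from (m2_tau_smul x).symm]
               exact Submodule.smul_mem _ _ hx
      | rho => rw [show of .rho * x = M2.rho • x from (m2_rho_smul x).symm]
               exact Submodule.smul_mem _ _ hx
      | sq1 => exact sq1_mul_mem_span hx
      | sq2 => exact sq2_mul_mem_span hx
    | mul a b ha hb => intro x hx; rw [mul_assoc]; exact ha _ (hb _ hx)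
    | add a b ha hb => intro x hx; rw [add_mul]; exact add_mem (ha _ hx) (hb _ hx)
  rw [← mul_one x]
  exact key x 1 (Submodule.subset_span ⟨0, rfl⟩)

theorem exists_eq_sum_word (x : A1R) : ∃ m : Fin 8 → M2, x = ∑ i, M2.toA1R (m i) * word i := by
  have hx : x ∈ Submodule.span M2 (Set.range word) := by rw [span_word]; trivial
  obtain ⟨m, hm⟩ := (Submodule.mem_span_range_iff_exists_fun M2).1 hx
  exact ⟨m, hm.symm⟩

end Words

end A1R

/-! ### Reductions of projective modules are exact -/

/-- The algebra `A(1)^ℝ/(ρ, τ)`, as the left module with the eight words as a basis. -/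
abbrev WordModel : Type := Fin 8 → ZMod 2

namespace WordModel

/-- Left multiplication by `Sq¹` in the basis of words. -/
def opA : WordModel →ₗ[ZMod 2] WordModel where
  toFun x := ![0, x 0, 0, x 2, 0, x 4, 0, x 6]
  map_add' x y := by ext i; fin_cases i <;> simp
  map_smul' c x := by ext i; fin_cases i <;> simp

/-- Left multiplication by `Sq²` in the basis of words. -/
def opB : WordModel →ₗ[ZMod 2] WordModel where
  toFun x := ![0, 0, x 0, 0, x 1, 0, x 3, x 5]
  map_add' x y := by ext i; fin_cases i <;> simp
  map_smul' c x := by ext i; fin_cases i <;> simp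

theorem opA_apply (x : WordModel) : opA x = ![0, x 0, 0, x 2, 0, x 4, 0, x 6] := rfl
theorem opB_apply (x : WordModel) : opB x = ![0, 0, x 0, 0, x 1, 0, x 3, x 5] := rfl

noncomputable instance : Module A1R WordModel :=
  moduleOfOps 0 0 opA opB (by simp) (by simp) (by simp) (by simp) (by simp)
    (by ext i j; fin_cases j <;> simp [opA_apply])
    (by ext i j; fin_cases j <;> simp [opB_apply])
    (by ext i j; fin_cases j <;> simp [opA_apply, opB_apply])

theorem tau_smul (x : WordModel) : A1R.tau • x = 0 :=
  LinearMap.congr_fun (opsHom_tau (T := WordModel) _ _ _ _ _ _ _ _ _ _ _ _) x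
theorem rho_smul (x : WordModel) : A1R.rho • x = 0 :=
  LinearMap.congr_fun (opsHom_rho (T := WordModel) _ _ _ _ _ _ _ _ _ _ _ _) x
theorem sq1_smul (x : WordModel) : A1R.sq1 • x = opA x :=
  LinearMap.congr_fun (opsHom_sq1 (T := WordModel) _ _ _ _ _ _ _ _ _ _ _ _) x
theorem sq2_smul (x : WordModel) : A1R.sq2 • x = opB x :=
  LinearMap.congr_fun (opsHom_sq2 (T := WordModel) _ _ _ _ _ _ _ _ _ _ _ _) x

/-- The Margolis operators are exact on the model; in the basis of words a preimage of a cycle is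
read off from its coordinates. -/
theorem exact {α : A1R} (hα : BigradedModule.IsMargolis α) (x : WordModel) (hx : α • x = 0) :
    ∃ y : WordModel, x = α • y := by
  rcases hα with rfl | rfl | rfl
  · rw [BigradedModule.Q0_smul, sq1_smul] at hx
    refine ⟨![x 1, 0, x 3, 0, x 5, 0, x 7, 0], ?_⟩
    rw [BigradedModule.Q0_smul, sq1_smul]
    have h0 := congrFun hx 1
    have h2 := congrFun hx 3
    have h4 := congrFun hx 5
    have h6 := congrFun hx 7
    simp [opA_apply] at h0 h2 h4 h6
    ext i; fin_cases i <;> simp [opA_apply, *]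
  · rw [BigradedModule.Q1_smul, sq1_smul, sq2_smul, sq1_smul, sq2_smul] at hx
    refine ⟨![x 3, x 5, x 6, 0, x 7, 0, 0, 0], ?_⟩
    rw [BigradedModule.Q1_smul, sq1_smul, sq2_smul, sq1_smul, sq2_smul]
    have h0 := congrFun hx 3
    have h1 := congrFun hx 5
    have h2 := congrFun hx 6
    have h3 := congrFun hx 7
    simp [opA_apply, opB_apply] at h0 h1 h2 h3
    have h4 : x 4 = x 3 := (CharTwo.add_eq_zero.1 h3).symm
    ext i; fin_cases i <;> simp [opA_apply, opB_apply, *]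
  · rw [sq2_smul] at hx
    refine ⟨![x 2, x 4, 0, x 6, 0, x 7, 0, 0], ?_⟩
    rw [sq2_smul]
    have h0 := congrFun hx 2
    have h1 := congrFun hx 4
    have h3 := congrFun hx 6
    have h5 := congrFun hx 7
    simp [opB_apply] at h0 h1 h3 h5
    ext i; fin_cases i <;> simp [opB_apply, *]

end WordModel

/-- Exactness of the operator `α` on the reduction `Y/(ρY + τY)`, for a module without grading. -/
def RedExact (α : A1R) (Y : Type*) [AddCommGroup Y] [Module A1R Y] : Prop :=
  ∀ x u v : Y, α • x = A1R.rho • u + A1R.tau • v →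
    ∃ y u' v' : Y, x = α • y + (A1R.rho • u' + A1R.tau • v')

open BigradedModule in
/-- The algebra itself has exact reduction, since its reduction is the model on eight words. -/
theorem redExact_A1R {α : A1R} (hα : IsMargolis α) : RedExact α A1R := by
  -- `I = ρA + τA`, and `x ≡ σ (x • e₀)` modulo `I`, where `σ` sends basis vectors to words
  let e₀ : WordModel := ![1, 0, 0, 0, 0, 0, 0, 0]
  let I : AddSubgroup A1R :=
    { carrier := {x | ∃ u v, x = A1R.rho * u + A1R.tau * v}
      zero_mem' := ⟨0, 0, by simp⟩
      add_mem' := by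
        rintro _ _ ⟨u, v, rfl⟩ ⟨u', v', rfl⟩
        exact ⟨u + u', v + v', by rw [mul_add, mul_add]; abel⟩
      neg_mem' := by
        rintro _ ⟨u, v, rfl⟩
        refine ⟨-u, -v, neg_eq_of_add_eq_zero_right ?_⟩
        rw [add_add_add_comm, ← mul_add, ← mul_add, add_neg_cancel, add_neg_cancel, mul_zero,
          mul_zero, add_zero] }
  let σ : WordModel →ₗ[ZMod 2] A1R := Fintype.linearCombination (ZMod 2) A1R.word
  have hσ : ∀ y, σ y = ∑ i, y i • A1R.word i := fun y => rfl
  have hword : ∀ i, A1R.word i • e₀ = Pi.single i 1 := by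
    intro i
    fin_cases i <;> ext j <;> fin_cases j <;>
      simp [A1R.word, mul_smul, WordModel.sq1_smul, WordModel.sq2_smul, WordModel.opA_apply,
        WordModel.opB_apply, e₀]
  have hzmod : ∀ (c : ZMod 2) (x : A1R) (y : WordModel), (c • x) • y = c • x • y := by
    intro c x y
    rcases zmod_two_cases c with rfl | rfl <;> simp
  have hI : ∀ x ∈ I, x • e₀ = 0 := by
    rintro _ ⟨u, v, rfl⟩
    rw [add_smul, mul_smul, mul_smul, WordModel.rho_smul, WordModel.tau_smul, add_zero]
  have hσe : ∀ y, σ y • e₀ = y := by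
    intro y
    rw [hσ, Finset.sum_smul]
    simp only [hzmod, hword]
    ext j
    simp [Finset.sum_apply, Pi.single_apply]
  have hres : ∀ x : A1R, x - σ (x • e₀) ∈ I := by
    intro x
    obtain ⟨m, rfl⟩ := A1R.exists_eq_sum_word x
    have h : ∀ i, ∃ c : ZMod 2, ∃ z ∈ I, M2.toA1R (m i) * A1R.word i = c • A1R.word i + z := by
      intro i
      obtain ⟨g, h, hm⟩ := M2.exists_eq_aug (m i)
      refine ⟨M2.aug (m i), _, ⟨M2.toA1R g * A1R.word i, M2.toA1R h * A1R.word i, rfl⟩, ?_⟩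
      have hc : ∀ c : ZMod 2, M2.toA1R (algebraMap (ZMod 2) M2 c) * A1R.word i =
          c • A1R.word i := by
        intro c
        rcases zmod_two_cases c with rfl | rfl <;> simp
      conv_lhs => rw [hm]
      rw [map_add, add_mul, hc, map_add, map_mul, map_mul, M2.toA1R_rho, M2.toA1R_tau, add_mul,
        mul_assoc, mul_assoc]
    choose c z hz h using h
    have hsum : ∑ i, M2.toA1R (m i) * A1R.word i = σ c + ∑ i, z i := by
      rw [hσ, ← Finset.sum_add_distrib]
      exact Finset.sum_congr rfl fun i _ => h i
    have hzI : ∑ i, z i ∈ I := sum_mem fun i _ => hz i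
    rw [hsum, add_smul, hI _ hzI, add_zero, hσe, add_sub_cancel_left]
    exact hzI
  intro x u v hx
  have h1 : α • x • e₀ = 0 := by
    rw [← mul_smul]
    exact hI _ ⟨u, v, hx⟩
  obtain ⟨y, hy⟩ := WordModel.exact hα _ h1
  have h2 := hres (α * σ y)
  rw [mul_smul, hσe, ← hy] at h2
  obtain ⟨u', v', h⟩ := sub_mem (hres x) h2
  refine ⟨σ y, u', v', ?_⟩
  change x = α * σ y + (A1R.rho * u' + A1R.tau * v')
  rw [← h]
  abel

theorem RedExact.pi {α : A1R} {Y ι : Type*} [AddCommGroup Y] [Module A1R Y]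
    (h : RedExact α Y) : RedExact α (ι → Y) := by
  intro x u v hx
  choose y u' v' h' using fun i => h (x i) (u i) (v i) (congrFun hx i)
  exact ⟨y, u', v', funext h'⟩

theorem RedExact.of_retract {α : A1R} {Y Z : Type*} [AddCommGroup Y] [Module A1R Y]
    [AddCommGroup Z] [Module A1R Z] (h : RedExact α Y) (s : Z →ₗ[A1R] Y) (p : Y →ₗ[A1R] Z)
    (hp : ∀ z, p (s z) = z) : RedExact α Z := by
  intro x u v hx
  obtain ⟨y, u', v', h'⟩ := h (s x) (s u) (s v) (by
    rw [← map_smul, hx, map_add, map_smul, map_smul])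
  refine ⟨p y, p u', p v', ?_⟩
  rw [← hp x, h']
  simp only [map_add, map_smul]

open BigradedModule in
/-- A finitely generated projective module has exact reduction, as a summand of some `A(1)ⁿ`. No
grading is needed. -/
theorem redExact_of_projective {α : A1R} (hα : IsMargolis α) (Y : Type*) [AddCommGroup Y]
    [Module A1R Y] [Module.Finite A1R Y] [Module.Projective A1R Y] : RedExact α Y := by
  obtain ⟨n, p, hp⟩ := Module.Finite.exists_fin' A1R Y
  obtain ⟨s, hs⟩ := Module.projective_lifting_property p LinearMap.id hp
  exact (redExact_A1R hα).pi.of_retract s p fun z => LinearMap.congr_fun hs z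

namespace BigradedModule

/-! ### Margolis homology: quasi-isomorphisms, the unit and tensor products -/

/-- Direct summands with exact complement do not change Margolis homology. -/
theorem finrank_margolisHomology_eq_of_retract {X : BigradedModule.{u}} {Y : BigradedModule.{v}}
    {Z : Type*} [AddCommGroup Z] [Module A1R Z] {α : A1R} (i : X →ₗ[A1R] Y) (p : Y →ₗ[A1R] X)
    (j : Z →ₗ[A1R] Y) (q : Y →ₗ[A1R] Z) (hpi : ∀ x, p (i x) = x)
    (hsum : ∀ y, y = i (p y) + j (q y)) (hZ : RedExact α Z) :
    Module.finrank (ZMod 2) (X.MargolisHomology α) =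
      Module.finrank (ZMod 2) (Y.MargolisHomology α) := by
  refine finrank_homology_eq ((redMap i).restrictScalars (ZMod 2)) ?_ ?_ ?_
  · intro v
    exact (redMap i).map_smul α v
  · intro v w _ hw
    refine ⟨redMap p w, ?_⟩
    obtain ⟨x, rfl⟩ := red_surjective v
    have h := congrArg (redMap p) hw
    change redMap p (red (i x)) = redMap p (α • w) at h
    rwa [redMap_red, hpi, map_smul] at h
  · intro w hw
    obtain ⟨y, rfl⟩ := red_surjective w
    have hw' : red (α • y) = 0 := hw
    obtain ⟨u, v, huv⟩ := (red_eq_zero_iff _).1 hw'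
    obtain ⟨z, u', v', hz⟩ := hZ (q y) (q u) (q v) (by
      rw [← map_smul, huv, map_add, map_smul, map_smul])
    refine ⟨red (p y), red (j z), ?_, ?_⟩
    · change red (α • p y) = 0
      rw [← map_smul, ← redMap_red, hw', map_zero]
    · change red y = red (i (p y)) + red (α • j z)
      conv_lhs => rw [hsum y, hz]
      rw [map_add, map_add, map_smul, map_smul, map_smul, red_add, red_add,
        (red_eq_zero_iff (A1R.rho • j u' + A1R.tau • j v')).2 ⟨_, _, rfl⟩, add_zero]

theorem finrank_margolisHomology_congr {X : BigradedModule.{u}} {Y : BigradedModule.{v}}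
    (α : A1R) (e : X ≃ₗ[A1R] Y) :
    Module.finrank (ZMod 2) (X.MargolisHomology α) =
      Module.finrank (ZMod 2) (Y.MargolisHomology α) :=
  finrank_margolisHomology_eq_of_retract (Z := PUnit.{1}) (α := α) e.toLinearMap e.symm.toLinearMap
    0 0 (by simp) (by simp) fun _ _ _ _ => ⟨0, 0, 0, rfl⟩

theorem finrank_margolisHomology_prod {X : BigradedModule.{u}} {P : BigradedModule.{v}} {α : A1R}
    (hP : RedExact α P) :
    Module.finrank (ZMod 2) (X.MargolisHomology α) =
      Module.finrank (ZMod 2) ((X.prod P).MargolisHomology α) :=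
  finrank_margolisHomology_eq_of_retract (Y := X.prod P) (LinearMap.inl A1R X P)
    (LinearMap.fst A1R X P) (LinearMap.inr A1R X P) (LinearMap.snd A1R X P) (fun _ => rfl)
    (fun y => Prod.ext (add_zero y.1).symm (zero_add y.2).symm) hP

/-! ### The unit -/

/-- The augmentation of the unit object, as an isomorphism of its reduction with `𝔽₂`. -/
noncomputable def redUnit : unit.Reduction ≃ₗ[ZMod 2] ZMod 2 :=
  (redCoords ((Module.Basis.singleton Unit M2).map unitEquiv.symm)).trans
    (LinearEquiv.funUnique Unit (ZMod 2) (ZMod 2))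

theorem redUnit_red (f : unit) : redUnit (red f) = M2.aug (unitEquiv f) := by
  change M2.aug (((Module.Basis.singleton Unit M2).map unitEquiv.symm).repr f default) = _
  simp

theorem aug_unitSq1 (f : M2) : M2.aug (unitSq1 f) = 0 := by
  have : unitSq1 f = M2.rho * Polynomial.derivative f := rfl
  rw [this, map_mul, M2.aug_rho, zero_mul]

theorem aug_unitSq2 (f : M2) : M2.aug (unitSq2 f) = 0 := by
  have : unitSq2 f = M2.rho ^ 2 * M2.tau * Polynomial.hasseDeriv 2 f := rfl
  rw [this, map_mul, map_mul, M2.aug_tau, mul_zero, zero_mul]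

theorem sq1_smul_redUnit (v : unit.Reduction) : A1R.sq1 • v = 0 := by
  obtain ⟨f, rfl⟩ := red_surjective v
  apply redUnit.injective
  rw [smul_red, redUnit_red, unitEquiv_sq1_smul, aug_unitSq1, map_zero]

theorem sq2_smul_redUnit (v : unit.Reduction) : A1R.sq2 • v = 0 := by
  obtain ⟨f, rfl⟩ := red_surjective v
  apply redUnit.injective
  rw [smul_red, redUnit_red, unitEquiv_sq2_smul, aug_unitSq2, map_zero]

theorem IsMargolis.smul_redUnit {α : A1R} (hα : IsMargolis α) (v : unit.Reduction) :
    α • v = 0 := by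
  rcases hα with rfl | rfl | rfl
  · exact sq1_smul_redUnit v
  · rw [Q1_smul, sq1_smul_redUnit, sq1_smul_redUnit, smul_zero, add_zero]
  · exact sq2_smul_redUnit v

theorem finrank_margolisHomology_unit {α : A1R} (hα : IsMargolis α) :
    Module.finrank (ZMod 2) (unit.MargolisHomology α) = 1 := by
  have D : HomologyRetract (unit.reductionAct α) (ZMod 2) :=
    { incl := redUnit.symm.toLinearMap
      retr := redUnit.toLinearMap
      htpy := 0
      retr_incl := fun c => redUnit.apply_symm_apply c
      d_incl := fun c => hα.smul_redUnit _
      retr_d := fun v => by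
        rw [reductionAct_apply, hα.smul_redUnit, map_zero]
      incl_retr := fun v => by simp }
  exact D.finrank_homology.trans (Module.finrank_self _)

/-! ### Tensor products -/

section Tensor

variable (M : BigradedModule.{u}) (N : BigradedModule.{v})

/-- A pure tensor, as an element of the bigraded module `M ⊗ N`. -/
noncomputable def pure {M : BigradedModule.{u}} {N : BigradedModule.{v}} (x : M) (y : N) :
    M.tensor N := x ⊗ₜ[M2] y

variable {M N}

theorem pure_add_left (x x' : M) (y : N) : pure (x + x') y = pure x y + pure x' y :=
  TensorProduct.add_tmul x x' y
theorem pure_add_right (x : M) (y y' : N) : pure x (y + y') = pure x y + pure x y' :=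
  TensorProduct.tmul_add x y y'
theorem tau_smul_pure (x : M) (y : N) : A1R.tau • pure x y = pure (A1R.tau • x) y :=
  tau_smul_tmul M N x y
theorem rho_smul_pure (x : M) (y : N) : A1R.rho • pure x y = pure (A1R.rho • x) y :=
  rho_smul_tmul M N x y
theorem sq1_smul_pure (x : M) (y : N) :
    A1R.sq1 • pure x y = pure (A1R.sq1 • x) y + pure x (A1R.sq1 • y) :=
  sq1_smul_tmul M N x y
theorem sq2_smul_pure (x : M) (y : N) :
    A1R.sq2 • pure x y = pure (A1R.sq2 • x) y + pure x (A1R.sq2 • y) +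
      pure (A1R.tau • A1R.sq1 • x) (A1R.sq1 • y) :=
  sq2_smul_tmul M N x y
theorem pure_tau (x : M) (y : N) : pure x (A1R.tau • y) = A1R.tau • pure x y :=
  (tmul_tau M N x y).trans (tau_smul_pure x y).symm
theorem pure_rho (x : M) (y : N) : pure x (A1R.rho • y) = A1R.rho • pure x y :=
  (tmul_rho M N x y).trans (rho_smul_pure x y).symm

theorem pure_smul (c : M2) (x : M) (y : N) : pure (c • x) y = pure x (c • y) :=
  TensorProduct.smul_tmul c x y

theorem tensor_induction {p : M.tensor N → Prop} (pure : ∀ x y, p (pure x y))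
    (add : ∀ s t, p s → p t → p (s + t)) (t : M.tensor N) : p t :=
  TensorProduct.induction_on (motive := p) t
    (by
      have h := pure 0 0
      have h0 : BigradedModule.pure (0 : M) (0 : N) = 0 := TensorProduct.zero_tmul _ _
      rwa [h0] at h) pure add

/-- The tensor product over the scalars is the one over `𝔽₂[τ, ρ]`. -/
noncomputable def tensorM2Equiv (M : BigradedModule.{u}) (N : BigradedModule.{v}) :
    M.tensor N ≃ₗ[M2] (M ⊗[M2] N) :=
  let f : M.tensor N →+ (M ⊗[M2] N) := AddMonoidHom.id (M ⊗[M2] N)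
  LinearEquiv.ofBijective
    (m2LinearOfGens f
      (fun t => by
        induction t using tensor_induction with
        | pure x y =>
          rw [tau_smul, tau_smul_pure, ← tau_smul]
          rfl
        | add s t hs ht => rw [smul_add, f.map_add, hs, ht, f.map_add, smul_add])
      (fun t => by
        induction t using tensor_induction with
        | pure x y =>
          rw [rho_smul, rho_smul_pure, ← rho_smul]
          rfl
        | add s t hs ht => rw [smul_add, f.map_add, hs, ht, f.map_add, smul_add]))
    Function.bijective_id

theorem IsFiniteFree.tensor (hM : M.IsFiniteFree) (hN : N.IsFiniteFree) :
    (M.tensor N).IsFiniteFree := by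
  obtain ⟨h1, h2⟩ := hM
  obtain ⟨h3, h4⟩ := hN
  exact ⟨Module.Finite.equiv (tensorM2Equiv M N).symm,
    Module.Free.of_equiv (tensorM2Equiv M N).symm⟩

theorem smul_red_pure {α : A1R} (hα : IsMargolis α) (x : M) (y : N) :
    red (α • pure x y) = red (pure (α • x) y) + red (pure x (α • y)) := by
  have h1 : ∀ (x : M) (y : N), red (A1R.sq1 • pure x y) =
      red (pure (A1R.sq1 • x) y) + red (pure x (A1R.sq1 • y)) := fun x y => by
    rw [sq1_smul_pure]; rfl
  have h2 : ∀ (x : M) (y : N), red (A1R.sq2 • pure x y) =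
      red (pure (A1R.sq2 • x) y) + red (pure x (A1R.sq2 • y)) := fun x y => by
    rw [sq2_smul_pure, red_add, red_add, ← tau_smul_pure, ← smul_red, tau_smul_red, add_zero]
  rcases hα with rfl | rfl | rfl
  · exact h1 x y
  · have h12 : red (A1R.sq1 • A1R.sq2 • pure x y) = A1R.sq1 • red (A1R.sq2 • pure x y) := rfl
    have h21 : red (A1R.sq2 • A1R.sq1 • pure x y) = A1R.sq2 • red (A1R.sq1 • pure x y) := rfl
    simp only [Q1_smul, pure_add_left, pure_add_right, red_add]
    rw [h12, h21, h1, h2, smul_add, smul_add]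
    simp only [smul_red, h1, h2]
    abel_nf
    simp [two_zsmul, ZModModule.add_self]
  · exact h2 x y

/-- Reduction is monoidal: `(M ⊗ N)/(ρ, τ) = M/(ρ, τ) ⊗ N/(ρ, τ)` over `𝔽₂`. -/
noncomputable def redTensor (M : BigradedModule.{u}) (N : BigradedModule.{v}) :
    (M.tensor N).Reduction ≃ₗ[ZMod 2] (M.Reduction ⊗[ZMod 2] N.Reduction) := by
  let f : M.tensor N →+ (M.Reduction ⊗[ZMod 2] N.Reduction) :=
    tensorLift M N (fun x y => red x ⊗ₜ red y)
      (fun x x' y => by rw [red_add, TensorProduct.add_tmul])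
      (fun x y y' => by rw [red_add, TensorProduct.tmul_add])
      (fun x y => by
        rw [← smul_red, ← smul_red, tau_smul_red, tau_smul_red, TensorProduct.zero_tmul,
          TensorProduct.tmul_zero])
      (fun x y => by
        rw [← smul_red, ← smul_red, rho_smul_red, rho_smul_red, TensorProduct.zero_tmul,
          TensorProduct.tmul_zero])
  have hfp : ∀ x y, f (pure x y) = red x ⊗ₜ red y := fun x y => rfl
  have hft : ∀ t, f (A1R.tau • t) = 0 := fun t => by
    induction t using tensor_induction with
    | pure x y =>
      rw [tau_smul_pure, hfp, ← smul_red, tau_smul_red, TensorProduct.zero_tmul]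
    | add s t hs ht => rw [smul_add, map_add, hs, ht, add_zero]
  have hfr : ∀ t, f (A1R.rho • t) = 0 := fun t => by
    induction t using tensor_induction with
    | pure x y =>
      rw [rho_smul_pure, hfp, ← smul_red, rho_smul_red, TensorProduct.zero_tmul]
    | add s t hs ht => rw [smul_add, map_add, hs, ht, add_zero]
  let F : (M.tensor N).Reduction →+ (M.Reduction ⊗[ZMod 2] N.Reduction) :=
    QuotientAddGroup.lift (M.tensor N).rhoTau.toAddSubgroup f (by
      rintro _ ⟨x, y, rfl⟩
      change f _ = 0
      rw [map_add, hft, hfr, add_zero])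
  have hF : ∀ x y, F (red (pure x y)) = red x ⊗ₜ red y := fun x y => rfl
  let g₁ : M → N.Reduction →+ (M.tensor N).Reduction := fun x =>
    QuotientAddGroup.lift N.rhoTau.toAddSubgroup
      (AddMonoidHom.mk' (fun y => red (pure x y)) fun y y' => by rw [pure_add_right, red_add]) (by
      rintro _ ⟨y, z, rfl⟩
      change red (pure x _) = 0
      rw [pure_add_right, pure_rho, pure_tau]
      exact (red_eq_zero_iff _).2 ⟨_, _, rfl⟩)
  have hg₁ : ∀ x y, g₁ x (red y) = red (pure x y) := fun x y => rfl
  let g₂ : M.Reduction →+ N.Reduction →+ (M.tensor N).Reduction :=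
    QuotientAddGroup.lift M.rhoTau.toAddSubgroup
      (AddMonoidHom.mk' g₁ fun x x' => AddMonoidHom.ext fun y => by
        obtain ⟨y, rfl⟩ := red_surjective y
        rw [AddMonoidHom.add_apply, hg₁, hg₁, hg₁, pure_add_left, red_add]) (by
      rintro _ ⟨x, z, rfl⟩
      refine AddMonoidHom.ext fun y => ?_
      obtain ⟨y, rfl⟩ := red_surjective y
      change red (pure _ y) = 0
      rw [pure_add_left, ← tau_smul_pure, ← rho_smul_pure]
      exact (red_eq_zero_iff _).2 ⟨_, _, rfl⟩)
  have hg₂ : ∀ x y, g₂ (red x) (red y) = red (pure x y) := fun x y => rfl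
  let G : (M.Reduction ⊗[ZMod 2] N.Reduction) →+ (M.tensor N).Reduction :=
    TensorProduct.liftAddHom g₂ fun c x y => by
      rcases zmod_two_cases c with rfl | rfl <;> simp
  have hG : ∀ x y, G (red x ⊗ₜ red y) = red (pure x y) := fun x y => rfl
  refine LinearEquiv.ofBijective (F.toZModLinearMap 2) (Function.bijective_iff_has_inverse.2
    ⟨G, fun v => ?_, fun w => ?_⟩)
  · obtain ⟨t, rfl⟩ := red_surjective v
    change G (F (red t)) = red t
    induction t using tensor_induction with
    | pure x y => rw [hF, hG]
    | add s t hs ht => rw [red_add, map_add, map_add, hs, ht]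
  · change F (G w) = w
    induction w using TensorProduct.induction_on with
    | zero => rw [map_zero, map_zero]
    | tmul x y =>
      obtain ⟨x, rfl⟩ := red_surjective x
      obtain ⟨y, rfl⟩ := red_surjective y
      rw [hG, hF]
    | add s t hs ht => rw [map_add, map_add, hs, ht]

/-- The Künneth theorem for Margolis homology. -/
theorem finrank_margolisHomology_tensor {α : A1R} (hα : IsMargolis α) :
    Module.finrank (ZMod 2) ((M.tensor N).MargolisHomology α) =
      Module.finrank (ZMod 2) (M.MargolisHomology α) *
        Module.finrank (ZMod 2) (N.MargolisHomology α) := by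
  obtain ⟨D⟩ := exists_homologyRetract (M.reductionAct α) fun v => hα.sq_red v
  obtain ⟨D'⟩ := exists_homologyRetract (N.reductionAct α) fun v => hα.sq_red v
  let e := redTensor M N
  let δ := e.toLinearMap ∘ₗ (M.tensor N).reductionAct α ∘ₗ e.symm.toLinearMap
  have hδ : ∀ v w, δ (v ⊗ₜ w) =
      M.reductionAct α v ⊗ₜ w + v ⊗ₜ N.reductionAct α w := by
    intro v w
    obtain ⟨x, rfl⟩ := red_surjective v
    obtain ⟨y, rfl⟩ := red_surjective w
    change e ((M.tensor N).reductionAct α (e.symm (e (red (pure x y))))) = _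
    rw [e.symm_apply_apply, reductionAct_apply, smul_red, smul_red_pure hα, map_add]
    rfl
  rw [((D.tensor D' δ hδ).congr e fun w => by simp [δ]).finrank_homology,
    Module.finrank_tensorProduct]

end Tensor

/-! ### Homogeneous components -/

section Homogeneous

variable (X : BigradedModule.{u})

theorem proj_mem (d : ℤ × ℤ) (x : X) : X.proj d x ∈ X.gr d := (X.dec x d).2

/-- An element is the sum of its components, over any large enough finite set of degrees. -/
theorem exists_sum_proj (x : X) :
    ∃ D : Finset (ℤ × ℤ), ∀ D', D ⊆ D' → ∑ d ∈ D', X.proj d x = x := by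
  classical
  induction x using X.hom_induction with
  | mem e x hx =>
    refine ⟨{e}, fun D' hD => ?_⟩
    rw [Finset.sum_eq_single e (fun d _ hd => X.proj_other d e hd x hx)
      (fun h => absurd (hD (Finset.mem_singleton_self e)) h), X.proj_same e x hx]
  | add x y hx hy =>
    obtain ⟨D, hD⟩ := hx
    obtain ⟨E, hE⟩ := hy
    refine ⟨D ∪ E, fun D' h => ?_⟩
    simp only [map_add, Finset.sum_add_distrib]
    rw [hD D' (Finset.union_subset_left h), hE D' (Finset.union_subset_right h)]

theorem exists_homogeneous_generators [Module.Finite M2 X] :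
    ∃ S : Finset X, (∀ x ∈ S, ∃ d, x ∈ X.gr d) ∧ Submodule.span M2 (S : Set X) = ⊤ := by
  classical
  have h : ∀ x : X, ∃ S : Finset X, (∀ y ∈ S, ∃ d, y ∈ X.gr d) ∧
      x ∈ Submodule.span M2 (S : Set X) := by
    intro x
    induction x using X.hom_induction with
    | mem e x hx =>
      exact ⟨{x}, fun y hy => ⟨e, by rwa [Finset.mem_singleton.1 hy]⟩,
        Submodule.subset_span (by simp)⟩
    | add x y hx hy =>
      obtain ⟨S, hS, hx⟩ := hx
      obtain ⟨T, hT, hy⟩ := hy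
      refine ⟨S ∪ T, fun z hz => (Finset.mem_union.1 hz).elim (hS z) (hT z), ?_⟩
      rw [Finset.coe_union]
      exact add_mem (Submodule.span_mono Set.subset_union_left hx)
        (Submodule.span_mono Set.subset_union_right hy)
  choose S hS hx using h
  obtain ⟨G, hG⟩ := Module.Finite.fg_top (R := M2) (M := X)
  refine ⟨G.biUnion S, fun y hy => ?_, ?_⟩
  · obtain ⟨x, _, hy⟩ := Finset.mem_biUnion.1 hy
    exact hS x y hy
  · rw [eq_top_iff, ← hG, Submodule.span_le]
    intro x hxG
    refine Submodule.span_mono ?_ (hx x)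
    rw [Finset.coe_subset]
    exact Finset.subset_biUnion_of_mem S hxG

/-- The projection of the coefficient ring to its part of bidegree `d`. -/
noncomputable def coeffProj (d : ℤ × ℤ) : M2 →+ M2 :=
  (unitEquiv.toAddMonoidHom.comp (unit.proj d)).comp unitEquiv.symm.toAddMonoidHom

theorem coeffProj_eq (d : ℤ × ℤ) (f : M2) :
    coeffProj d f = unitEquiv (unit.proj d (unitEquiv.symm f)) := rfl

theorem coeffProj_mem (d : ℤ × ℤ) (f : M2) : coeffProj d f ∈ unitGr d :=
  unit.proj_mem d _

theorem unitEquiv_symm_mem {d : ℤ × ℤ} {f : M2} (hf : f ∈ unitGr d) :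
    unitEquiv.symm f ∈ unit.gr d := by
  rwa [← unitEquiv_mem, LinearEquiv.apply_symm_apply]

theorem coeffProj_same {d : ℤ × ℤ} {f : M2} (hf : f ∈ unitGr d) : coeffProj d f = f := by
  rw [coeffProj_eq, unit.proj_same d _ (unitEquiv_symm_mem hf), LinearEquiv.apply_symm_apply]

theorem coeffProj_other {d e : ℤ × ℤ} (h : d ≠ e) {f : M2} (hf : f ∈ unitGr e) :
    coeffProj d f = 0 := by
  rw [coeffProj_eq, unit.proj_other d e h _ (unitEquiv_symm_mem hf), map_zero]

theorem coeffProj_tau (d : ℤ × ℤ) (f : M2) :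
    coeffProj (d + (0, 1)) (M2.tau * f) = M2.tau * coeffProj d f := by
  have h := unit.proj_shift (DistribSMul.toAddMonoidHom unit A1R.tau) (0, 1) unit.tau_mem d
    (unitEquiv.symm f)
  have h' := congrArg unitEquiv h
  simp only [DistribSMul.toAddMonoidHom_apply, unitEquiv_tau_smul] at h'
  rw [coeffProj_eq, coeffProj_eq, ← h', ← tau_smul, ← map_smul, smul_eq_mul]

theorem coeffProj_rho (d : ℤ × ℤ) (f : M2) :
    coeffProj (d + (1, 1)) (M2.rho * f) = M2.rho * coeffProj d f := by
  have h := unit.proj_shift (DistribSMul.toAddMonoidHom unit A1R.rho) (1, 1) unit.rho_mem d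
    (unitEquiv.symm f)
  have h' := congrArg unitEquiv h
  simp only [DistribSMul.toAddMonoidHom_apply, unitEquiv_rho_smul] at h'
  rw [coeffProj_eq, coeffProj_eq, ← h', ← rho_smul, ← map_smul, smul_eq_mul]

theorem exists_sum_coeffProj (f : M2) :
    ∃ D : Finset (ℤ × ℤ), ∀ D', D ⊆ D' → ∑ d ∈ D', coeffProj d f = f := by
  obtain ⟨D, hD⟩ := unit.exists_sum_proj (unitEquiv.symm f)
  refine ⟨D, fun D' h => ?_⟩
  simp only [coeffProj_eq]
  rw [← map_sum, hD D' h, LinearEquiv.apply_symm_apply]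

theorem tau_mul_mem_unitGr {d : ℤ × ℤ} {f : M2} (hf : f ∈ unitGr d) :
    M2.tau * f ∈ unitGr (d + (0, 1)) := by
  rw [← coeffProj_same hf, ← coeffProj_tau]; exact coeffProj_mem _ _

theorem rho_mul_mem_unitGr {d : ℤ × ℤ} {f : M2} (hf : f ∈ unitGr d) :
    M2.rho * f ∈ unitGr (d + (1, 1)) := by
  rw [← coeffProj_same hf, ← coeffProj_rho]; exact coeffProj_mem _ _

theorem unitSq1_mem_unitGr {d : ℤ × ℤ} {f : M2} (hf : f ∈ unitGr d) :
    unitSq1 f ∈ unitGr (d + (1, 0)) := by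
  have h := unit.sq1_mem d (unitEquiv.symm f) (unitEquiv_symm_mem hf)
  rwa [← unitEquiv_mem, unitEquiv_sq1_smul, LinearEquiv.apply_symm_apply] at h

theorem unitSq2_mem_unitGr {d : ℤ × ℤ} {f : M2} (hf : f ∈ unitGr d) :
    unitSq2 f ∈ unitGr (d + (2, 1)) := by
  have h := unit.sq2_mem d (unitEquiv.symm f) (unitEquiv_symm_mem hf)
  rwa [← unitEquiv_mem, unitEquiv_sq2_smul, LinearEquiv.apply_symm_apply] at h

end Homogeneous

/-! ### The dual module -/

section Dual

variable (M : BigradedModule.{u})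

theorem dual_tau_smul (f : M →ₗ[M2] M2) (x : M) : f (A1R.tau • x) = M2.tau * f x := by
  rw [← tau_smul, map_smul, smul_eq_mul]
theorem dual_rho_smul (f : M →ₗ[M2] M2) (x : M) : f (A1R.rho • x) = M2.rho * f x := by
  rw [← rho_smul, map_smul, smul_eq_mul]

/-- An operator on the dual, given by a formula that is additive in both variables and compatible
with `τ` and `ρ`. -/
noncomputable def dualOperator (F : (M →ₗ[M2] M2) → M → M2)
    (addl : ∀ f g x, F (f + g) x = F f x + F g x) (addr : ∀ f x y, F f (x + y) = F f x + F f y)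
    (ht : ∀ f x, F f (A1R.tau • x) = M2.tau * F f x)
    (hr : ∀ f x, F f (A1R.rho • x) = M2.rho * F f x) :
    (M →ₗ[M2] M2) →ₗ[ZMod 2] (M →ₗ[M2] M2) where
  toFun f := m2LinearOfGens (AddMonoidHom.mk' (F f) (addr f))
    (fun x => by rw [tau_smul]; exact ht f x) (fun x => by rw [rho_smul]; exact hr f x)
  map_add' f g := LinearMap.ext fun x => addl f g x
  map_smul' c f := by
    rcases zmod_two_cases c with rfl | rfl
    · rw [RingHom.id_apply, zero_smul, zero_smul]
      refine LinearMap.ext fun x => ?_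
      have h := addl 0 0 x
      rw [add_zero] at h
      exact left_eq_add.1 h
    · rw [RingHom.id_apply, one_smul, one_smul]

/-- The dual action of `Sq¹`: `(Sq¹ f)(x) = Sq¹ (f x) + f (Sq¹ x)`. -/
noncomputable def dualSq1 : (M →ₗ[M2] M2) →ₗ[ZMod 2] (M →ₗ[M2] M2) :=
  dualOperator M (fun f x => unitSq1 (f x) + f (A1R.sq1 • x))
    (fun f g x => by simp only [LinearMap.add_apply, map_add]; ring)
    (fun f x y => by simp only [smul_add, map_add]; ring)
    (fun f x => by
      simp only [sq1_tau_smul, map_add, dual_tau_smul, dual_rho_smul, unitSq1_tau]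
      linear_combination M2_add_self (M2.rho * f x))
    (fun f x => by
      simp only [sq1_rho_smul, dual_rho_smul, unitSq1_rho]
      ring)

theorem dualSq1_apply (f : M →ₗ[M2] M2) (x : M) :
    dualSq1 M f x = unitSq1 (f x) + f (A1R.sq1 • x) := rfl

/-- The dual action of `Sq²`: `(Sq² f)(x) = Sq² (f x) + f (Sq² x) + τ Sq¹ (f (Sq¹ x))`. -/
noncomputable def dualSq2 : (M →ₗ[M2] M2) →ₗ[ZMod 2] (M →ₗ[M2] M2) :=
  dualOperator M (fun f x => unitSq2 (f x) + f (A1R.sq2 • x) + M2.tau * unitSq1 (f (A1R.sq1 • x)))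
    (fun f g x => by simp only [LinearMap.add_apply, map_add]; ring)
    (fun f x y => by simp only [smul_add, map_add]; ring)
    (fun f x => by
      simp only [sq1_tau_smul, sq2_tau_smul, map_add, dual_tau_smul, dual_rho_smul, unitSq1_tau,
        unitSq1_rho, unitSq2_tau]
      linear_combination M2_add_self (M2.tau * M2.rho * unitSq1 (f x)) +
        M2_add_self (M2.tau * M2.rho * f (A1R.sq1 • x)))
    (fun f x => by
      simp only [sq1_rho_smul, sq2_rho_smul, dual_rho_smul, unitSq1_rho, unitSq2_rho]
      ring)

theorem dualSq2_apply (f : M →ₗ[M2] M2) (x : M) :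
    dualSq2 M f x = unitSq2 (f x) + f (A1R.sq2 • x) + M2.tau * unitSq1 (f (A1R.sq1 • x)) := rfl

/-- Multiplication by a scalar on the dual. -/
noncomputable def dualScalar (c : M2) : (M →ₗ[M2] M2) →ₗ[ZMod 2] (M →ₗ[M2] M2) :=
  dualOperator M (fun f x => c * f x) (fun f g x => by rw [LinearMap.add_apply, mul_add])
    (fun f x y => by rw [map_add, mul_add]) (fun f x => by rw [dual_tau_smul]; ring)
    (fun f x => by rw [dual_rho_smul]; ring)

theorem dualScalar_apply (c : M2) (f : M →ₗ[M2] M2) (x : M) : dualScalar M c f x = c * f x := rfl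

/-- The `A(1)^ℝ`-module structure on the dual. -/
@[reducible] noncomputable def dualModule : Module A1R (M →ₗ[M2] M2) :=
  moduleOfOps (T := M →ₗ[M2] M2) (dualScalar M M2.tau) (dualScalar M M2.rho) (dualSq1 M) (dualSq2 M)
    (LinearMap.ext fun f => LinearMap.ext fun x => by
      simp only [Module.End.mul_apply, dualScalar_apply]; ring)
    (LinearMap.ext fun f => LinearMap.ext fun x => by
      simp only [Module.End.mul_apply, LinearMap.add_apply, dualScalar_apply, dualSq1_apply,
        unitSq1_tau]; ring)
    (LinearMap.ext fun f => LinearMap.ext fun x => by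
      simp only [Module.End.mul_apply, dualScalar_apply, dualSq1_apply, unitSq1_rho]; ring)
    (LinearMap.ext fun f => LinearMap.ext fun x => by
      simp only [Module.End.mul_apply, LinearMap.add_apply, dualScalar_apply, dualSq1_apply,
        dualSq2_apply, unitSq1_tau, unitSq2_tau]; ring)
    (LinearMap.ext fun f => LinearMap.ext fun x => by
      simp only [Module.End.mul_apply, dualScalar_apply, dualSq2_apply, unitSq1_rho,
        unitSq2_rho]; ring)
    (LinearMap.ext fun f => LinearMap.ext fun x => by
      simp only [Module.End.mul_apply, dualSq1_apply, map_add, unitSq1_sq1, sq1_sq1_smul,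
        map_zero, LinearMap.zero_apply]
      linear_combination M2_add_self (unitSq1 (f (A1R.sq1 • x))))
    (LinearMap.ext fun f => LinearMap.ext fun x => by
      simp only [Module.End.mul_apply, dualScalar_apply, dualSq1_apply, dualSq2_apply, map_add,
        unitSq1_sq1, unitSq2_sq2, unitSq2_tau, sq1_sq1_smul, sq2_sq2_smul, dual_tau_smul,
        map_zero, mul_zero, add_zero]
      linear_combination M2_add_self (unitSq2 (f (A1R.sq2 • x))))
    (LinearMap.ext fun f => LinearMap.ext fun x => by
      simp only [Module.End.mul_apply, dualSq1_apply, dualSq2_apply, map_add, unitSq1_sq1,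
        unitSq2_sq2, unitSq1_tau, unitSq1_rho, unitSq2_rho, sq1_sq1_smul, sq2_sq2_smul,
        sq2121_smul, unitSq1212, dual_tau_smul, map_zero, mul_zero, add_zero, smul_zero]
      linear_combination M2_add_self (M2.rho * unitSq1 (unitSq2 (unitSq1 (f (A1R.sq1 • x))))) +
        M2_add_self (M2.rho * unitSq1 (f (A1R.sq1 • A1R.sq2 • A1R.sq1 • x))) +
        M2_add_self (unitSq1 (unitSq2 (f (A1R.sq2 • A1R.sq1 • x)))) -
        M2_add_self (unitSq2 (unitSq1 (f (A1R.sq1 • A1R.sq2 • x)))))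

/-- The part of the dual of bidegree `d`: the functionals that shift degrees by `d`. -/
def dualGr (d : ℤ × ℤ) : AddSubgroup (M →ₗ[M2] M2) where
  carrier := {f | ∀ e, ∀ x ∈ M.gr e, f x ∈ unitGr (e + d)}
  zero_mem' _ _ _ := zero_mem _
  add_mem' hf hg e x hx := add_mem (hf e x hx) (hg e x hx)
  neg_mem' hf e x hx := neg_mem (hf e x hx)

/-- The component of bidegree `d` of a functional, as an additive map. -/
noncomputable def dualComponent (d : ℤ × ℤ) (f : M →ₗ[M2] M2) : M →+ M2 :=
  (DirectSum.toAddMonoid fun e =>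
    ((coeffProj (e + d)).comp f.toAddMonoidHom).comp (M.gr e).subtype).comp M.dec.toAddMonoidHom

theorem dualComponent_apply (d e : ℤ × ℤ) (f : M →ₗ[M2] M2) (x : M) (hx : x ∈ M.gr e) :
    dualComponent M d f x = coeffProj (e + d) (f x) := by
  rw [dualComponent, AddMonoidHom.comp_apply, AddEquiv.coe_toAddMonoidHom, dec_mem M hx,
    DirectSum.toAddMonoid_of]
  rfl

/-- The component of bidegree `d` of a functional. -/
noncomputable def dualProj (d : ℤ × ℤ) : (M →ₗ[M2] M2) →+ (M →ₗ[M2] M2) where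
  toFun f := m2LinearOfGens (dualComponent M d f)
    (fun x => by
      rw [tau_smul]
      induction x using M.hom_induction with
      | mem e x hx =>
        rw [dualComponent_apply M d _ f _ (M.tau_mem e x hx), dualComponent_apply M d e f x hx,
          dual_tau_smul, smul_eq_mul, ← coeffProj_tau, add_right_comm]
      | add x y hx hy => rw [smul_add, map_add, hx, hy, map_add, smul_add])
    (fun x => by
      rw [rho_smul]
      induction x using M.hom_induction with
      | mem e x hx =>
        rw [dualComponent_apply M d _ f _ (M.rho_mem e x hx), dualComponent_apply M d e f x hx,
          dual_rho_smul, smul_eq_mul, ← coeffProj_rho, add_right_comm]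
      | add x y hx hy => rw [smul_add, map_add, hx, hy, map_add, smul_add])
  map_zero' := LinearMap.ext fun x => by
    change dualComponent M d 0 x = 0
    induction x using M.hom_induction with
    | mem e x hx => rw [dualComponent_apply M d e 0 x hx, LinearMap.zero_apply, map_zero]
    | add x y hx hy => rw [map_add, hx, hy, add_zero]
  map_add' f g := LinearMap.ext fun x => by
    change dualComponent M d (f + g) x = dualComponent M d f x + dualComponent M d g x
    induction x using M.hom_induction with
    | mem e x hx =>
      rw [dualComponent_apply M d e _ x hx, dualComponent_apply M d e _ x hx,
        dualComponent_apply M d e _ x hx, LinearMap.add_apply, map_add]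
    | add x y hx hy => rw [map_add, hx, hy, map_add, map_add]; abel

theorem dualProj_apply (d e : ℤ × ℤ) (f : M →ₗ[M2] M2) (x : M) (hx : x ∈ M.gr e) :
    dualProj M d f x = coeffProj (e + d) (f x) :=
  dualComponent_apply M d e f x hx

theorem dualProj_mem (d : ℤ × ℤ) (f : M →ₗ[M2] M2) : dualProj M d f ∈ dualGr M d :=
  fun e x hx => by rw [dualProj_apply M d e f x hx]; exact coeffProj_mem _ _

theorem dual_ext_homogeneous {f g : M →ₗ[M2] M2} (h : ∀ e, ∀ x ∈ M.gr e, f x = g x) : f = g :=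
  LinearMap.ext fun x => by
    induction x using M.hom_induction with
    | mem e x hx => exact h e x hx
    | add x y hx hy => rw [map_add, hx, hy, map_add]

theorem dualGr_isInternal [Module.Finite M2 M] : DirectSum.IsInternal (dualGr M) := by
  classical
  refine isInternal_of_proj _ (dualProj M) ?_ ?_ ?_
  · intro d f hf
    exact dual_ext_homogeneous M fun e x hx => by
      rw [dualProj_apply M d e f x hx, coeffProj_same (hf e x hx)]
  · intro d d' h f hf
    exact dual_ext_homogeneous M fun e x hx => by
      rw [dualProj_apply M d e f x hx, coeffProj_other _ (hf e x hx), LinearMap.zero_apply]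
      exact fun h' => h (add_left_cancel h')
  · intro f
    -- on finitely many homogeneous generators only finitely many components are nonzero
    obtain ⟨S, hS, hspan⟩ := exists_homogeneous_generators M
    choose! deg hdeg using hS
    choose D hD using fun x : M => exists_sum_coeffProj (f x)
    let E : Finset (ℤ × ℤ) := S.biUnion fun x => (D x).image fun d => d - deg x
    have hf : f = ∑ d ∈ E, dualProj M d f := by
      refine LinearMap.ext_on hspan fun x hx => ?_
      rw [LinearMap.sum_apply]
      have h := hD x (E.image fun d => deg x + d) (fun d hd => by
        refine Finset.mem_image.2 ⟨d - deg x, ?_, by abel⟩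
        exact Finset.mem_biUnion.2 ⟨x, hx, Finset.mem_image_of_mem _ hd⟩)
      rw [Finset.sum_image (fun a _ b _ hab => add_left_cancel hab)] at h
      rw [← h]
      refine Finset.sum_congr rfl fun d _ => ?_
      rw [dualProj_apply M d _ f x (hdeg x hx)]
    rw [hf]
    exact sum_mem fun d _ => AddSubgroup.mem_iSup_of_mem d (dualProj_mem M d f)

/-- The dual `Hom(M, 𝔽₂[τ, ρ])` of a bigraded module. -/
noncomputable def dual [Module.Finite M2 M] : BigradedModule.{u} where
  carrier := M →ₗ[M2] M2
  module := dualModule M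
  gr := dualGr M
  isInternal := dualGr_isInternal M
  tau_mem d f hf e x hx := by
    have h : (dualModule M).smul A1R.tau f = dualScalar M M2.tau f :=
      LinearMap.congr_fun (opsHom_tau (T := M →ₗ[M2] M2) _ _ _ _ _ _ _ _ _ _ _ _) f
    refine Eq.mpr (congrArg (· ∈ _) (LinearMap.congr_fun h x)) ?_
    rw [dualScalar_apply, ← add_assoc]
    exact tau_mul_mem_unitGr (hf e x hx)
  rho_mem d f hf e x hx := by
    have h : (dualModule M).smul A1R.rho f = dualScalar M M2.rho f :=
      LinearMap.congr_fun (opsHom_rho (T := M →ₗ[M2] M2) _ _ _ _ _ _ _ _ _ _ _ _) f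
    refine Eq.mpr (congrArg (· ∈ _) (LinearMap.congr_fun h x)) ?_
    rw [dualScalar_apply, ← add_assoc]
    exact rho_mul_mem_unitGr (hf e x hx)
  sq1_mem d f hf e x hx := by
    have h : (dualModule M).smul A1R.sq1 f = dualSq1 M f :=
      LinearMap.congr_fun (opsHom_sq1 (T := M →ₗ[M2] M2) _ _ _ _ _ _ _ _ _ _ _ _) f
    refine Eq.mpr (congrArg (· ∈ _) (LinearMap.congr_fun h x)) ?_
    rw [dualSq1_apply, ← add_assoc]
    refine add_mem (unitSq1_mem_unitGr (hf e x hx)) ?_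
    rw [add_right_comm]
    exact hf _ _ (M.sq1_mem e x hx)
  sq2_mem d f hf e x hx := by
    have h : (dualModule M).smul A1R.sq2 f = dualSq2 M f :=
      LinearMap.congr_fun (opsHom_sq2 (T := M →ₗ[M2] M2) _ _ _ _ _ _ _ _ _ _ _ _) f
    refine Eq.mpr (congrArg (· ∈ _) (LinearMap.congr_fun h x)) ?_
    rw [dualSq2_apply, ← add_assoc]
    refine add_mem (add_mem (unitSq2_mem_unitGr (hf e x hx)) ?_) ?_
    · rw [add_right_comm]
      exact hf _ _ (M.sq2_mem e x hx)
    · have h' := tau_mul_mem_unitGr (unitSq1_mem_unitGr (hf _ _ (M.sq1_mem e x hx)))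
      convert h' using 2
      ext
      · simp; ring
      · simp

variable [Module.Finite M2 M]

/-- The functional underlying an element of the dual module. -/
noncomputable def dualEquiv : M.dual ≃ₗ[M2] (M →ₗ[M2] M2) :=
  LinearEquiv.ofBijective
    (m2LinearOfGens (X := M.dual) (Y := M →ₗ[M2] M2) (AddMonoidHom.id (M →ₗ[M2] M2))
      (fun f => by
        rw [tau_smul]
        exact LinearMap.congr_fun (opsHom_tau (T := M →ₗ[M2] M2) _ _ _ _ _ _ _ _ _ _ _ _) f)
      (fun f => by
        rw [rho_smul]
        exact LinearMap.congr_fun (opsHom_rho (T := M →ₗ[M2] M2) _ _ _ _ _ _ _ _ _ _ _ _) f))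
    Function.bijective_id

variable {M}

theorem dualEquiv_sq1 (f : M.dual) (x : M) :
    M.dualEquiv (A1R.sq1 • f) x = unitSq1 (M.dualEquiv f x) + M.dualEquiv f (A1R.sq1 • x) :=
  LinearMap.congr_fun (LinearMap.congr_fun
    (opsHom_sq1 (T := M →ₗ[M2] M2) _ _ _ _ _ _ _ _ _ _ _ _) f) x

theorem dualEquiv_sq2 (f : M.dual) (x : M) :
    M.dualEquiv (A1R.sq2 • f) x = unitSq2 (M.dualEquiv f x) + M.dualEquiv f (A1R.sq2 • x) +
      M2.tau * unitSq1 (M.dualEquiv f (A1R.sq1 • x)) :=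
  LinearMap.congr_fun (LinearMap.congr_fun
    (opsHom_sq2 (T := M →ₗ[M2] M2) _ _ _ _ _ _ _ _ _ _ _ _) f) x

theorem dualEquiv_tau (f : M.dual) (x : M) :
    M.dualEquiv (A1R.tau • f) x = M2.tau * M.dualEquiv f x := by
  rw [← tau_smul, map_smul]; rfl

theorem dualEquiv_rho (f : M.dual) (x : M) :
    M.dualEquiv (A1R.rho • f) x = M2.rho * M.dualEquiv f x := by
  rw [← rho_smul, map_smul]; rfl

theorem dualEquiv_mem {d e : ℤ × ℤ} {f : M.dual} (hf : f ∈ M.dual.gr d) {x : M}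
    (hx : x ∈ M.gr e) : M.dualEquiv f x ∈ unitGr (e + d) :=
  hf e x hx

theorem dual_isFiniteFree (hM : Module.Free M2 M) : M.dual.IsFiniteFree :=
  ⟨Module.Finite.equiv M.dualEquiv.symm, Module.Free.of_equiv M.dualEquiv.symm⟩

end Dual

/-! ### Margolis homology of the dual -/

section DualHomology

variable (M : BigradedModule.{u}) [Module.Finite M2 M]

/-- The functional on the reduction induced by a functional. -/
noncomputable def redFunctional : M.dual →+ Module.Dual (ZMod 2) M.Reduction where
  toFun f := AddMonoidHom.toZModLinearMap (M := M.Reduction) 2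
    (QuotientAddGroup.lift M.rhoTau.toAddSubgroup
      (M2.aug.toAddMonoidHom.comp (M.dualEquiv f).toAddMonoidHom) (by
      rintro _ ⟨x, y, rfl⟩
      change M2.aug (M.dualEquiv f _) = 0
      rw [map_add, dual_rho_smul, dual_tau_smul]
      simp))
  map_zero' := LinearMap.ext fun v => by
    obtain ⟨x, rfl⟩ := red_surjective v
    change M2.aug (M.dualEquiv 0 x) = 0
    simp
  map_add' f g := LinearMap.ext fun v => by
    obtain ⟨x, rfl⟩ := red_surjective v
    change M2.aug (M.dualEquiv (f + g) x) = M2.aug (M.dualEquiv f x) + M2.aug (M.dualEquiv g x)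
    simp

variable {M}

theorem redFunctional_red (f : M.dual) (x : M) :
    M.redFunctional f (red x) = M2.aug (M.dualEquiv f x) := rfl

theorem redFunctional_eq_zero_iff (hM : Module.Free M2 M) (f : M.dual) :
    M.redFunctional f = 0 ↔ red f = 0 := by
  constructor
  · intro h
    let b := Module.Free.chooseBasis M2 M
    have hb : ∀ i, ∃ g h : M2, M.dualEquiv f (b i) = M2.rho * g + M2.tau * h := fun i => by
      obtain ⟨g, h', hgh⟩ := M2.exists_eq_aug (M.dualEquiv f (b i))
      rw [← redFunctional_red, h, LinearMap.zero_apply, map_zero, zero_add] at hgh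
      exact ⟨g, h', hgh⟩
    choose g h hgh using hb
    refine (red_eq_zero_iff f).2
      ⟨M.dualEquiv.symm (b.constr M2 g), M.dualEquiv.symm (b.constr M2 h), ?_⟩
    apply M.dualEquiv.injective
    rw [← tau_smul, ← rho_smul, map_add, map_smul, map_smul, LinearEquiv.apply_symm_apply,
      LinearEquiv.apply_symm_apply]
    refine b.ext fun i => ?_
    rw [hgh, LinearMap.add_apply, LinearMap.smul_apply, LinearMap.smul_apply, b.constr_basis,
      b.constr_basis, smul_eq_mul, smul_eq_mul]
  · intro h
    obtain ⟨g, g', rfl⟩ := (red_eq_zero_iff f).1 h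
    refine LinearMap.ext fun v => ?_
    obtain ⟨x, rfl⟩ := red_surjective v
    rw [redFunctional_red, map_add, LinearMap.add_apply, dualEquiv_tau, dualEquiv_rho]
    simp

theorem redFunctional_surjective (hM : Module.Free M2 M) :
    Function.Surjective M.redFunctional := by
  intro φ
  let b := Module.finBasis M2 M
  refine ⟨M.dualEquiv.symm (b.constr M2 fun i => algebraMap (ZMod 2) M2 (φ (red (b i)))), ?_⟩
  refine LinearMap.ext fun v => ?_
  obtain ⟨x, rfl⟩ := red_surjective v
  have haug : ∀ c : ZMod 2, M2.aug (algebraMap (ZMod 2) M2 c) = c := fun c => by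
    rcases zmod_two_cases c with rfl | rfl <;> simp
  rw [redFunctional_red, LinearEquiv.apply_symm_apply]
  induction b.mem_span x using Submodule.span_induction with
  | mem x hx =>
    obtain ⟨i, rfl⟩ := hx
    rw [b.constr_basis, haug]
  | zero => simp
  | add x y _ _ hx hy => rw [map_add, map_add, hx, hy, red_add, map_add]
  | smul c x _ hx => rw [map_smul, smul_eq_mul, map_mul, hx, red_m2_smul, map_smul, smul_eq_mul]

/-- Reduction commutes with duality. -/
noncomputable def redDual (hM : Module.Free M2 M) :
    M.dual.Reduction ≃ₗ[ZMod 2] Module.Dual (ZMod 2) M.Reduction := by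
  let F : M.dual.Reduction →+ Module.Dual (ZMod 2) M.Reduction :=
    QuotientAddGroup.lift M.dual.rhoTau.toAddSubgroup M.redFunctional fun f hf =>
      (redFunctional_eq_zero_iff hM f).2 ((Submodule.Quotient.mk_eq_zero _).2 hf)
  refine LinearEquiv.ofBijective (F.toZModLinearMap 2) ⟨?_, ?_⟩
  · rw [injective_iff_map_eq_zero]
    intro v hv
    obtain ⟨f, rfl⟩ := red_surjective v
    exact (redFunctional_eq_zero_iff hM f).1 hv
  · intro φ
    obtain ⟨f, rfl⟩ := redFunctional_surjective hM φ
    exact ⟨red f, rfl⟩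

theorem redDual_red (hM : Module.Free M2 M) (f : M.dual) (x : M) :
    redDual hM (red f) (red x) = M2.aug (M.dualEquiv f x) := rfl

/-- The Margolis operators act on the reduction of the dual by transposition: the correction terms
of the dual action vanish modulo `(ρ, τ)`. -/
theorem redDual_smul (hM : Module.Free M2 M) {α : A1R} (hα : IsMargolis α) (v : M.dual.Reduction)
    (w : M.Reduction) : redDual hM (α • v) w = redDual hM v (α • w) := by
  have h1 : ∀ v w, redDual hM (A1R.sq1 • v) w = redDual hM v (A1R.sq1 • w) := fun v w => by
    obtain ⟨f, rfl⟩ := red_surjective v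
    obtain ⟨x, rfl⟩ := red_surjective w
    rw [smul_red, smul_red, redDual_red, redDual_red, dualEquiv_sq1, map_add, aug_unitSq1,
      zero_add]
  have h2 : ∀ v w, redDual hM (A1R.sq2 • v) w = redDual hM v (A1R.sq2 • w) := fun v w => by
    obtain ⟨f, rfl⟩ := red_surjective v
    obtain ⟨x, rfl⟩ := red_surjective w
    rw [smul_red, smul_red, redDual_red, redDual_red, dualEquiv_sq2, map_add, map_add,
      aug_unitSq2, zero_add, map_mul, M2.aug_tau, zero_mul, add_zero]
  rcases hα with rfl | rfl | rfl
  · exact h1 v w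
  · rw [Q1_smul, Q1_smul, map_add, map_add, LinearMap.add_apply, h1, h2, h2, h1, add_comm]
  · exact h2 v w

theorem finrank_margolisHomology_dual (hM : Module.Free M2 M) {α : A1R} (hα : IsMargolis α)
    (h : Module.finrank (ZMod 2) (M.MargolisHomology α) = 1) :
    Module.finrank (ZMod 2) (M.dual.MargolisHomology α) = 1 := by
  obtain ⟨D⟩ := exists_homologyRetract (M.reductionAct α) fun v => hα.sq_red v
  have D' := D.dual.congr (d' := M.dual.reductionAct α) (redDual hM) fun v =>
    LinearMap.ext fun w => redDual_smul hM hα v w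
  rw [D'.finrank_homology, Subspace.dual_finrank_eq]
  exact h

end DualHomology

/-! ### Evaluation and coevaluation -/

section Evaluation

variable (M : BigradedModule.{u}) [Module.Finite M2 M]

/-- Evaluation `M ⊗ M^∨ → 𝔽₂[τ, ρ]`, as an additive map. -/
noncomputable def evalAdd : M.tensor M.dual →+ unit :=
  tensorLift M M.dual (fun x f => unitEquiv.symm (M.dualEquiv f x))
    (fun x x' f => by rw [map_add, map_add])
    (fun x f f' => by rw [map_add, LinearMap.add_apply, map_add])
    (fun x f => by rw [dual_tau_smul, dualEquiv_tau])
    (fun x f => by rw [dual_rho_smul, dualEquiv_rho])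

theorem evalAdd_pure (x : M) (f : M.dual) :
    M.evalAdd (pure x f) = unitEquiv.symm (M.dualEquiv f x) := rfl

theorem unitEquiv_evalAdd_pure (x : M) (f : M.dual) :
    unitEquiv (M.evalAdd (pure x f)) = M.dualEquiv f x := by
  rw [evalAdd_pure, LinearEquiv.apply_symm_apply]

/-- Evaluation `M ⊗ M^∨ → 𝔽₂[τ, ρ]`. -/
noncomputable def eval : M.tensor M.dual →ₗ[A1R] unit :=
  linearOfGens M.evalAdd
    (fun t => by
      induction t using tensor_induction with
      | pure x f =>
        apply unitEquiv.injective
        rw [tau_smul_pure, unitEquiv_tau_smul, unitEquiv_evalAdd_pure, unitEquiv_evalAdd_pure,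
          dual_tau_smul]
      | add s t hs ht => rw [smul_add, map_add, hs, ht, map_add, smul_add])
    (fun t => by
      induction t using tensor_induction with
      | pure x f =>
        apply unitEquiv.injective
        rw [rho_smul_pure, unitEquiv_rho_smul, unitEquiv_evalAdd_pure, unitEquiv_evalAdd_pure,
          dual_rho_smul]
      | add s t hs ht => rw [smul_add, map_add, hs, ht, map_add, smul_add])
    (fun t => by
      induction t using tensor_induction with
      | pure x f =>
        apply unitEquiv.injective
        rw [sq1_smul_pure, unitEquiv_sq1_smul, map_add, map_add, unitEquiv_evalAdd_pure,
          unitEquiv_evalAdd_pure, unitEquiv_evalAdd_pure, dualEquiv_sq1]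
        linear_combination M2_add_self (M.dualEquiv f (A1R.sq1 • x))
      | add s t hs ht => rw [smul_add, map_add, hs, ht, map_add, smul_add])
    (fun t => by
      induction t using tensor_induction with
      | pure x f =>
        apply unitEquiv.injective
        rw [sq2_smul_pure, unitEquiv_sq2_smul, map_add, map_add, map_add, map_add,
          unitEquiv_evalAdd_pure, unitEquiv_evalAdd_pure, unitEquiv_evalAdd_pure,
          unitEquiv_evalAdd_pure, dualEquiv_sq2, dual_tau_smul, dualEquiv_sq1, sq1_sq1_smul,
          map_zero]
        linear_combination M2_add_self (M.dualEquiv f (A1R.sq2 • x)) +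
          M2_add_self (M2.tau * unitSq1 (M.dualEquiv f (A1R.sq1 • x)))
      | add s t hs ht => rw [smul_add, map_add, hs, ht, map_add, smul_add])

theorem unitEquiv_eval_pure (x : M) (f : M.dual) :
    unitEquiv (M.eval (pure x f)) = M.dualEquiv f x :=
  M.unitEquiv_evalAdd_pure x f

theorem eval_mem {d : ℤ × ℤ} {t : M.tensor M.dual} (ht : t ∈ (M.tensor M.dual).gr d) :
    M.eval t ∈ unit.gr d := by
  change t ∈ tensorGr M M.dual d at ht
  induction ht using AddSubgroup.closure_induction with
  | mem t ht =>
    obtain ⟨d₁, d₂, x, f, rfl, hx, hf, rfl⟩ := ht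
    rw [← unitEquiv_mem]
    exact (M.unitEquiv_eval_pure x f).symm ▸ dualEquiv_mem hf hx
  | zero => exact (map_zero M.eval).symm ▸ zero_mem _
  | add s t _ _ hs ht => exact (map_add M.eval s t).symm ▸ add_mem hs ht
  | neg t _ ht => exact (map_neg M.eval t).symm ▸ neg_mem ht

/-- The endomorphism of `M` given by an element of `M ⊗ M^∨`: `x ⊗ f` is `m ↦ f(m) x`. -/
noncomputable def tensorToEnd : M.tensor M.dual →+ (M →+ M) :=
  tensorLift M M.dual
    (fun x f => AddMonoidHom.mk' (fun m => M.dualEquiv f m • x) fun m m' => by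
      rw [map_add, add_smul])
    (fun x x' f => AddMonoidHom.ext fun m => smul_add _ _ _)
    (fun x f f' => AddMonoidHom.ext fun m => by
      change M.dualEquiv (f + f') m • x = M.dualEquiv f m • x + M.dualEquiv f' m • x
      rw [map_add, LinearMap.add_apply, add_smul])
    (fun x f => AddMonoidHom.ext fun m => by
      change M.dualEquiv f m • A1R.tau • x = M.dualEquiv (A1R.tau • f) m • x
      rw [dualEquiv_tau, mul_comm, mul_smul, tau_smul])
    (fun x f => AddMonoidHom.ext fun m => by
      change M.dualEquiv f m • A1R.rho • x = M.dualEquiv (A1R.rho • f) m • x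
      rw [dualEquiv_rho, mul_comm, mul_smul, rho_smul])

theorem tensorToEnd_pure (x : M) (f : M.dual) (m : M) :
    M.tensorToEnd (pure x f) m = M.dualEquiv f m • x := rfl

/-- `Sq¹` acts on endomorphisms by the commutator. -/
theorem tensorToEnd_sq1 (t : M.tensor M.dual) (m : M) : M.tensorToEnd (A1R.sq1 • t) m =
    A1R.sq1 • M.tensorToEnd t m + M.tensorToEnd t (A1R.sq1 • m) := by
  induction t using tensor_induction with
  | pure x f =>
    rw [sq1_smul_pure, map_add, AddMonoidHom.add_apply]
    simp only [tensorToEnd_pure]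
    rw [dualEquiv_sq1, sq1_smul_smul, add_smul]
    abel
  | add s t hs ht =>
    simp only [smul_add, map_add, AddMonoidHom.add_apply, hs, ht]
    abel

/-- The action of `Sq²` on endomorphisms. -/
theorem tensorToEnd_sq2 (t : M.tensor M.dual) (m : M) : M.tensorToEnd (A1R.sq2 • t) m =
    A1R.sq2 • M.tensorToEnd t m + M.tensorToEnd t (A1R.sq2 • m) +
      A1R.tau • A1R.sq1 • M.tensorToEnd t (A1R.sq1 • m) := by
  induction t using tensor_induction with
  | pure x f =>
    rw [sq2_smul_pure, map_add, map_add, AddMonoidHom.add_apply, AddMonoidHom.add_apply]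
    simp only [tensorToEnd_pure]
    rw [dualEquiv_sq1, dualEquiv_sq2, sq2_smul_smul, sq1_smul_smul]
    simp only [add_smul, smul_add, mul_smul, tau_smul, smul_smul_comm_tau]
    abel
  | add s t hs ht =>
    simp only [smul_add, map_add, AddMonoidHom.add_apply, hs, ht]
    abel

/-- The canonical element `∑ bᵢ ⊗ bᵢ^∨` of `M ⊗ M^∨`. -/
noncomputable def coev {ι : Type*} [Fintype ι] (b : Module.Basis ι M2 M) : M.tensor M.dual :=
  ∑ i, pure (b i) (M.dualEquiv.symm (b.coord i))

variable {M}

theorem eq_sum_tensorToEnd {ι : Type*} [Fintype ι] (b : Module.Basis ι M2 M)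
    (t : M.tensor M.dual) :
    t = ∑ i, pure (M.tensorToEnd t (b i)) (M.dualEquiv.symm (b.coord i)) := by
  induction t using tensor_induction with
  | pure x f =>
    have hf : f = ∑ i, M.dualEquiv f (b i) • M.dualEquiv.symm (b.coord i) := by
      apply M.dualEquiv.injective
      rw [map_sum]
      simp only [map_smul, LinearEquiv.apply_symm_apply]
      refine b.ext fun j => ?_
      simp
    simp only [tensorToEnd_pure, pure_smul]
    conv_lhs => rw [hf]
    exact TensorProduct.tmul_sum x _ _
  | add s t hs ht =>
    simp only [map_add, AddMonoidHom.add_apply, pure_add_left, Finset.sum_add_distrib]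
    rw [← hs, ← ht]

theorem tensorToEnd_coev {ι : Type*} [Fintype ι] (b : Module.Basis ι M2 M) (m : M) :
    M.tensorToEnd (M.coev b) m = m := by
  rw [coev, map_sum, AddMonoidHom.finsetSum_apply]
  simp only [tensorToEnd_pure, LinearEquiv.apply_symm_apply, Module.Basis.coord_apply]
  exact b.sum_repr m

/-- For a finitely generated free module the map `M ⊗ M^∨ → End M` is injective. -/
theorem tensor_eq_zero (hM : Module.Free M2 M) (t : M.tensor M.dual)
    (h : ∀ m, M.tensorToEnd t m = 0) : t = 0 := by
  rw [eq_sum_tensorToEnd (Module.finBasis M2 M) t]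
  refine Finset.sum_eq_zero fun i _ => ?_
  rw [h]
  exact TensorProduct.zero_tmul _ _

theorem sq1_smul_coev {ι : Type*} [Fintype ι] (b : Module.Basis ι M2 M) :
    A1R.sq1 • M.coev b = 0 :=
  tensor_eq_zero (Module.Free.of_basis b) _ fun m => by
    rw [tensorToEnd_sq1, tensorToEnd_coev, tensorToEnd_coev, add_self_eq_zero]

theorem sq2_smul_coev {ι : Type*} [Fintype ι] (b : Module.Basis ι M2 M) :
    A1R.sq2 • M.coev b = 0 :=
  tensor_eq_zero (Module.Free.of_basis b) _ fun m => by
    rw [tensorToEnd_sq2, tensorToEnd_coev, tensorToEnd_coev, tensorToEnd_coev, add_self_eq_zero,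
      sq1_sq1_smul, smul_zero, add_zero]

theorem unitEquiv_eval_coev {ι : Type*} [Fintype ι] (b : Module.Basis ι M2 M) :
    unitEquiv (M.eval (M.coev b)) = (Fintype.card ι : M2) := by
  rw [coev, map_sum, map_sum]
  simp only [unitEquiv_eval_pure, LinearEquiv.apply_symm_apply, Module.Basis.coord_apply,
    Module.Basis.repr_self, Finsupp.single_eq_same]
  simp

end Evaluation

end BigradedModule

/-! ### Exactness of operators on images, by a degree argument -/

/-- Let `x`, `y` be commuting square-zero operators on the image of `z`, both exact there. If `x`
raises the first degree more than `y`, then `y` is still exact on the image of `x z`: a failure of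
exactness in some degree propagates to ever smaller degrees, where the module vanishes. -/
theorem exact_on_image {V : Type*} [AddCommGroup V] (p : ℤ × ℤ → V →+ V)
    (hp : ∀ d v, p d (p d v) = p d v)
    (hsum : ∀ v, ∃ D : Finset (ℤ × ℤ), ∑ d ∈ D, p d v = v) (N : ℤ)
    (hN : ∀ d v, d.1 < N → p d v = 0) (z x y : V →+ V) (cz cx cy : ℤ × ℤ)
    (hz : ∀ d v, p (d + cz) (z v) = z (p d v)) (hx : ∀ d v, p (d + cx) (x v) = x (p d v))
    (hy : ∀ d v, p (d + cy) (y v) = y (p d v)) (hlt : cy.1 < cx.1)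
    (hxy : ∀ v, x (y (z v)) = y (x (z v))) (hzx : ∀ v, z (x v) = x (z v))
    (hzy : ∀ v, z (y v) = y (z v)) (hxx : ∀ v, x (x (z v)) = 0) (hyy : ∀ v, y (y (z v)) = 0)
    (ex : ∀ v, x (z v) = 0 → ∃ w, z v = x (z w)) (ey : ∀ v, y (z v) = 0 → ∃ w, z v = y (z w))
    (v : V) (hv : y (x (z v)) = 0) : ∃ w, x (z v) = y (x (z w)) := by
  have key : ∀ n : ℕ, ∀ d v, d.1 < N + n → y (x (z (p d v))) = 0 →
      ∃ w, x (z (p d v)) = y (x (z w)) := by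
    intro n
    induction n with
    | zero =>
      intro d v hd _
      refine ⟨0, ?_⟩
      rw [hN d v (by simpa using hd)]
      simp
    | succ n ih =>
      intro d v hd hv
      -- `y v` is an `x`-boundary, of an element of degree `d + cy - cx`, lower than `d`
      obtain ⟨u, hu⟩ := ex (y (p d v)) (by rw [hzy, hxy, hv])
      have hu' : z (y (p d v)) = x (z (p (d + cy - cx) u)) := by
        have h := congrArg (p (d + cy + cz)) hu
        rw [hz, hy, hp, show d + cy + cz = (d + cy - cx + cz) + cx by abel, hx, hz] at h
        exact h
      obtain ⟨w, hw⟩ := ih (d + cy - cx) u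
        (by simp only [Prod.fst_sub, Prod.fst_add]; push_cast at hd; omega)
        (by rw [← hu', hzy, hyy])
      -- subtracting `x w` from `v` makes it a `y`-cycle and does not change `x v`
      obtain ⟨w₀, hw₀⟩ := ey (p d v - x w) (by
        rw [map_sub, map_sub, hzx, ← hw, ← hu', hzy, sub_self])
      refine ⟨w₀, ?_⟩
      have h := congrArg x hw₀
      rw [map_sub, map_sub, hzx, hxx, sub_zero, hxy] at h
      exact h
  have key' : ∀ d, ∃ w, x (z (p d v)) = y (x (z w)) := by
    intro d
    refine key (d.1 - N + 1).toNat d v (by omega) ?_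
    rw [← hz, ← hx, ← hy, hv, map_zero]
  choose w hw using key'
  obtain ⟨D, hD⟩ := hsum v
  refine ⟨∑ d ∈ D, w d, ?_⟩
  conv_lhs => rw [← hD]
  simp only [map_sum, hw]

/-- If `g` is square-zero and exact on the image of `f`, and preserves that image, then it halves
the dimension. -/
theorem finrank_range_eq_two_mul {k V : Type*} [Field k] [AddCommGroup V] [Module k V]
    [Module.Finite k V] (f g : V →ₗ[k] V) (hle : ∀ v, ∃ w, g (f v) = f w)
    (hgg : ∀ v, g (g (f v)) = 0) (hex : ∀ v, g (f v) = 0 → ∃ w, f v = g (f w)) :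
    Module.finrank k (LinearMap.range f) = 2 * Module.finrank k (LinearMap.range (g ∘ₗ f)) := by
  let h : LinearMap.range f →ₗ[k] V := g.domRestrict (LinearMap.range f)
  have h1 : LinearMap.range h = LinearMap.range (g ∘ₗ f) := by
    ext v
    constructor
    · rintro ⟨⟨_, w, rfl⟩, rfl⟩
      exact ⟨w, rfl⟩
    · rintro ⟨w, rfl⟩
      exact ⟨⟨f w, w, rfl⟩, rfl⟩
  have h2 : (LinearMap.ker h).map (LinearMap.range f).subtype = LinearMap.range (g ∘ₗ f) := by
    ext v
    constructor
    · rintro ⟨⟨_, w, rfl⟩, hw, rfl⟩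
      obtain ⟨w', hw'⟩ := hex w hw
      exact ⟨w', hw'.symm⟩
    · rintro ⟨w, rfl⟩
      obtain ⟨w', hw'⟩ := hle w
      exact ⟨⟨f w', w', rfl⟩, by change g (f w') = 0; rw [← hw', hgg], hw'.symm⟩
  have h3 := h.finrank_range_add_finrank_ker
  have h4 := (Submodule.equivMapOfInjective (LinearMap.range f).subtype
    Subtype.val_injective (LinearMap.ker h)).finrank_eq
  rw [h2] at h4
  rw [h1, h4] at h3
  omega

namespace BigradedModule

/-! ### Gradings on reductions and boundedness -/

section Grading

variable {K : BigradedModule.{u}}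

theorem proj_proj (d : ℤ × ℤ) (x : K) : K.proj d (K.proj d x) = K.proj d x :=
  K.proj_same d _ (K.proj_mem d x)

theorem proj_smul {α : A1R} {c : ℤ × ℤ} (hα : ∀ d x, x ∈ K.gr d → α • x ∈ K.gr (d + c))
    (d : ℤ × ℤ) (x : K) : K.proj (d + c) (α • x) = α • K.proj d x :=
  K.proj_shift (DistribSMul.toAddMonoidHom K α) c hα d x

theorem proj_tau_smul (d : ℤ × ℤ) (x : K) :
    K.proj d (A1R.tau • x) = A1R.tau • K.proj (d - (0, 1)) x := by
  rw [← proj_smul K.tau_mem, sub_add_cancel]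

theorem proj_rho_smul (d : ℤ × ℤ) (x : K) :
    K.proj d (A1R.rho • x) = A1R.rho • K.proj (d - (1, 1)) x := by
  rw [← proj_smul K.rho_mem, sub_add_cancel]

theorem proj_sq1_smul (d : ℤ × ℤ) (x : K) :
    K.proj d (A1R.sq1 • x) = A1R.sq1 • K.proj (d - (1, 0)) x := by
  rw [← proj_smul K.sq1_mem, sub_add_cancel]

theorem proj_sq2_smul (d : ℤ × ℤ) (x : K) :
    K.proj d (A1R.sq2 • x) = A1R.sq2 • K.proj (d - (2, 1)) x := by
  rw [← proj_smul K.sq2_mem, sub_add_cancel]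

theorem Q1_mem (d : ℤ × ℤ) (x : K) (hx : x ∈ K.gr d) : A1R.Q1 • x ∈ K.gr (d + (3, 1)) := by
  rw [Q1_smul]
  have e1 : d + (2, 1) + (1, 0) = d + (3, 1) := by rw [add_assoc]; rfl
  have e2 : d + (1, 0) + (2, 1) = d + (3, 1) := by rw [add_assoc]; rfl
  exact add_mem (e1 ▸ K.sq1_mem _ _ (K.sq2_mem _ _ hx)) (e2 ▸ K.sq2_mem _ _ (K.sq1_mem _ _ hx))

/-- The projections of the reduction to its homogeneous parts. -/
noncomputable def redProj (K : BigradedModule.{u}) (d : ℤ × ℤ) : K.Reduction →+ K.Reduction :=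
  QuotientAddGroup.map K.rhoTau.toAddSubgroup K.rhoTau.toAddSubgroup (K.proj d) (by
    rintro _ ⟨x, y, rfl⟩
    refine ⟨K.proj (d - (1, 1)) x, K.proj (d - (0, 1)) y, ?_⟩
    rw [map_add, proj_tau_smul, proj_rho_smul])

theorem redProj_red (d : ℤ × ℤ) (x : K) : K.redProj d (red x) = red (K.proj d x) := rfl

theorem redProj_smul {α : A1R} {c : ℤ × ℤ} (hα : ∀ d x, x ∈ K.gr d → α • x ∈ K.gr (d + c))
    (d : ℤ × ℤ) (v : K.Reduction) : K.redProj (d + c) (α • v) = α • K.redProj d v := by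
  obtain ⟨x, rfl⟩ := red_surjective v
  rw [smul_red, redProj_red, proj_smul hα]
  rfl

/-- A finitely generated module is bounded below in both degrees. -/
theorem exists_bound (K : BigradedModule.{u}) [Module.Finite M2 K] :
    ∃ N : ℤ, ∀ d : ℤ × ℤ, d.1 < N ∨ d.2 < N → ∀ x : K, K.proj d x = 0 := by
  classical
  obtain ⟨S, hS, hspan⟩ := exists_homogeneous_generators K
  choose! deg hdeg using hS
  obtain ⟨N, hN⟩ := (S.image fun x => min (deg x).1 (deg x).2).bddBelow
  refine ⟨N, fun d hd x => ?_⟩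
  have hx : x ∈ Submodule.span M2 (S : Set K) := by rw [hspan]; trivial
  induction hx using Submodule.span_induction generalizing d with
  | mem x hx =>
    refine K.proj_other d (deg x) ?_ x (hdeg x hx)
    rintro rfl
    have := hN (Finset.mem_image_of_mem _ hx)
    rw [le_min_iff] at this
    omega
  | zero => exact map_zero _
  | add x y _ _ hx hy => rw [map_add, hx d hd, hy d hd, add_zero]
  | smul c x _ hx =>
    induction c using M2.induction_mul generalizing d with
    | one => rw [one_smul, hx d hd]
    | htau c hc =>
      rw [mul_smul, tau_smul, proj_tau_smul, hc _ (by simp; omega), smul_zero]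
    | hrho c hc =>
      rw [mul_smul, rho_smul, proj_rho_smul, hc _ (by simp; omega), smul_zero]
    | add a b ha hb => rw [add_smul, map_add, ha d hd, hb d hd, add_zero]

/-- Nakayama's lemma: homogeneous elements that generate the reduction generate the module. -/
theorem span_eq_top_of_red [Module.Finite M2 K] {ι : Type*} (x : ι → K)
    (hx : ∀ i, ∃ d, x i ∈ K.gr d)
    (hspan : Submodule.span A1R (Set.range fun i => red (x i)) = ⊤) :
    Submodule.span A1R (Set.range x) = ⊤ := by
  set L := Submodule.span A1R (Set.range x) with hL
  -- the generated submodule is graded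
  let L' : Submodule A1R K :=
    { carrier := {y | ∀ d, K.proj d y ∈ L}
      zero_mem' := fun d => by rw [map_zero]; exact zero_mem _
      add_mem' := fun hy hz d => by rw [map_add]; exact add_mem (hy d) (hz d)
      smul_mem' := fun c => by
        induction c using A1R_induction with
        | algebraMap c =>
          intro y hy
          rcases zmod_two_cases c with rfl | rfl
          · intro d; rw [map_zero, zero_smul, map_zero]; exact zero_mem _
          · rwa [map_one, one_smul]
        | of g =>
          intro y hy d
          cases g with
          | tau => exact (proj_tau_smul d y).symm ▸ L.smul_mem _ (hy _)
          | rho => exact (proj_rho_smul d y).symm ▸ L.smul_mem _ (hy _)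
          | sq1 => exact (proj_sq1_smul d y).symm ▸ L.smul_mem _ (hy _)
          | sq2 => exact (proj_sq2_smul d y).symm ▸ L.smul_mem _ (hy _)
        | mul a b ha hb => intro y hy; rw [mul_smul]; exact ha (hb hy)
        | add a b ha hb =>
          intro y hy d
          rw [add_smul, map_add]
          exact add_mem (ha hy d) (hb hy d) }
  have hLL' : L ≤ L' := by
    rw [hL, Submodule.span_le]
    rintro _ ⟨i, rfl⟩ d
    obtain ⟨e, he⟩ := hx i
    have hmem : x i ∈ L := Submodule.subset_span ⟨i, rfl⟩
    by_cases h : d = e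
    · subst h; rwa [K.proj_same d _ he]
    · rw [K.proj_other d e h _ he]; exact zero_mem _
  have hred : ∀ y : K, ∃ z ∈ L, ∃ s t : K, y = z + (A1R.rho • s + A1R.tau • t) := by
    intro y
    have hy : red y ∈ L.map K.rhoTau.mkQ := by
      have : L.map K.rhoTau.mkQ = ⊤ := by
        rw [hL, Submodule.map_span, ← Set.range_comp]
        exact hspan
      rw [this]; trivial
    obtain ⟨z, hz, hzy⟩ := hy
    have h0 : red (y - z) = 0 := by rw [red_sub, sub_eq_zero]; exact hzy.symm
    obtain ⟨s, t, hst⟩ := (red_eq_zero_iff _).1 h0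
    exact ⟨z, hz, s, t, by rw [← hst]; abel⟩
  obtain ⟨N, hN⟩ := K.exists_bound
  -- both `ρ` and `τ` raise the second degree, which is bounded below
  have key : ∀ n : ℕ, ∀ d : ℤ × ℤ, d.2 < N + n → ∀ y : K, K.proj d y ∈ L := by
    intro n
    induction n with
    | zero =>
      intro d hd y
      rw [hN d (Or.inr (by simpa using hd))]
      exact zero_mem _
    | succ n ih =>
      intro d hd y
      obtain ⟨z, hz, s, t, rfl⟩ := hred y
      push_cast at hd
      rw [map_add, map_add, proj_rho_smul, proj_tau_smul]
      exact add_mem (hLL' hz d) (add_mem (L.smul_mem _ (ih _ (by simp; omega) _))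
        (L.smul_mem _ (ih _ (by simp; omega) _)))
  rw [eq_top_iff]
  rintro y -
  obtain ⟨D, hD⟩ := K.exists_sum_proj y
  rw [← hD D subset_rfl]
  exact sum_mem fun d _ => key (d.2 - N + 1).toNat d (by omega) y

end Grading

/-! ### Freeness of exact modules -/

section Freeness

variable {K : BigradedModule.{u}}

/-- Exactness of an operator on the reduction. -/
def RedAcyclic (K : BigradedModule.{u}) (α : A1R) : Prop :=
  ∀ v : K.Reduction, α • v = 0 → ∃ w : K.Reduction, v = α • w

theorem sq1_Q1_red (v : K.Reduction) : A1R.sq1 • A1R.Q1 • v = A1R.Q1 • A1R.sq1 • v := by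
  simp only [Q1_smul, smul_add, sq1_sq1_red, smul_zero, zero_add, add_zero]

theorem sq2_Q1_red (v : K.Reduction) : A1R.sq2 • A1R.Q1 • v = A1R.Q1 • A1R.sq2 • v := by
  simp only [Q1_smul, smul_add, sq2_sq2_red, smul_zero, zero_add, add_zero]

theorem sq1_sq2_Q1_red (v : K.Reduction) :
    A1R.sq1 • A1R.sq2 • A1R.Q1 • v = A1R.sq2 • A1R.sq1 • A1R.Q1 • v := by
  simp only [Q1_smul, smul_add, sq2_sq2_red, sq1_sq1_red, zero_add, add_zero, sq1212_smul]

/-- The specialization of the degree argument to operators of `A(1)^ℝ` on the reduction. -/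
theorem exact_on_image_red [Module.Finite M2 K] (z x y : K.Reduction →+ K.Reduction)
    (cz cx cy : ℤ × ℤ)
    (hz : ∀ d v, K.redProj (d + cz) (z v) = z (K.redProj d v))
    (hx : ∀ d v, K.redProj (d + cx) (x v) = x (K.redProj d v))
    (hy : ∀ d v, K.redProj (d + cy) (y v) = y (K.redProj d v)) (hlt : cy.1 < cx.1)
    (hxy : ∀ v, x (y (z v)) = y (x (z v))) (hzx : ∀ v, z (x v) = x (z v))
    (hzy : ∀ v, z (y v) = y (z v)) (hxx : ∀ v, x (x (z v)) = 0) (hyy : ∀ v, y (y (z v)) = 0)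
    (ex : ∀ v, x (z v) = 0 → ∃ w, z v = x (z w)) (ey : ∀ v, y (z v) = 0 → ∃ w, z v = y (z w))
    (v : K.Reduction) (hv : y (x (z v)) = 0) : ∃ w, x (z v) = y (x (z w)) := by
  obtain ⟨N, hN⟩ := K.exists_bound
  refine exact_on_image K.redProj (fun d v => ?_) (fun v => ?_) N (fun d v hd => ?_) z x y cz cx cy
    hz hx hy hlt hxy hzx hzy hxx hyy ex ey v hv
  · obtain ⟨x, rfl⟩ := red_surjective v
    rw [redProj_red, redProj_red, proj_proj]
  · obtain ⟨x, rfl⟩ := red_surjective v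
    obtain ⟨D, hD⟩ := K.exists_sum_proj x
    refine ⟨D, ?_⟩
    simp only [redProj_red]
    rw [← red_sum, hD D subset_rfl]
  · obtain ⟨x, rfl⟩ := red_surjective v
    rw [redProj_red, hN d (Or.inl hd), red_zero]

/-- The action of an element on the reduction, as an additive map. -/
abbrev redAct (K : BigradedModule.{u}) (α : A1R) : K.Reduction →+ K.Reduction :=
  DistribSMul.toAddMonoidHom K.Reduction α

/-- `Sq¹` is exact on the image of `Q₁`; the degree `3` of `Q₁` exceeds the degree `1` of `Sq¹`. -/
theorem sq1_exact_Q1 [Module.Finite M2 K] (h0 : K.RedAcyclic A1R.sq1)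
    (h1 : K.RedAcyclic A1R.Q1) (v : K.Reduction) (hv : A1R.sq1 • A1R.Q1 • v = 0) :
    ∃ w : K.Reduction, A1R.Q1 • v = A1R.sq1 • A1R.Q1 • w :=
  exact_on_image_red (AddMonoidHom.id _) (K.redAct A1R.Q1) (K.redAct A1R.sq1) 0 (3, 1) (1, 0)
    (fun d v => by rw [add_zero]; rfl) (redProj_smul Q1_mem) (redProj_smul K.sq1_mem) (by decide)
    (fun v => (sq1_Q1_red v).symm) (fun _ => rfl) (fun _ => rfl) Q1_Q1_red sq1_sq1_red h1 h0 v hv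

/-- `Sq²` is exact on the image of `Q₁`; the degree `3` of `Q₁` exceeds the degree `2` of `Sq²`. -/
theorem sq2_exact_Q1 [Module.Finite M2 K] (h1 : K.RedAcyclic A1R.Q1)
    (h2 : K.RedAcyclic A1R.sq2) (v : K.Reduction) (hv : A1R.sq2 • A1R.Q1 • v = 0) :
    ∃ w : K.Reduction, A1R.Q1 • v = A1R.sq2 • A1R.Q1 • w :=
  exact_on_image_red (AddMonoidHom.id _) (K.redAct A1R.Q1) (K.redAct A1R.sq2) 0 (3, 1) (2, 1)
    (fun d v => by rw [add_zero]; rfl) (redProj_smul Q1_mem) (redProj_smul K.sq2_mem) (by decide)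
    (fun v => (sq2_Q1_red v).symm) (fun _ => rfl) (fun _ => rfl) Q1_Q1_red sq2_sq2_red h1 h2 v hv

/-- `Sq¹` is exact on the image of `Sq² Q₁`. -/
theorem sq1_exact_sq2_Q1 [Module.Finite M2 K] (h0 : K.RedAcyclic A1R.sq1)
    (h1 : K.RedAcyclic A1R.Q1) (h2 : K.RedAcyclic A1R.sq2) (v : K.Reduction)
    (hv : A1R.sq1 • A1R.sq2 • A1R.Q1 • v = 0) :
    ∃ w : K.Reduction, A1R.sq2 • A1R.Q1 • v = A1R.sq1 • A1R.sq2 • A1R.Q1 • w :=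
  exact_on_image_red (K.redAct A1R.Q1) (K.redAct A1R.sq2) (K.redAct A1R.sq1) (3, 1) (2, 1) (1, 0)
    (redProj_smul Q1_mem) (redProj_smul K.sq2_mem) (redProj_smul K.sq1_mem) (by decide)
    (fun v => (sq1_sq2_Q1_red v).symm) (fun v => (sq2_Q1_red v).symm)
    (fun v => (sq1_Q1_red v).symm) (fun v => sq2_sq2_red _) (fun v => sq1_sq1_red _)
    (sq2_exact_Q1 h1 h2) (sq1_exact_Q1 h0 h1) v hv

/-- The annihilator of the top class `Sq¹ Sq² Q₁` is the image of the augmentation ideal. -/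
theorem exists_eq_sq1_add_sq2 [Module.Finite M2 K] (h0 : K.RedAcyclic A1R.sq1)
    (h1 : K.RedAcyclic A1R.Q1) (h2 : K.RedAcyclic A1R.sq2) (v : K.Reduction)
    (hv : A1R.sq1 • A1R.sq2 • A1R.Q1 • v = 0) :
    ∃ w w' : K.Reduction, v = A1R.sq1 • w + A1R.sq2 • w' := by
  obtain ⟨w, hw⟩ := sq1_exact_sq2_Q1 h0 h1 h2 v hv
  obtain ⟨u, hu⟩ := sq2_exact_Q1 h1 h2 (v - A1R.sq1 • w) (by
    rw [smul_sub, smul_sub, hw, sq1_sq2_Q1_red, sq1_Q1_red, sub_self])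
  obtain ⟨z, hz⟩ := h1 (v - A1R.sq1 • w - A1R.sq2 • u) (by
    rw [smul_sub, hu, sq2_Q1_red, sub_self])
  refine ⟨w + A1R.sq2 • z, u + A1R.sq1 • z, ?_⟩
  have hv' : v = A1R.Q1 • z + (A1R.sq1 • w + A1R.sq2 • u) := by rw [← hz]; abel
  rw [hv', Q1_smul, smul_add, smul_add]
  abel

/-- The top operator `Sq¹ Sq² Q₁ = Sq¹ Sq² Sq¹ Sq²` on the reduction. -/
noncomputable def topOp (K : BigradedModule.{u}) : K.Reduction →ₗ[ZMod 2] K.Reduction :=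
  K.reductionAct A1R.sq1 ∘ₗ K.reductionAct A1R.sq2 ∘ₗ K.reductionAct A1R.Q1

theorem topOp_apply (v : K.Reduction) : K.topOp v = A1R.sq1 • A1R.sq2 • A1R.Q1 • v := rfl

/-- Each of `Q₁`, `Sq²` on the image of `Q₁`, and `Sq¹` on the image of `Sq² Q₁` halves the
dimension. -/
theorem finrank_reduction_eq_eight_mul [Module.Finite M2 K] (h0 : K.RedAcyclic A1R.sq1)
    (h1 : K.RedAcyclic A1R.Q1) (h2 : K.RedAcyclic A1R.sq2) :
    Module.finrank (ZMod 2) K.Reduction =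
      8 * Module.finrank (ZMod 2) (LinearMap.range K.topOp) := by
  have := finite_reduction (X := K) inferInstance
  have e1 := finrank_range_eq_two_mul (LinearMap.id : K.Reduction →ₗ[ZMod 2] K.Reduction)
    (K.reductionAct A1R.Q1) (fun v => ⟨_, rfl⟩) Q1_Q1_red h1
  have e2 := finrank_range_eq_two_mul (K.reductionAct A1R.Q1) (K.reductionAct A1R.sq2)
    (fun v => ⟨A1R.sq2 • v, sq2_Q1_red v⟩) (fun v => sq2_sq2_red _) (sq2_exact_Q1 h1 h2)
  have e3 := finrank_range_eq_two_mul (K.reductionAct A1R.sq2 ∘ₗ K.reductionAct A1R.Q1)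
    (K.reductionAct A1R.sq1) (fun v => ⟨A1R.sq1 • v, by
      change A1R.sq1 • A1R.sq2 • A1R.Q1 • v = A1R.sq2 • A1R.Q1 • A1R.sq1 • v
      rw [sq1_sq2_Q1_red, sq1_Q1_red]⟩) (fun v => sq1_sq1_red _) (sq1_exact_sq2_Q1 h0 h1 h2)
  rw [LinearMap.range_id, finrank_top, LinearMap.comp_id] at e1
  rw [e1, e2, e3, topOp]
  ring

/-- The augmentation ideal is nilpotent on the reduction, so a submodule that generates modulo the
image of the augmentation ideal is everything. -/
theorem mem_of_generates {W : Submodule A1R K.Reduction}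
    (hW : ∀ v, ∃ g ∈ W, ∃ w w', v = g + (A1R.sq1 • w + A1R.sq2 • w')) (v : K.Reduction) :
    v ∈ W := by
  have a3 : ∀ v : K.Reduction, A1R.sq1 • A1R.sq2 • A1R.sq1 • A1R.sq2 • v ∈ W := by
    intro v
    obtain ⟨g, hg, w, w', rfl⟩ := hW v
    have hz : A1R.sq1 • A1R.sq2 • A1R.sq1 • A1R.sq2 • A1R.sq1 • w = 0 := by
      rw [sq1212_smul, sq1_sq1_red, smul_zero, smul_zero, smul_zero]
    simp only [smul_add, sq2_sq2_red, add_zero, hz]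
    exact W.smul_mem _ (W.smul_mem _ (W.smul_mem _ (W.smul_mem _ hg)))
  have a2 : ∀ v : K.Reduction, A1R.sq1 • A1R.sq2 • A1R.sq1 • v ∈ W := by
    intro v
    obtain ⟨g, hg, w, w', rfl⟩ := hW v
    simp only [smul_add, sq1_sq1_red, zero_add]
    exact add_mem (W.smul_mem _ (W.smul_mem _ (W.smul_mem _ hg))) (a3 w')
  have b2 : ∀ v : K.Reduction, A1R.sq2 • A1R.sq1 • A1R.sq2 • v ∈ W := by
    intro v
    obtain ⟨g, hg, w, w', rfl⟩ := hW v
    simp only [smul_add, sq2_sq2_red, add_zero]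
    exact add_mem (W.smul_mem _ (W.smul_mem _ (W.smul_mem _ hg)))
      (by rw [← sq1212_smul]; exact a3 w)
  have a1 : ∀ v : K.Reduction, A1R.sq1 • A1R.sq2 • v ∈ W := by
    intro v
    obtain ⟨g, hg, w, w', rfl⟩ := hW v
    simp only [smul_add, sq2_sq2_red, add_zero]
    exact add_mem (W.smul_mem _ (W.smul_mem _ hg)) (a2 w)
  have b1 : ∀ v : K.Reduction, A1R.sq2 • A1R.sq1 • v ∈ W := by
    intro v
    obtain ⟨g, hg, w, w', rfl⟩ := hW v
    simp only [smul_add, sq1_sq1_red, zero_add]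
    exact add_mem (W.smul_mem _ (W.smul_mem _ hg)) (b2 w')
  have a0 : ∀ v : K.Reduction, A1R.sq1 • v ∈ W := by
    intro v
    obtain ⟨g, hg, w, w', rfl⟩ := hW v
    simp only [smul_add, sq1_sq1_red, zero_add]
    exact add_mem (W.smul_mem _ hg) (a1 w')
  have b0 : ∀ v : K.Reduction, A1R.sq2 • v ∈ W := by
    intro v
    obtain ⟨g, hg, w, w', rfl⟩ := hW v
    simp only [smul_add, sq2_sq2_red, add_zero]
    exact add_mem (W.smul_mem _ hg) (b1 w)
  obtain ⟨g, hg, w, w', rfl⟩ := hW v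
  exact add_mem hg (add_mem (a0 w) (b0 w'))

/-- A minimal number of generators: homogeneous lifts of a basis of the image of the top operator
generate the module. -/
theorem exists_generators [Module.Finite M2 K] (h0 : K.RedAcyclic A1R.sq1)
    (h1 : K.RedAcyclic A1R.Q1) (h2 : K.RedAcyclic A1R.sq2) :
    ∃ x : Fin (Module.finrank (ZMod 2) (LinearMap.range K.topOp)) → K,
    Submodule.span A1R (Set.range x) = ⊤ := by
  have := finite_reduction (X := K) inferInstance
  let s : Set K.Reduction := {v | ∃ d, ∃ x ∈ K.gr d, K.topOp (red x) = v}
  have hs : Submodule.span (ZMod 2) s = LinearMap.range K.topOp := by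
    apply le_antisymm
    · rw [Submodule.span_le]
      rintro _ ⟨d, x, _, rfl⟩
      exact ⟨_, rfl⟩
    · rintro _ ⟨v, rfl⟩
      obtain ⟨x, rfl⟩ := red_surjective v
      induction x using K.hom_induction with
      | mem d x hx => exact Submodule.subset_span ⟨d, x, hx, rfl⟩
      | add x y hx hy => rw [red_add, map_add]; exact add_mem hx hy
  obtain ⟨f, hf, hspan, -⟩ := Submodule.exists_fun_fin_finrank_span_eq (ZMod 2) s
  rw [← hs]
  choose d x hx hfx using hf
  refine ⟨x, span_eq_top_of_red x (fun i => ⟨d i, hx i⟩) ?_⟩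
  rw [eq_top_iff]
  rintro v -
  refine mem_of_generates (fun v => ?_) v
  have hv : K.topOp v ∈ Submodule.span (ZMod 2) (Set.range f) := by
    rw [hspan, hs]
    exact ⟨v, rfl⟩
  obtain ⟨c, hc⟩ := (Submodule.mem_span_range_iff_exists_fun (ZMod 2)).1 hv
  let g : K.Reduction := ∑ i, c i • red (x i)
  have hg : K.topOp g = K.topOp v := by
    rw [← hc, map_sum]
    exact Finset.sum_congr rfl fun i _ => by rw [map_smul, hfx]
  obtain ⟨w, w', hw⟩ := exists_eq_sq1_add_sq2 h0 h1 h2 (v - g) (by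
    rw [← topOp_apply, map_sub, hg, sub_self])
  refine ⟨g, sum_mem fun i _ => ?_, w, w', by rw [← hw]; abel⟩
  have hmem : red (x i) ∈ Submodule.span A1R (Set.range fun i => red (x i)) :=
    Submodule.subset_span ⟨i, rfl⟩
  rcases zmod_two_cases (c i) with h | h
  · rw [h, zero_smul]; exact zero_mem _
  · rwa [h, one_smul]

/-- A module with exact reduction that is stably free of the right rank over the scalars is free
over `A(1)^ℝ`. The products of words with generators span over `𝔽₂[τ, ρ]`, and their number equals
the rank, so that they are a basis. -/
theorem exists_linearEquiv_pi [Module.Finite M2 K] (h0 : K.RedAcyclic A1R.sq1)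
    (h1 : K.RedAcyclic A1R.Q1) (h2 : K.RedAcyclic A1R.sq2) (hfree : Module.Free M2 (K × M2))
    (hrank : Module.finrank M2 (K × M2) = Module.finrank (ZMod 2) K.Reduction + 1) :
    ∃ n : ℕ, Nonempty (K ≃ₗ[A1R] (Fin n → A1R)) := by
  obtain ⟨x, hx⟩ := exists_generators h0 h1 h2
  have hdim := finrank_reduction_eq_eight_mul h0 h1 h2
  generalize Module.finrank (ZMod 2) (LinearMap.range K.topOp) = n at x hx hdim
  let φ : (Fin n → A1R) →ₗ[A1R] K := Fintype.linearCombination A1R x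
  have hφ : ∀ c, φ c = ∑ i, c i • x i := fun c => rfl
  have hφs : Function.Surjective φ := by
    rw [← LinearMap.range_eq_top, Fintype.range_linearCombination, hx]
  let ψ : (Fin n × Fin 8 → M2) →ₗ[M2] K :=
    Fintype.linearCombination M2 fun i => A1R.word i.2 • x i.1
  have hψ : ∀ m : Fin n → Fin 8 → M2, ψ (fun i => m i.1 i.2) =
      φ fun i => ∑ w, M2.toA1R (m i w) * A1R.word w := by
    intro m
    rw [hφ, Fintype.linearCombination_apply, Fintype.sum_prod_type]
    refine Finset.sum_congr rfl fun i _ => ?_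
    rw [Finset.sum_smul]
    refine Finset.sum_congr rfl fun w _ => ?_
    rw [mul_smul]
    rfl
  have hψs : Function.Surjective ψ := by
    intro y
    obtain ⟨c, rfl⟩ := hφs y
    choose m hm using fun i => A1R.exists_eq_sum_word (c i)
    exact ⟨fun i => m i.1 i.2, by rw [hψ]; exact congrArg φ (funext fun i => (hm i).symm)⟩
  -- compare ranks after adding a free summand of rank one on both sides
  have hψi : Function.Injective ψ := by
    let e : (K × M2) ≃ₗ[M2] ((Fin n × Fin 8 → M2) × M2) := LinearEquiv.ofFinrankEq _ _ (by
      rw [hrank, hdim, Module.finrank_prod, Module.finrank_self, Module.finrank_pi,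
        Fintype.card_prod, Fintype.card_fin, Fintype.card_fin, mul_comm])
    let Ψ : ((Fin n × Fin 8 → M2) × M2) →ₗ[M2] (K × M2) := ψ.prodMap LinearMap.id
    have hΨ : Function.Surjective Ψ := Function.Surjective.prodMap hψs Function.surjective_id
    have hinj : Function.Injective (e.toLinearMap ∘ₗ Ψ) :=
      OrzechProperty.injective_of_surjective_endomorphism _ (e.surjective.comp hΨ)
    intro a b hab
    have h : (e.toLinearMap ∘ₗ Ψ) (a, 0) = (e.toLinearMap ∘ₗ Ψ) (b, 0) := by
      change e (ψ a, 0) = e (ψ b, 0)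
      rw [hab]
    exact congrArg Prod.fst (hinj h)
  have hφi : Function.Injective φ := by
    rw [injective_iff_map_eq_zero]
    intro c hc
    choose m hm using fun i => A1R.exists_eq_sum_word (c i)
    have hm' : c = fun i => ∑ w, M2.toA1R (m i w) * A1R.word w := funext hm
    rw [hm', ← hψ] at hc
    have h0 := (injective_iff_map_eq_zero ψ).1 hψi _ hc
    rw [hm']
    refine funext fun i => Finset.sum_eq_zero fun w _ => ?_
    rw [show m i w = 0 from congrFun h0 (i, w), map_zero, zero_mul]
  exact ⟨n, ⟨(LinearEquiv.ofBijective φ ⟨hφi, hφs⟩).symm⟩⟩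

end Freeness

/-! ### Splitting off the unit object -/

/-- A degree-preserving linear map commutes with the projections to the homogeneous parts. -/
theorem map_proj {X : BigradedModule.{u}} {Y : BigradedModule.{v}} (f : X →ₗ[A1R] Y)
    (hf : ∀ d x, x ∈ X.gr d → f x ∈ Y.gr d) (d : ℤ × ℤ) (x : X) :
    f (X.proj d x) = Y.proj d (f x) := by
  induction x using X.hom_induction with
  | mem e x hx =>
    by_cases h : d = e
    · subst h
      rw [X.proj_same _ _ hx, Y.proj_same _ _ (hf _ _ hx)]
    · rw [X.proj_other _ _ h _ hx, Y.proj_other _ _ h _ (hf _ _ hx), map_zero]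
  | add x y hx hy => simp only [map_add, hx, hy]

/-- The homogeneous parts of the kernel of a map. -/
def kernelGr {X : BigradedModule.{u}} {Y : BigradedModule.{v}} (f : X →ₗ[A1R] Y) (d : ℤ × ℤ) :
    AddSubgroup (LinearMap.ker f) :=
  (X.gr d).comap (LinearMap.ker f).subtype.toAddMonoidHom

/-- The kernel of a degree-preserving map, as a bigraded module. -/
noncomputable def kernel {X : BigradedModule.{u}} {Y : BigradedModule.{v}} (f : X →ₗ[A1R] Y)
    (hf : ∀ d x, x ∈ X.gr d → f x ∈ Y.gr d) : BigradedModule.{u} where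
  carrier := LinearMap.ker f
  gr := kernelGr f
  isInternal := by
    have hker : ∀ d (x : LinearMap.ker f), X.proj d x.1 ∈ LinearMap.ker f := fun d x => by
      rw [LinearMap.mem_ker, map_proj f hf, LinearMap.mem_ker.1 x.2, map_zero]
    let p : ℤ × ℤ → LinearMap.ker f →+ LinearMap.ker f := fun d =>
      AddMonoidHom.mk' (fun x => ⟨X.proj d x.1, hker d x⟩)
        fun x y => Subtype.ext (map_add (X.proj d) x.1 y.1)
    refine isInternal_of_proj _ p (fun d x hx => Subtype.ext (X.proj_same d x.1 hx))
      (fun d e h x hx => Subtype.ext (X.proj_other d e h x.1 hx)) fun x => ?_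
    obtain ⟨D, hD⟩ := X.exists_sum_proj x.1
    have hx : x = ∑ d ∈ D, p d x := Subtype.ext (by
      rw [AddSubmonoidClass.coe_finsetSum]
      exact (hD D subset_rfl).symm)
    rw [hx]
    exact sum_mem fun d _ => AddSubgroup.mem_iSup_of_mem d (X.proj_mem d x.1)
  tau_mem d x hx := X.tau_mem d x.1 hx
  rho_mem d x hx := X.rho_mem d x.1 hx
  sq1_mem d x hx := X.sq1_mem d x.1 hx
  sq2_mem d x hx := X.sq2_mem d x.1 hx

/-- The map from the unit object given by an element killed by `Sq¹` and `Sq²`. -/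
noncomputable def ofUnit {X : BigradedModule.{u}} (x : X) (h1 : A1R.sq1 • x = 0)
    (h2 : A1R.sq2 • x = 0) : unit →ₗ[A1R] X :=
  linearOfGens
    (AddMonoidHom.mk' (fun c : unit => unitEquiv c • x) fun c c' => by rw [map_add, add_smul])
    (fun c => by
      change unitEquiv (A1R.tau • c) • x = A1R.tau • unitEquiv c • x
      rw [unitEquiv_tau_smul, mul_smul, tau_smul])
    (fun c => by
      change unitEquiv (A1R.rho • c) • x = A1R.rho • unitEquiv c • x
      rw [unitEquiv_rho_smul, mul_smul, rho_smul])
    (fun c => by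
      change unitEquiv (A1R.sq1 • c) • x = A1R.sq1 • unitEquiv c • x
      rw [unitEquiv_sq1_smul, sq1_smul_smul, h1, smul_zero, add_zero])
    (fun c => by
      change unitEquiv (A1R.sq2 • c) • x = A1R.sq2 • unitEquiv c • x
      rw [unitEquiv_sq2_smul, sq2_smul_smul, h1, h2]
      simp only [smul_zero, add_zero])

theorem ofUnit_apply {X : BigradedModule.{u}} (x : X) (h1 : A1R.sq1 • x = 0)
    (h2 : A1R.sq2 • x = 0) (c : unit) : ofUnit x h1 h2 c = unitEquiv c • x := rfl

theorem smul_mem_gr {X : BigradedModule.{u}} {x : X} {d : ℤ × ℤ} (hx : x ∈ X.gr 0) {c : M2}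
    (hc : c ∈ unitGr d) : c • x ∈ X.gr d := by
  induction hc using AddSubgroup.closure_induction with
  | mem z hz =>
    obtain ⟨i, j, rfl, rfl⟩ := hz
    have hr : ∀ j : ℕ, M2.rho ^ j • x ∈ X.gr (j • ((1, 1) : ℤ × ℤ)) := fun j => by
      induction j with
      | zero => simpa using hx
      | succ j ih =>
        rw [pow_succ', mul_smul, rho_smul, succ_nsmul]
        exact X.rho_mem _ _ ih
    induction i with
    | zero => simpa using hr j
    | succ i ih =>
      rw [pow_succ', mul_assoc, mul_smul, tau_smul, succ_nsmul, add_right_comm]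
      exact X.tau_mem _ _ ih
  | zero => rw [zero_smul]; exact zero_mem _
  | add z w _ _ hz hw => rw [add_smul]; exact add_mem hz hw
  | neg z _ hz => rw [neg_smul]; exact neg_mem hz

/-- The zero module. -/
noncomputable def zeroModule : BigradedModule.{u} where
  carrier := PUnit.{u + 1}
  gr _ := ⊥
  isInternal := isInternal_of_proj _ (fun _ => 0) (fun _ _ _ => rfl) (fun _ _ _ _ _ => rfl)
    fun x => by rw [Subsingleton.elim x 0]; exact zero_mem _
  tau_mem _ _ _ := rfl
  rho_mem _ _ _ := rfl
  sq1_mem _ _ _ := rfl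
  sq2_mem _ _ _ := rfl

theorem zeroModule_isFiniteProjective : zeroModule.{u}.IsFiniteProjective :=
  ⟨inferInstanceAs (Module.Finite A1R PUnit.{u + 1}),
    inferInstanceAs (Module.Projective A1R PUnit.{u + 1})⟩

/-- The grading carried along a linear isomorphism. -/
noncomputable def transport (K : BigradedModule.{u}) {Z : Type v} [AddCommGroup Z] [Module A1R Z]
    (e : K ≃ₗ[A1R] Z) : BigradedModule.{v} where
  carrier := Z
  gr d := (K.gr d).comap e.symm.toLinearMap.toAddMonoidHom
  isInternal := by
    refine isInternal_of_proj _ (fun d => (e.toLinearMap.toAddMonoidHom.comp (K.proj d)).comp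
      e.symm.toLinearMap.toAddMonoidHom) (fun d z hz => ?_) (fun d d' h z hz => ?_) fun z => ?_
    · exact (congrArg e (K.proj_same d _ hz)).trans (e.apply_symm_apply z)
    · exact (congrArg e (K.proj_other d d' h _ hz)).trans (map_zero e)
    · obtain ⟨D, hD⟩ := K.exists_sum_proj (e.symm z)
      rw [← e.apply_symm_apply z, ← hD D subset_rfl, map_sum]
      refine sum_mem fun d _ => AddSubgroup.mem_iSup_of_mem d ?_
      change e.symm (e _) ∈ K.gr d
      rw [e.symm_apply_apply]
      exact K.proj_mem d _
  tau_mem d z hz := by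
    change e.symm (A1R.tau • z) ∈ K.gr (d + (0, 1))
    rw [map_smul]; exact K.tau_mem d _ hz
  rho_mem d z hz := by
    change e.symm (A1R.rho • z) ∈ K.gr (d + (1, 1))
    rw [map_smul]; exact K.rho_mem d _ hz
  sq1_mem d z hz := by
    change e.symm (A1R.sq1 • z) ∈ K.gr (d + (1, 0))
    rw [map_smul]; exact K.sq1_mem d _ hz
  sq2_mem d z hz := by
    change e.symm (A1R.sq2 • z) ∈ K.gr (d + (2, 1))
    rw [map_smul]; exact K.sq2_mem d _ hz

section Split

variable {X : BigradedModule.{u}} {f : X →ₗ[A1R] unit}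
    {hf : ∀ d x, x ∈ X.gr d → f x ∈ unit.gr d} {x₀ : X} {h1 : A1R.sq1 • x₀ = 0}
    {h2 : A1R.sq2 • x₀ = 0}

theorem map_ofUnit (h : unitEquiv (f x₀) = 1) (c : unit) : f (ofUnit x₀ h1 h2 c) = c := by
  apply unitEquiv.injective
  rw [ofUnit_apply]
  change unitEquiv (toM2Linear f (unitEquiv c • x₀)) = _
  rw [map_smul, map_smul, toM2Linear_apply, h, smul_eq_mul, mul_one]

/-- The projection to the kernel of a map to the unit object, along a section. -/
noncomputable def toKernel (hf : ∀ d x, x ∈ X.gr d → f x ∈ unit.gr d) (h1 : A1R.sq1 • x₀ = 0)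
    (h2 : A1R.sq2 • x₀ = 0) (h : unitEquiv (f x₀) = 1) : X →ₗ[A1R] kernel f hf :=
  LinearMap.codRestrict (LinearMap.ker f) (LinearMap.id - (ofUnit x₀ h1 h2).comp f) fun x => by
    rw [LinearMap.mem_ker]
    change f (x - ofUnit x₀ h1 h2 (f x)) = 0
    rw [map_sub, map_ofUnit h, sub_self]

/-- The inclusion of the kernel. -/
noncomputable def kernelIncl (hf : ∀ d x, x ∈ X.gr d → f x ∈ unit.gr d) : kernel f hf →ₗ[A1R] X :=
  (LinearMap.ker f).subtype

theorem map_kernelIncl (k : kernel f hf) : f (kernelIncl hf k) = 0 := k.2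

theorem kernelIncl_toKernel (h : unitEquiv (f x₀) = 1) (x : X) :
    kernelIncl hf (toKernel hf h1 h2 h x) = x - ofUnit x₀ h1 h2 (f x) := rfl

theorem kernelIncl_injective : Function.Injective (kernelIncl hf) := Subtype.val_injective

theorem toKernel_kernelIncl (h : unitEquiv (f x₀) = 1) (k : kernel f hf) :
    toKernel hf h1 h2 h (kernelIncl hf k) = k := by
  apply kernelIncl_injective
  rw [kernelIncl_toKernel, map_kernelIncl, map_zero, sub_zero]

theorem toKernel_self (h : unitEquiv (f x₀) = 1) : toKernel hf h1 h2 h x₀ = 0 := by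
  apply kernelIncl_injective
  rw [kernelIncl_toKernel, ofUnit_apply, h, one_smul, sub_self, map_zero]

/-- A module with a map onto the unit object, split by an element of degree zero killed by `Sq¹`
and `Sq²`, is stably the unit when the kernel of the map is free. -/
theorem stablyEquivalent_unit (hf : ∀ d x, x ∈ X.gr d → f x ∈ unit.gr d)
    (h1 : A1R.sq1 • x₀ = 0) (h2 : A1R.sq2 • x₀ = 0) (hx₀ : x₀ ∈ X.gr 0)
    (h : unitEquiv (f x₀) = 1) {n : ℕ} (φ : kernel f hf ≃ₗ[A1R] (Fin n → A1R)) :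
    X.StablyEquivalent unit := by
  let e : (X.prod zeroModule.{u}) ≃ₗ[A1R] (unit.prod ((kernel f hf).transport φ)) :=
    LinearEquiv.ofLinearMap (M := X × zeroModule.{u}) (M₂ := unit × (Fin n → A1R))
      ((f.prod (φ.toLinearMap.comp (toKernel hf h1 h2 h))).comp
        (LinearMap.fst A1R X zeroModule.{u}))
      ((LinearMap.inl A1R X zeroModule.{u}).comp
        ((ofUnit x₀ h1 h2).coprod ((kernelIncl hf).comp φ.symm.toLinearMap)))
      (LinearMap.ext fun ⟨c, z⟩ => by
        refine Prod.ext ?_ ?_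
        · change f (ofUnit x₀ h1 h2 c + kernelIncl hf (φ.symm z)) = c
          rw [map_add, map_ofUnit h, map_kernelIncl, add_zero]
        · change φ (toKernel hf h1 h2 h (ofUnit x₀ h1 h2 c + kernelIncl hf (φ.symm z))) = z
          rw [map_add, toKernel_kernelIncl, ofUnit_apply]
          change φ (toM2Linear (toKernel hf h1 h2 h) (unitEquiv c • x₀) + φ.symm z) = z
          rw [map_smul, toM2Linear_apply, toKernel_self, smul_zero, zero_add,
            LinearEquiv.apply_symm_apply])
      (LinearMap.ext fun ⟨x, p⟩ => by
        refine Prod.ext ?_ rfl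
        change ofUnit x₀ h1 h2 (f x) + kernelIncl hf (φ.symm (φ (toKernel hf h1 h2 h x))) = x
        rw [LinearEquiv.symm_apply_apply, kernelIncl_toKernel, add_sub_cancel])
  refine ⟨zeroModule, (kernel f hf).transport φ, zeroModule_isFiniteProjective,
    ⟨inferInstanceAs (Module.Finite A1R (Fin n → A1R)),
      inferInstanceAs (Module.Projective A1R (Fin n → A1R))⟩, e, ?_⟩
  rintro d ⟨x, p⟩
  change (f x ∈ unit.gr d ∧ φ.symm (φ (toKernel hf h1 h2 h x)) ∈ (kernel f hf).gr d) ↔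
    (x ∈ X.gr d ∧ p ∈ zeroModule.gr d)
  rw [LinearEquiv.symm_apply_apply]
  have hs : f x ∈ unit.gr d → ofUnit x₀ h1 h2 (f x) ∈ X.gr d := fun hx =>
    smul_mem_gr hx₀ (unitEquiv_mem.2 hx)
  constructor
  · rintro ⟨hx, hk⟩
    change x - ofUnit x₀ h1 h2 (f x) ∈ X.gr d at hk
    refine ⟨?_, Subsingleton.elim (α := PUnit) p 0⟩
    have := add_mem hk (hs hx)
    rwa [sub_add_cancel] at this
  · rintro ⟨hx, -⟩
    exact ⟨hf d x hx, sub_mem (H := X.gr d) hx (hs (hf d x hx))⟩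

/-- If the homology of the reduction is one-dimensional and is carried isomorphically to that of
the unit object, then the reduction of the kernel is acyclic. -/
theorem kernel_redAcyclic (hf : ∀ d x, x ∈ X.gr d → f x ∈ unit.gr d) (h1 : A1R.sq1 • x₀ = 0)
    (h2 : A1R.sq2 • x₀ = 0) (h : unitEquiv (f x₀) = 1) {α : A1R} (hα : IsMargolis α)
    (hX : Module.finrank (ZMod 2) (X.MargolisHomology α) = 1) : (kernel f hf).RedAcyclic α := by
  have hα₀ : α • x₀ = 0 := by
    rcases hα with rfl | rfl | rfl
    · exact h1
    · rw [Q1_smul, h1, h2, smul_zero, smul_zero, add_zero]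
    · exact h2
  have hne : ∀ v, X.reductionAct α v ≠ red x₀ := fun v hv => by
    have h' : redMap f (α • v) = redMap f (red x₀) := congrArg (redMap f) hv
    rw [map_smul, hα.smul_redUnit, redMap_red] at h'
    have h'' := congrArg redUnit h'
    rw [redUnit_red, h, map_zero, map_one] at h''
    exact zero_ne_one h''
  have hi : ∀ v, redMap (toKernel hf h1 h2 h) (redMap (kernelIncl hf) v) = v := fun v => by
    obtain ⟨k, rfl⟩ := red_surjective v
    rw [redMap_red, redMap_red, toKernel_kernelIncl]
  intro v hv
  obtain ⟨s, w, hw⟩ := exists_smul_add_of_homology hX (red x₀)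
    (by rw [reductionAct_apply, smul_red, hα₀, red_zero]) hne (redMap (kernelIncl hf) v)
    (by rw [reductionAct_apply, ← map_smul, hv, map_zero])
  refine ⟨redMap (toKernel hf h1 h2 h) w, ?_⟩
  have h0 : redMap (toKernel hf h1 h2 h) (s • red x₀) = 0 := by
    rcases zmod_two_cases s with rfl | rfl
    · rw [zero_smul, map_zero]
    · rw [one_smul, redMap_red, toKernel_self, red_zero]
  rw [← hi v, hw, reductionAct_apply, map_add, h0, zero_add, map_smul]

/-- The splitting of a module into the unit object and a complement, over `𝔽₂[τ, ρ]`. -/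
noncomputable def kernelProdEquiv (hf : ∀ d x, x ∈ X.gr d → f x ∈ unit.gr d)
    (h1 : A1R.sq1 • x₀ = 0) (h2 : A1R.sq2 • x₀ = 0) (h : unitEquiv (f x₀) = 1) :
    X ≃ₗ[M2] (kernel f hf × M2) :=
  LinearEquiv.ofLinearMap
    ((toM2Linear (toKernel hf h1 h2 h)).prod (unitEquiv.toLinearMap.comp (toM2Linear f)))
    ((toM2Linear (kernelIncl hf)).coprod (LinearMap.toSpanSingleton M2 X x₀))
    (LinearMap.ext fun ⟨k, c⟩ => by
      have e1 : toM2Linear (toKernel hf h1 h2 h) (toM2Linear (kernelIncl hf) k) = k :=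
        toKernel_kernelIncl h k
      have e2 : toM2Linear (toKernel hf h1 h2 h) x₀ = 0 := toKernel_self h
      have e3 : toM2Linear f (toM2Linear (kernelIncl hf) k) = 0 := map_kernelIncl k
      have e4 : unitEquiv (toM2Linear f x₀) = 1 := h
      refine Prod.ext ?_ ?_
      · change toM2Linear (toKernel hf h1 h2 h) (toM2Linear (kernelIncl hf) k + c • x₀) = k
        rw [map_add, e1, map_smul, e2, smul_zero, add_zero]
      · change unitEquiv (toM2Linear f (toM2Linear (kernelIncl hf) k + c • x₀)) = c
        rw [map_add, e3, zero_add, map_smul, map_smul, e4, smul_eq_mul, mul_one])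
    (LinearMap.ext fun x => by
      change kernelIncl hf (toKernel hf h1 h2 h x) + unitEquiv (f x) • x₀ = x
      rw [kernelIncl_toKernel, ofUnit_apply, sub_add_cancel])

/-- The reduction of the module is that of the kernel plus the line spanned by `red x₀`. -/
theorem finrank_reduction_kernel (hX : X.IsFiniteFree)
    (hf : ∀ d x, x ∈ X.gr d → f x ∈ unit.gr d) (h1 : A1R.sq1 • x₀ = 0) (h2 : A1R.sq2 • x₀ = 0)
    (h : unitEquiv (f x₀) = 1) : Module.finrank (ZMod 2) X.Reduction =
      Module.finrank (ZMod 2) (kernel f hf).Reduction + 1 := by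
  have hX' := hX.1
  have := finite_reduction hX'
  have : Module.Finite M2 (kernel f hf) := Module.Finite.of_surjective
    (toM2Linear (toKernel hf h1 h2 h)) fun k => ⟨_, toKernel_kernelIncl h k⟩
  have := finite_reduction this
  let F : X.Reduction →ₗ[ZMod 2] (kernel f hf).Reduction :=
    (redMap (toKernel hf h1 h2 h)).restrictScalars (ZMod 2)
  have hF : Function.Surjective F := fun v => by
    obtain ⟨k, rfl⟩ := red_surjective v
    exact ⟨red (kernelIncl hf k), congrArg red (toKernel_kernelIncl h k)⟩
  have hker : LinearMap.ker F = Submodule.span (ZMod 2) {red x₀} := by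
    refine le_antisymm (fun v hv => ?_) ?_
    · obtain ⟨x, rfl⟩ := red_surjective v
      have h0 : redMap (kernelIncl hf) (F (red x)) = 0 := by
        rw [LinearMap.mem_ker.1 hv, map_zero]
      change red (x - unitEquiv (f x) • x₀) = 0 at h0
      rw [red_sub, sub_eq_zero, red_m2_smul] at h0
      rw [h0]
      exact Submodule.smul_mem _ _ (Submodule.mem_span_singleton_self _)
    · rw [Submodule.span_singleton_le_iff_mem, LinearMap.mem_ker]
      exact congrArg red (toKernel_self h)
  have hne : red x₀ ≠ 0 := fun h0 => by
    have h' := congrArg redUnit (congrArg (redMap f) h0)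
    rw [redMap_red, redUnit_red, h, map_zero, map_zero, map_one] at h'
    exact one_ne_zero h'
  rw [← F.finrank_range_add_finrank_ker, LinearMap.range_eq_top.2 hF, finrank_top, hker,
    finrank_span_singleton hne]

/-- The stable splitting criterion: a module of one-dimensional Margolis homologies with a
degree-preserving split map to the unit object is stably the unit. -/
theorem stablyEquivalent_unit_of_homology (hX : X.IsFiniteFree)
    (hH : ∀ α, IsMargolis α → Module.finrank (ZMod 2) (X.MargolisHomology α) = 1)
    (hf : ∀ d x, x ∈ X.gr d → f x ∈ unit.gr d) (h1 : A1R.sq1 • x₀ = 0) (h2 : A1R.sq2 • x₀ = 0)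
    (hx₀ : x₀ ∈ X.gr 0) (h : unitEquiv (f x₀) = 1) : X.StablyEquivalent unit := by
  obtain ⟨hfin, hfree⟩ := hX
  have : Module.Finite M2 (kernel f hf) := Module.Finite.of_surjective
    (toM2Linear (toKernel hf h1 h2 h)) fun k => ⟨_, toKernel_kernelIncl h k⟩
  have e := kernelProdEquiv hf h1 h2 h
  have hac : ∀ α, IsMargolis α → (kernel f hf).RedAcyclic α := fun α hα =>
    kernel_redAcyclic hf h1 h2 h hα (hH α hα)
  obtain ⟨n, ⟨φ⟩⟩ := exists_linearEquiv_pi (hac _ (Or.inl rfl)) (hac _ (Or.inr (Or.inl rfl)))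
    (hac _ (Or.inr (Or.inr rfl))) (Module.Free.of_equiv e)
    (by rw [← e.finrank_eq, ← finrank_reduction ⟨hfin, hfree⟩,
      finrank_reduction_kernel ⟨hfin, hfree⟩ hf h1 h2 h])
  exact stablyEquivalent_unit hf h1 h2 hx₀ h φ

end Split

/-! ### Invertible modules -/

/-- Margolis homology detects stable equivalence with the unit object. -/
theorem StablyEquivalent.finrank_margolisHomology {X : BigradedModule.{u}}
    (h : X.StablyEquivalent unit) {α : A1R} (hα : IsMargolis α) :
    Module.finrank (ZMod 2) (X.MargolisHomology α) = 1 := by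
  obtain ⟨P, Q, ⟨hP, hP'⟩, ⟨hQ, hQ'⟩, e, -⟩ := h
  rw [finrank_margolisHomology_prod (redExact_of_projective hα P),
    finrank_margolisHomology_congr α e,
    ← finrank_margolisHomology_prod (redExact_of_projective hα Q),
    finrank_margolisHomology_unit hα]

theorem StablyInvertible.finrank_margolisHomology {M : BigradedModule.{u}}
    (h : M.StablyInvertible) {α : A1R} (hα : IsMargolis α) :
    Module.finrank (ZMod 2) (M.MargolisHomology α) = 1 := by
  obtain ⟨N, -, h⟩ := h
  have h' := h.finrank_margolisHomology hα
  rw [finrank_margolisHomology_tensor hα] at h'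
  exact Nat.eq_one_of_mul_eq_one_right h'

/-- A module with one-dimensional Margolis homologies is invertible, with inverse its dual. -/
theorem stablyInvertible_of_homology {M : BigradedModule.{u}} (hM : M.IsFiniteFree)
    (hH : ∀ α, IsMargolis α → Module.finrank (ZMod 2) (M.MargolisHomology α) = 1) :
    M.StablyInvertible := by
  obtain ⟨hfin, hfree⟩ := hM
  have := finite_reduction hfin
  have hdual := dual_isFiniteFree hfree
  let b := Module.finBasis M2 M
  -- the rank is odd, so that the evaluation of the canonical element is `1` in characteristic two
  have hodd : Odd (Module.finrank M2 M) := by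
    rw [← finrank_reduction ⟨hfin, hfree⟩]
    exact odd_finrank_of_homology (M.reductionAct A1R.Q0) sq1_sq1_red (hH _ (Or.inl rfl))
  have hev : unitEquiv (M.eval (M.coev b)) = 1 := by
    rw [unitEquiv_eval_coev, Fintype.card_fin]
    obtain ⟨k, hk⟩ := hodd
    rw [hk]
    push_cast
    linear_combination (k : M2) * M2_add_self 1
  -- the component of degree zero of the canonical element has the same properties
  have h1 : A1R.sq1 • (M.tensor M.dual).proj 0 (M.coev b) = 0 := by
    rw [← proj_smul (M.tensor M.dual).sq1_mem, sq1_smul_coev, map_zero]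
  have h2 : A1R.sq2 • (M.tensor M.dual).proj 0 (M.coev b) = 0 := by
    rw [← proj_smul (M.tensor M.dual).sq2_mem, sq2_smul_coev, map_zero]
  have hone : M.eval (M.coev b) ∈ unit.gr 0 := by
    rw [← unitEquiv_mem, hev]
    simpa using mem_unitGr 0 0 0 (by simp)
  refine ⟨M.dual, hdual, stablyEquivalent_unit_of_homology
    (IsFiniteFree.tensor ⟨hfin, hfree⟩ hdual) (fun α hα => ?_) (fun d t => M.eval_mem) h1 h2
    (proj_mem _ 0 _) ?_⟩
  · rw [finrank_margolisHomology_tensor hα, hH α hα,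
      finrank_margolisHomology_dual hfree hα (hH α hα)]
  · rw [map_proj M.eval (fun d t => M.eval_mem), unit.proj_same 0 _ hone, hev]

end BigradedModule

end RMotivic

theorem mainTheorem2 (M : RMotivic.BigradedModule.{u}) (hM : M.IsFiniteFree) :
    M.StablyInvertible ↔
      (Module.finrank (ZMod 2) (M.MargolisHomology RMotivic.A1R.Q0) = 1 ∧
        Module.finrank (ZMod 2) (M.MargolisHomology RMotivic.A1R.Q1) = 1 ∧
        Module.finrank (ZMod 2) (M.MargolisHomology RMotivic.A1R.sq2) = 1) := by
  constructor
  · intro h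
    exact ⟨h.finrank_margolisHomology (Or.inl rfl),
      h.finrank_margolisHomology (Or.inr (Or.inl rfl)),
      h.finrank_margolisHomology (Or.inr (Or.inr rfl))⟩
  · rintro ⟨h0, h1, h2⟩
    refine RMotivic.BigradedModule.stablyInvertible_of_homology hM ?_
    rintro α (rfl | rfl | rfl)
    exacts [h0, h1, h2]
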